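/- All Lie algebras are finite dimensional over $\mathbb{C}$. For a Lie algebra $L$ let $\mathrm{Int}(L)\subseteq\mathrm{Aut}(L)$ be the group generated by the automorphisms $\exp(\mathrm{ad}\,x)$, $x\in L$. A quasitorus is an abelian algebraic subgroup of $\mathrm{GL}(L)$ consisting of semisimple elements. For a finite quasitorus $T\subseteq\mathrm{Aut}(L)$ with character group $\widehat T$, the grading induced by $T$ is the $\widehat T$-grading $L=\bigoplus_{\alpha}L_\alpha$, $L_\alpha=\{x: t x=\alpha(t)x\ \forall t\in T\}$. For $K=\mathrm{Aut}(L)$ or $K=\mathrm{Int}(L)$, $T$ is a good finite maximal quasitorus in $K$ if it is finite, maximal among the quasitori contained in $K$, $L_0=0$, and every nonzero $L_\alpha$ is one-dimensional. A $G_1$-grading of $L_1$ and a $G_2$-grading of $L_2$ are isomorphic if there are a Lie algebra isomorphism $\varphi:L_1\to L_2$ and a group isomorphism $\psi:G_1\to G_2$ with $\varphi((L_1)_a)=(L_2)_{\psi(a)}$ for all $a$. A finite root system $(G,\beta,R)$ consists of a finite abelian group $G$, an alternating bicharacter $\beta:G\times G\to\mathbb{C}^\times$ with radical $\mathrm{Rad}(\beta)\neq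 G$, and a subset $R\subseteq G\setminus\mathrm{Rad}(\beta)$ generating $G$ such that $-a\in R$ for $a\in R$, and $a+b\in R$ whenever $a,b\in R$ and $\beta(a,b)\ne1$. Isomorphisms of finite root systems are group isomorphisms preserving $\beta$ and $R$. Choose a bimultiplicative $\xi:G\times G\to\mathbb{C}^\times$ with $\beta(a,b)=\xi(a,b)\xi(b,a)^{-1}$; then $L(R)=\bigoplus_{a\in R}\mathbb{C}u_a$ is the Lie algebra with $[u_a,u_b]=(\xi(a,b)-\xi(b,a))u_{a+b}$, and its standard grading is the $G$-grading in which $u_a$ has degree $a$. For $n\ge 2$ and a primitive $n$-th root of unity $\varepsilon$ let $X_n=\mathrm{diag}(\varepsilon^{n-1},\dots,\varepsilon,1)$, let $Y_n$ be the cyclic permutation matrix with ones just above the diagonal and in the lower left corner, and let $P_n$ be the group generated by $X_n$ and $Y_n$. Let $\mathfrak{so}(n)$ be the Lie algebra of skew-symmetric matrices, and $\mathfrak{sp}(2^k)$ that of the form $\varphi_1\otimes\varphi_0^{\otimes(k-1)}$ on $(\mathbb{C}^2)^{\otimes k}$, where $\varphi_1,\varphi_0$ have matrices $\begin{pmatrix}0&1\\-1&0\end{pmatrix}$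 and $I_2$. For a set $A$ of invertible matrices write $\mathrm{Ad}(A)$ for the group generated by $x\mapsto gxg^{-1}$, $g\in A$. Let $D_n$ be the group of diagonal $n\times n$ matrices with entries $\pm1$, and $D_n^1$ its subgroup of matrices of determinant $1$. Let $(L,T)$ be, up to isomorphism of pairs, one of the following. Inner examples: (I) $L=\mathfrak{sl}(n_1\cdots n_k)$, $T=\mathrm{Ad}(P_{n_1}\otimes\cdots\otimes P_{n_k})$, where $k\ge1$, each $n_i>1$, and $n_i\mid n_{i+1}$ for $1\le i<k$; (II) $L=\mathfrak{so}(2k+1)$, $T=\mathrm{Ad}(D^1_{2k+1})$, $k\ge1$; (III) $L=\mathfrak{sp}(2^k)$, $T=\mathrm{Ad}(P_2^{\otimes k})$, $k\ge1$; (IV) $L=\mathfrak{so}(2k)$, $T=\mathrm{Ad}(D^1_{2k})$, $k\ge3$; (V) $L=\mathfrak{so}(2^k)$, $T=\mathrm{Ad}(P_2^{\otimes k})$, $k\ge3$. Outer examples: (I$'$) $L=\mathfrak{sl}(2^k)$, $T=\langle\mathrm{Ad}(P_2^{\otimes k}),\ x\mapsto -x^t\rangle$, $k\ge2$; (IV$'$)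 $L=\mathfrak{so}(2k)$, $T=\mathrm{Ad}(D_{2k})$, $k\ge3$. Then $T$ is a good finite maximal quasitorus, in $\mathrm{Int}(L)$ for the inner examples and in $\mathrm{Aut}(L)$ for the outer examples. Moreover, there is a finite root system $(G,\beta,R)$, unique up to isomorphism, such that $L(R)\cong L$ by an isomorphism of Lie algebras that is an isomorphism from the standard grading of $L(R)$ to the grading induced by $T$. -/

import Mathlib

open scoped DirectSum Matrix

universe u v

/-! ### Bicharacters -/

/-- A bimultiplicative map `G × G → ℂˣ` on an additive abelian group. -/
structure Bicharacter (G : Type u) [AddCommGroup G] where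
  toFun : G → G → ℂˣ
  add_left : ∀ a b c, toFun (a + b) c = toFun a c * toFun b c
  add_right : ∀ a b c, toFun a (b + c) = toFun a b * toFun a c

namespace Bicharacter

variable {G : Type u} [AddCommGroup G]

instance : CoeFun (Bicharacter G) (fun _ => G → G → ℂˣ) := ⟨Bicharacter.toFun⟩

/-- Alternating: `β(a,a) = 1` for all `a`. -/
def IsAlternating (β : Bicharacter G) : Prop := ∀ a, β a a = 1

/-- The radical `Rad(β)`. -/
def radical (β : Bicharacter G) : Set G := {a | ∀ b, β a b = 1}

/-- `Ψ(ξ) = β`, where `Ψ(ξ)(a,b) = ξ(a,b) ξ(b,a)⁻¹`. -/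
def IsLift (ξ β : Bicharacter G) : Prop := ∀ a b, β a b = ξ a b * (ξ b a)⁻¹

theorem map_zero_left (β : Bicharacter G) (a : G) : β 0 a = 1 := by
  have h := β.add_left 0 0 a
  rw [add_zero] at h
  exact left_eq_mul.mp h

theorem map_zero_right (β : Bicharacter G) (a : G) : β a 0 = 1 := by
  have h := β.add_right a 0 0
  rw [add_zero] at h
  exact left_eq_mul.mp h

theorem map_sum_left (β : Bicharacter G) {ι : Type*} (s : Finset ι) (f : ι → G) (b : G) :
    β (∑ i ∈ s, f i) b = ∏ i ∈ s, β (f i) b := by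
  classical
  induction s using Finset.induction_on with
  | empty => simpa using β.map_zero_left b
  | insert i s hi ih => rw [Finset.sum_insert hi, Finset.prod_insert hi, β.add_left, ih]

theorem map_sum_right (β : Bicharacter G) {ι : Type*} (s : Finset ι) (f : ι → G) (b : G) :
    β b (∑ i ∈ s, f i) = ∏ i ∈ s, β b (f i) := by
  classical
  induction s using Finset.induction_on with
  | empty => simpa using β.map_zero_right b
  | insert i s hi ih => rw [Finset.sum_insert hi, Finset.prod_insert hi, β.add_right, ih]

theorem map_nsmul_left (β : Bicharacter G) (n : ℕ) (a b : G) : β (n • a) b = β a b ^ n := by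
  induction n with
  | zero => simpa using β.map_zero_left b
  | succ n ih => rw [succ_nsmul, β.add_left, ih, pow_succ]

theorem map_nsmul_right (β : Bicharacter G) (n : ℕ) (a b : G) : β a (n • b) = β a b ^ n := by
  induction n with
  | zero => simpa using β.map_zero_right a
  | succ n ih => rw [succ_nsmul, β.add_right, ih, pow_succ]

theorem IsAlternating.swap {β : Bicharacter G} (h : β.IsAlternating) (a b : G) :
    β b a = (β a b)⁻¹ := by
  have h1 := h (a + b)
  rw [β.add_left, β.add_right, β.add_right, h a, h b, one_mul, mul_one] at h1
  exact eq_inv_of_mul_eq_one_right h1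

/-- On a finite abelian group every alternating bicharacter is `Ψ(ξ)` for a bicharacter `ξ`. -/
theorem IsAlternating.exists_isLift [Finite G] {β : Bicharacter G} (hβ : β.IsAlternating) :
    ∃ ξ : Bicharacter G, ξ.IsLift β := by
  classical
  obtain ⟨ι, _, p, hp, e, ⟨f⟩⟩ := AddCommGroup.equiv_directSum_zmod_of_finite G
  let n := Fintype.card ι
  let eqv : ι ≃ Fin n := Fintype.equivFin ι
  let π : ι → G → G := fun i a => f.symm (DirectSum.of (fun i => ZMod (p i ^ e i)) i (f a i))
  have π_add : ∀ i a b, π i (a + b) = π i a + π i b := by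
    intro i a b
    simp [π]
  have π_sum : ∀ a, ∑ i, π i a = a := by
    intro a
    apply f.injective
    rw [map_sum]
    simp only [π, AddEquiv.apply_symm_apply]
    ext j
    rw [DFinsupp.finsetSum_apply, Finset.sum_eq_single j]
    · exact DirectSum.of_eq_same _ _
    · intro b _ hb
      exact DirectSum.of_eq_of_ne _ _ _ hb.symm
    · simp
  have π_diag : ∀ i a b, β (π i a) (π i b) = 1 := by
    intro i a b
    have : NeZero (p i ^ e i) := ⟨pow_ne_zero _ (hp i).ne_zero⟩
    let g : G := f.symm (DirectSum.of (fun i => ZMod (p i ^ e i)) i 1)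
    have key : ∀ c, ∃ m : ℕ, π i c = m • g := by
      intro c
      refine ⟨(f c i).val, ?_⟩
      simp only [π, g]
      rw [← map_nsmul, ← map_nsmul, nsmul_one, ZMod.natCast_zmod_val]
    obtain ⟨m, hm⟩ := key a
    obtain ⟨k, hk⟩ := key b
    rw [hm, hk, β.map_nsmul_left, β.map_nsmul_right, hβ g, one_pow, one_pow]
  let χ : ι → ι → G → G → ℂˣ := fun i j a b => if eqv j < eqv i then β (π i a) (π j b) else 1
  refine ⟨⟨fun a b => ∏ i, ∏ j, χ i j a b, ?_, ?_⟩, ?_⟩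
  · intro a b c
    simp only [← Finset.prod_mul_distrib, χ]
    refine Finset.prod_congr rfl fun i _ => Finset.prod_congr rfl fun j _ => ?_
    split_ifs
    · rw [π_add, β.add_left]
    · simp
  · intro a b c
    simp only [← Finset.prod_mul_distrib, χ]
    refine Finset.prod_congr rfl fun i _ => Finset.prod_congr rfl fun j _ => ?_
    split_ifs
    · rw [π_add, β.add_right]
    · simp
  · intro a b
    change β a b = (∏ i, ∏ j, χ i j a b) * (∏ i, ∏ j, χ i j b a)⁻¹
    conv_lhs => rw [← π_sum a, ← π_sum b]
    rw [β.map_sum_left]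
    simp only [β.map_sum_right]
    rw [Finset.prod_comm (f := fun i j => χ i j b a)]
    simp only [← Finset.prod_inv_distrib, ← Finset.prod_mul_distrib]
    refine Finset.prod_congr rfl fun i _ => Finset.prod_congr rfl fun j _ => ?_
    simp only [χ]
    rcases lt_trichotomy (eqv j) (eqv i) with h | h | h
    · rw [if_pos h, if_neg h.asymm, inv_one, mul_one]
    · have hij : j = i := eqv.injective h
      subst hij
      simp [π_diag]
    · rw [if_neg h.asymm, if_pos h, one_mul, hβ.swap (π i a) (π j b), inv_inv]

end Bicharacter

/-! ### The graded Lie algebra of a bicharacter -/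

/-- The vector space `⨁_{a ∈ G} ℂ u_a` underlying the twisted group algebra `ℂ^ξ[G]`
(`u_a = Finsupp.single a 1`), to be regarded as a Lie algebra. -/
def TwistedLie {G : Type u} [AddCommGroup G] (_ξ : Bicharacter G) : Type u := G →₀ ℂ

namespace TwistedLie

variable {G : Type u} [AddCommGroup G] (ξ : Bicharacter G)

noncomputable instance : AddCommGroup (TwistedLie ξ) := inferInstanceAs (AddCommGroup (G →₀ ℂ))

noncomputable instance : Module ℂ (TwistedLie ξ) := inferInstanceAs (Module ℂ (G →₀ ℂ))

/-- The basis vector `u_a`. -/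
noncomputable def u (a : G) : TwistedLie ξ := Finsupp.single a (1 : ℂ)

/-- The basis `(u_a)`. -/
noncomputable def basis : Module.Basis G ℂ (TwistedLie ξ) := Finsupp.basisSingleOne

theorem basis_apply (a : G) : basis ξ a = u ξ a :=
  congrFun Finsupp.coe_basisSingleOne a

/-- The bilinear map with `[u_a, u_b] = (ξ(a,b) - ξ(b,a)) u_{a+b}`. -/
noncomputable def bracket : TwistedLie ξ →ₗ[ℂ] TwistedLie ξ →ₗ[ℂ] TwistedLie ξ :=
  (basis ξ).constr ℂ fun a => (basis ξ).constr ℂ fun b =>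
    ((ξ a b : ℂ) - (ξ b a : ℂ)) • u ξ (a + b)

theorem bracket_u (a b : G) :
    bracket ξ (u ξ a) (u ξ b) = ((ξ a b : ℂ) - (ξ b a : ℂ)) • u ξ (a + b) := by
  rw [bracket, ← basis_apply, ← basis_apply, Module.Basis.constr_basis,
    Module.Basis.constr_basis]

theorem bracket_swap (x y : TwistedLie ξ) : bracket ξ x y = -bracket ξ y x := by
  have h : bracket ξ = -(bracket ξ).flip := by
    refine (basis ξ).ext fun a => (basis ξ).ext fun b => ?_
    simp only [basis_apply, LinearMap.neg_apply, LinearMap.flip_apply, bracket_u]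
    rw [add_comm b a, ← neg_smul, neg_sub]
  conv_lhs => rw [h]
  rfl

theorem eq_zero_of_eq_neg {x : TwistedLie ξ} (h : x = -x) : x = 0 := by
  have h2 : (2 : ℂ) • x = 0 := by
    rw [two_smul]
    exact eq_neg_iff_add_eq_zero.mp h
  exact (smul_eq_zero.mp h2).resolve_left two_ne_zero

theorem induction_u {p : TwistedLie ξ → Prop} (zero : p 0)
    (add : ∀ x y, p x → p y → p (x + y)) (smul : ∀ (r : ℂ) x, p x → p (r • x))
    (basis : ∀ a, p (u ξ a)) (x : TwistedLie ξ) : p x := by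
  refine Finsupp.induction_linear (motive := p) x zero add fun a r => ?_
  have h : (Finsupp.single a r : G →₀ ℂ) = r • Finsupp.single a 1 := by simp
  rw [h]
  exact smul r _ (basis a)

theorem bracket_self (x : TwistedLie ξ) : bracket ξ x x = 0 :=
  eq_zero_of_eq_neg ξ (bracket_swap ξ x x)

theorem bracket_leibniz (x y z : TwistedLie ξ) :
    bracket ξ x (bracket ξ y z) =
      bracket ξ (bracket ξ x y) z + bracket ξ y (bracket ξ x z) := by
  induction x using induction_u with
  | zero => simp
  | add x x' hx hx' => simp only [map_add, LinearMap.add_apply, hx, hx']; abel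
  | smul r x hx => simp only [map_smul, LinearMap.smul_apply, hx, smul_add]
  | basis a =>
  induction y using induction_u with
  | zero => simp
  | add y y' hy hy' => simp only [map_add, LinearMap.add_apply, hy, hy']; abel
  | smul r y hy => simp only [map_smul, LinearMap.smul_apply, hy, smul_add]
  | basis b =>
  induction z using induction_u with
  | zero => simp
  | add z z' hz hz' => simp only [map_add, hz, hz']; abel
  | smul r z hz => simp only [map_smul, hz, smul_add]
  | basis c =>
  simp only [bracket_u, map_smul, LinearMap.smul_apply, smul_smul]
  rw [← add_assoc a b c, show b + (a + c) = a + b + c by abel, ← add_smul]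
  congr 1
  simp only [ξ.add_left, ξ.add_right, Units.val_mul]
  ring

noncomputable instance : LieRing (TwistedLie ξ) where
  bracket x y := bracket ξ x y
  add_lie x y z := by
    change bracket ξ (x + y) z = bracket ξ x z + bracket ξ y z
    simp
  lie_add x y z := map_add (bracket ξ x) y z
  lie_self := bracket_self ξ
  leibniz_lie := bracket_leibniz ξ

noncomputable instance : LieAlgebra ℂ (TwistedLie ξ) where
  lie_smul t x y := map_smul (bracket ξ x) t y

end TwistedLie

/-! ### Finite root systems -/

/-- A finite root system `(G, β, R)`. -/
structure FiniteRootSystem where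
  G : Type u
  [addCommGroup : AddCommGroup G]
  [finite : Finite G]
  β : Bicharacter G
  alternating : β.IsAlternating
  nontrivial : β.radical ≠ Set.univ
  R : Set G
  disjoint_radical : R ⊆ β.radicalᶜ
  generates : AddSubgroup.closure R = ⊤
  neg_closed : ∀ a ∈ R, -a ∈ R
  add_closed : ∀ a ∈ R, ∀ b ∈ R, β a b ≠ 1 → a + b ∈ R

attribute [instance] FiniteRootSystem.addCommGroup FiniteRootSystem.finite

namespace FiniteRootSystem

/-- Isomorphism of finite root systems. -/
def Iso (S : FiniteRootSystem.{u}) (S' : FiniteRootSystem.{v}) : Prop :=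
  ∃ φ : S.G ≃+ S'.G, (∀ a b, S'.β (φ a) (φ b) = S.β a b) ∧ φ '' S.R = S'.R

variable (S : FiniteRootSystem.{u})

/-- Some bicharacter `ξ` with `Ψ(ξ) = β`. -/
noncomputable def ξ : Bicharacter S.G := S.alternating.exists_isLift.choose

theorem ξ_isLift : S.ξ.IsLift S.β := S.alternating.exists_isLift.choose_spec

/-- The underlying space of `L(R)`, `⨁_{a ∈ R} ℂ u_a`, as a subspace of `⨁_{a ∈ G} ℂ u_a`. -/
noncomputable def rootSpan : Submodule ℂ (TwistedLie S.ξ) :=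
  Submodule.span ℂ (TwistedLie.u S.ξ '' S.R)

theorem bracket_mem_rootSpan {x y : TwistedLie S.ξ} (hx : x ∈ S.rootSpan)
    (hy : y ∈ S.rootSpan) : TwistedLie.bracket S.ξ x y ∈ S.rootSpan := by
  induction hx, hy using Submodule.span_induction₂ with
  | mem_mem x y hx hy =>
    obtain ⟨a, ha, rfl⟩ := hx
    obtain ⟨b, hb, rfl⟩ := hy
    rw [TwistedLie.bracket_u]
    by_cases h : S.β a b = 1
    · have h' : S.ξ a b = S.ξ b a := mul_inv_eq_one.mp ((S.ξ_isLift a b).symm.trans h)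
      rw [h', sub_self, zero_smul]
      exact zero_mem _
    · exact Submodule.smul_mem _ _ (Submodule.subset_span ⟨a + b, S.add_closed a ha b hb h, rfl⟩)
  | zero_left y hy => simp
  | zero_right x hx => simp
  | add_left x y z _ _ _ h1 h2 => simpa using Submodule.add_mem _ h1 h2
  | add_right x y z _ _ _ h1 h2 => simpa using Submodule.add_mem _ h1 h2
  | smul_left r x y _ _ h => simpa using Submodule.smul_mem _ r h
  | smul_right r x y _ _ h => simpa using Submodule.smul_mem _ r h

/-- The Lie algebra `L(R)`, with `[u_a, u_b] = (ξ(a,b) - ξ(b,a)) u_{a+b}`. -/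
noncomputable def lieAlgebra : LieSubalgebra ℂ (TwistedLie S.ξ) where
  __ := S.rootSpan
  lie_mem' hx hy := S.bracket_mem_rootSpan hx hy

/-- The standard `G`-grading of `L(R)`: the component of degree `a` is `ℂ u_a` if `a ∈ R`, and
zero otherwise. -/
noncomputable def standardGrading (a : S.G) : Submodule ℂ S.lieAlgebra :=
  Submodule.span ℂ {x | a ∈ S.R ∧ (x : TwistedLie S.ξ) = TwistedLie.u S.ξ a}

end FiniteRootSystem

/-! ### Quasitori in the automorphism group of a Lie algebra, and gradings -/

section Quasitori

variable (L : Type u) [LieRing L] [LieAlgebra ℂ L]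

/-- `Aut(L)`, as a subgroup of `GL(L)`. -/
def lieAut : Subgroup (L ≃ₗ[ℂ] L) where
  carrier := {σ | ∀ x y : L, σ ⁅x, y⁆ = ⁅σ x, σ y⁆}
  one_mem' _ _ := rfl
  mul_mem' {σ τ} hσ hτ x y := by
    change σ (τ ⁅x, y⁆) = ⁅σ (τ x), σ (τ y)⁆
    rw [hτ, hσ]
  inv_mem' {σ} hσ x y := by
    change σ.symm ⁅x, y⁆ = ⁅σ.symm x, σ.symm y⁆
    apply σ.injective
    rw [hσ]
    simp

/-- `Int(L)`: the group generated by the automorphisms `exp(ad x) = ∑ (ad x)ⁿ / n!`, `x ∈ L`.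
As `L` is to be finite dimensional, the series is evaluated through linear functionals. -/
def lieInt : Subgroup (L ≃ₗ[ℂ] L) :=
  Subgroup.closure {σ | ∃ x : L, ∀ (y : L) (f : Module.Dual ℂ L),
    HasSum (fun n : ℕ => ((n.factorial : ℂ)⁻¹) * f (((LieAlgebra.ad ℂ L x) ^ n) y)) (f (σ y))}

variable {L}

/-- Zariski closed subgroups of `GL(L)`: zero sets of polynomials in linear functionals on
`End(L)`, that is, in the matrix entries. -/
def IsZariskiClosed (T : Subgroup (L ≃ₗ[ℂ] L)) : Prop :=
  ∃ P : Set (MvPolynomial (Module.Dual ℂ (Module.End ℂ L)) ℂ), ∀ σ : L ≃ₗ[ℂ] L,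
    σ ∈ T ↔ ∀ p ∈ P, MvPolynomial.eval (fun f => f (σ : Module.End ℂ L)) p = 0

/-- Quasitori in `GL(L)`: abelian algebraic groups consisting of semisimple elements. -/
structure IsQuasitorus (T : Subgroup (L ≃ₗ[ℂ] L)) : Prop where
  closed : IsZariskiClosed T
  comm : ∀ σ ∈ T, ∀ τ ∈ T, σ * τ = τ * σ
  semisimple : ∀ σ ∈ T, Module.End.IsSemisimple (σ : Module.End ℂ L)

/-- The homogeneous component of degree `α` of the grading induced by a finite group `T`; the
grading group is the dual group of `T`, written additively. -/
def inducedGrading (T : Subgroup (L ≃ₗ[ℂ] L)) (α : Additive (T →* ℂˣ)) : Submodule ℂ L where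
  carrier := {x | ∀ t : T, (t : L ≃ₗ[ℂ] L) x = ((α.toMul t : ℂˣ) : ℂ) • x}
  zero_mem' t := by simp
  add_mem' {x y} hx hy t := by rw [map_add, hx t, hy t, smul_add]
  smul_mem' c x hx t := by rw [map_smul, hx t, smul_comm]

/-- Good finite maximal quasitori in `K`, where `K` is `Aut(L)` or `Int(L)`: finite, maximal among
the quasitori contained in `K`, and such that in the induced grading `0` is not in the support
and every nonzero homogeneous component is one-dimensional. -/
structure IsGoodFiniteMaximalQuasitorus (K T : Subgroup (L ≃ₗ[ℂ] L)) : Prop where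
  finite : Finite T
  maximal : Maximal (fun S : Subgroup (L ≃ₗ[ℂ] L) => S ≤ K ∧ IsQuasitorus S) T
  zero_component : inducedGrading T 0 = ⊥
  one_dimensional : ∀ α, inducedGrading T α ≠ ⊥ → Module.finrank ℂ (inducedGrading T α) = 1

/-- Isomorphism of group gradings. -/
def GradingIso {L₁ : Type u} [LieRing L₁] [LieAlgebra ℂ L₁] {L₂ : Type v} [LieRing L₂]
    [LieAlgebra ℂ L₂] {G₁ : Type*} [AddCommGroup G₁] {G₂ : Type*} [AddCommGroup G₂]
    (Γ₁ : G₁ → Submodule ℂ L₁) (Γ₂ : G₂ → Submodule ℂ L₂) : Prop :=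
  ∃ (φ : L₁ ≃ₗ⁅ℂ⁆ L₂) (ψ : G₁ ≃+ G₂),
    ∀ a, (Γ₁ a).map (φ.toLinearEquiv : L₁ →ₗ[ℂ] L₂) = Γ₂ (ψ a)

/-- `S = (G, β, R)` corresponds to `(L, T)`: there is a Lie algebra isomorphism `L(R) ≅ L` which is
an isomorphism from the standard grading to the grading induced by `T`. -/
def FiniteRootSystem.CorrespondsTo (S : FiniteRootSystem.{v}) (T : Subgroup (L ≃ₗ[ℂ] L)) : Prop :=
  GradingIso S.standardGrading (inducedGrading T)

/-- `(L, T)` and `(L', T')` are isomorphic pairs. -/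
def PairIso {L' : Type v} [LieRing L'] [LieAlgebra ℂ L'] (T : Subgroup (L ≃ₗ[ℂ] L))
    (T' : Subgroup (L' ≃ₗ[ℂ] L')) : Prop :=
  ∃ e : L ≃ₗ⁅ℂ⁆ L', ∀ σ : L ≃ₗ[ℂ] L,
    σ ∈ T ↔ e.toLinearEquiv.symm ≪≫ₗ σ ≪≫ₗ e.toLinearEquiv ∈ T'

end Quasitori

/-! ### The examples -/

section Examples

attribute [local instance] LieRing.ofAssociativeRing

/-- The matrix `X_n = diag(ε^(n-1), …, ε, 1)`. -/
def pauliX (n : ℕ) (ε : ℂ) : Matrix (Fin n) (Fin n) ℂ :=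
  Matrix.diagonal fun p => ε ^ (n - 1 - (p : ℕ))

/-- The cyclic permutation matrix `Y_n`, with entries `1` just above the diagonal and in the
lower left corner. -/
def pauliY (n : ℕ) : Matrix (Fin n) (Fin n) ℂ :=
  Matrix.of fun p q => if (q : ℕ) = ((p : ℕ) + 1) % n then 1 else 0

/-- The group `P_n` generated by `X_n` and `Y_n`. -/
def pauliGroup (n : ℕ) (ε : ℂ) : Subgroup (GL (Fin n) ℂ) :=
  Subgroup.closure {g | (g : Matrix (Fin n) (Fin n) ℂ) = pauliX n ε ∨
    (g : Matrix (Fin n) (Fin n) ℂ) = pauliY n}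

/-- The Kronecker product `A_1 ⊗ … ⊗ A_k`, with rows and columns indexed by tuples. -/
def kroneckerProd {k : ℕ} {n : Fin k → ℕ} (A : ∀ i, Matrix (Fin (n i)) (Fin (n i)) ℂ) :
    Matrix (∀ i, Fin (n i)) (∀ i, Fin (n i)) ℂ :=
  Matrix.of fun p q => ∏ i, A i (p i) (q i)

/-- The set `P_{n_1} ⊗ … ⊗ P_{n_k}` of matrices of size `n_1 ⋯ n_k`. -/
def pauliTensor {k : ℕ} (n : Fin k → ℕ) (ε : Fin k → ℂ) :
    Set (Matrix (∀ i, Fin (n i)) (∀ i, Fin (n i)) ℂ) :=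
  {M | ∃ A : ∀ i, GL (Fin (n i)) ℂ, (∀ i, A i ∈ pauliGroup (n i) (ε i)) ∧
    M = kroneckerProd fun i => (A i : Matrix (Fin (n i)) (Fin (n i)) ℂ)}

/-- Diagonal matrices with entries `±1`. -/
def diagSigns (n : ℕ) : Set (Matrix (Fin n) (Fin n) ℂ) :=
  {M | ∃ d : Fin n → ℂ, (∀ i, d i = 1 ∨ d i = -1) ∧ M = Matrix.diagonal d}

/-- Diagonal matrices with entries `±1` and determinant one. -/
def specialDiagSigns (n : ℕ) : Set (Matrix (Fin n) (Fin n) ℂ) :=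
  {M | M ∈ diagSigns n ∧ M.det = 1}

/-- For a Lie algebra `L` of matrices, the group generated by the maps `Ad g : x ↦ g x g⁻¹` of `L`
onto itself with `g` in the set `A` of matrices. -/
noncomputable def adGroup {ι : Type} [Fintype ι] [DecidableEq ι]
    (L : LieSubalgebra ℂ (Matrix ι ι ℂ)) (A : Set (Matrix ι ι ℂ)) : Subgroup (L ≃ₗ[ℂ] L) :=
  Subgroup.closure {σ | ∃ g ∈ A, IsUnit g ∧
    ∀ x : L, ((σ x : L) : Matrix ι ι ℂ) = g * (x : Matrix ι ι ℂ) * g⁻¹}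

/-- The group generated by `τ : x ↦ -xᵗ` on a Lie algebra of matrices. -/
def negTransposeGroup {ι : Type} [Fintype ι] [DecidableEq ι]
    (L : LieSubalgebra ℂ (Matrix ι ι ℂ)) : Subgroup (L ≃ₗ[ℂ] L) :=
  Subgroup.closure {σ | ∀ x : L, ((σ x : L) : Matrix ι ι ℂ) = -(x : Matrix ι ι ℂ)ᵀ}

/-- The matrix of the skew-symmetric form `φ₁ ⊗ φ₀ ⊗ … ⊗ φ₀` on `(ℂ²)^{⊗k}`, where `φ₁` has matrix
`(0 1; -1 0)` and `φ₀` has matrix `I₂`. -/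
def symplecticForm (k : ℕ) : Matrix (Fin k → Fin 2) (Fin k → Fin 2) ℂ :=
  kroneckerProd (n := fun _ => 2) fun i => if (i : ℕ) = 0 then !![0, 1; -1, 0] else 1

variable {L : Type u} [LieRing L] [LieAlgebra ℂ L]

/-- The examples `(L, T)` in which `T` consists of inner automorphisms, up to isomorphism. -/
inductive IsInnerExample (T : Subgroup (L ≃ₗ[ℂ] L)) : Prop
  /-- Type `I(n_1, …, n_k)`: `sl(n_1 ⋯ n_k)`, generalized Pauli matrices. -/
  | typeI (k : ℕ) (n : Fin k → ℕ) (ε : Fin k → ℂ) (hk : 1 ≤ k) (hn : ∀ i, 1 < n i)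
      (hdvd : ∀ i j, i ≤ j → n i ∣ n j) (hε : ∀ i, IsPrimitiveRoot (ε i) (n i))
      (h : PairIso T (adGroup (LieAlgebra.SpecialLinear.sl (∀ i, Fin (n i)) ℂ) (pauliTensor n ε)))
  /-- Type `II(k)`: `so(2k+1)`, diagonal sign matrices in `SO(2k+1)`. -/
  | typeII (k : ℕ) (hk : 1 ≤ k)
      (h : PairIso T (adGroup (LieAlgebra.Orthogonal.so (Fin (2 * k + 1)) ℂ)
        (specialDiagSigns (2 * k + 1))))
  /-- Type `III(k)`: `sp(2^k)`, Pauli matrices. -/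
  | typeIII (k : ℕ) (hk : 1 ≤ k)
      (h : PairIso T (adGroup (skewAdjointMatricesLieSubalgebra (symplecticForm k))
        (pauliTensor (fun _ : Fin k => 2) (fun _ => -1))))
  /-- Type `IV(k)`: `so(2k)`, diagonal sign matrices in `SO(2k)`. -/
  | typeIV (k : ℕ) (hk : 3 ≤ k)
      (h : PairIso T (adGroup (LieAlgebra.Orthogonal.so (Fin (2 * k)) ℂ)
        (specialDiagSigns (2 * k))))
  /-- Type `V(k)`: `so(2^k)`, Pauli matrices. -/
  | typeV (k : ℕ) (hk : 3 ≤ k)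
      (h : PairIso T (adGroup (LieAlgebra.Orthogonal.so (Fin k → Fin 2) ℂ)
        (pauliTensor (fun _ : Fin k => 2) (fun _ => -1))))

/-- The examples `(L, T)` in which `T` contains outer automorphisms, up to isomorphism. -/
inductive IsOuterExample (T : Subgroup (L ≃ₗ[ℂ] L)) : Prop
  /-- Type `I'(2, …, 2)`: `sl(2^k)`, Pauli matrices and `x ↦ -xᵗ`. -/
  | typeI' (k : ℕ) (hk : 2 ≤ k)
      (h : PairIso T (adGroup (LieAlgebra.SpecialLinear.sl (Fin k → Fin 2) ℂ)
          (pauliTensor (fun _ : Fin k => 2) (fun _ => -1)) ⊔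
        negTransposeGroup (LieAlgebra.SpecialLinear.sl (Fin k → Fin 2) ℂ)))
  /-- Type `IV'(k)`: `so(2k)`, all diagonal sign matrices. -/
  | typeIV' (k : ℕ) (hk : 3 ≤ k)
      (h : PairIso T (adGroup (LieAlgebra.Orthogonal.so (Fin (2 * k)) ℂ) (diagSigns (2 * k))))

end Examples

-- The setting is the twisted group algebra ℂ^ξ[G] with u_a u_b = ξ(a,b) u_{a+b}, whose commutator
-- Lie algebra contains L(R). Each example is brought to the form `Realizes`: L embeds with image
-- the span of the u_a, a ∈ R, and T becomes the group of all maps u_a ↦ χ(a) u_a with χ a character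
-- of G. By duality of finite abelian groups G is the dual of T, and the grading induced by T is the
-- standard one (`Realizes.correspondsTo`). Its components are the lines ℂ u_a, so whatever commutes
-- with T is diagonal; maximality is then the question which diagonal maps lie in Int(L) or Aut(L)
-- (`isGood_of_basis`).
--
-- For Int(L), exp(ad x) is conjugation by exp x in the associative algebra, so inner automorphisms
-- extend to associative automorphisms (`exists_mulEquiv_of_mem_lieInt`), and the eigenvalues of a
-- diagonal one form a character. Conversely, if β is nondegenerate, every character is some β(a,·),
-- that is, conjugation by u_a; a logarithm of u_a is a polynomial in u_a and lies in L modulo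
-- scalars if R contains the nonzero multiples of a (`mem_lieInt_of_diag`). For Aut(L), a diagonal
-- automorphism is multiplicative only on the pairs of roots that do not commute, and one has to
-- show that this already forces a character: directly for so(2k), and by `exists_eq_mul_of_mul` for
-- sl(2^k).
--
-- There are two sources of realizations. For diagonal sign matrices, so(n) sits in a Clifford
-- algebra as quadratic expressions in generators, and pairwise anticommuting u_a provide the
-- generators (`CliffordFamily`). For Pauli matrices, the monomials in the X's and Y's form a basis
-- of the matrix algebra with v_a v_c = γ(a,c) v_{a+c} (`WeylFamily`); γ agrees with ξ up to a
-- symmetric cocycle, which is a coboundary (`exists_coboundary_of_symm`). If all factors have size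
-- two, transposition acts by the signs of a quadratic form q with polar form β (`quadraticPair`).
-- Translates of q cut out so and sp, and the outer example on sl lives on V × ℤ/2 with roots (a,
-- q(a) + 1).
--
-- Uniqueness compares structure constants. On an elementary 2-group β takes values ±1 and is
-- determined by which brackets vanish. For type I, the moduli of the structure constants determine
-- |β(a,b) - 1|, hence β(a,b) up to inversion; the inversion is uniform, and it is undone by
-- exchanging the exponents of X and Y (`iso_of_gradingIso_of_forall_mem`).

universe w

/-! ### The twisted group algebra -/

namespace TwistedLie

variable {G : Type u} [AddCommGroup G] (ξ : Bicharacter G)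

/-- The product of the twisted group algebra, `u_a u_b = ξ(a,b) u_{a+b}`. -/
noncomputable def mul : TwistedLie ξ →ₗ[ℂ] TwistedLie ξ →ₗ[ℂ] TwistedLie ξ :=
  (basis ξ).constr ℂ fun a => (basis ξ).constr ℂ fun b => (ξ a b : ℂ) • u ξ (a + b)

theorem mul_apply_u (a b : G) : mul ξ (u ξ a) (u ξ b) = (ξ a b : ℂ) • u ξ (a + b) := by
  rw [mul, ← basis_apply, ← basis_apply, Module.Basis.constr_basis, Module.Basis.constr_basis]

theorem mul_assoc_aux (x y z : TwistedLie ξ) :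
    mul ξ (mul ξ x y) z = mul ξ x (mul ξ y z) := by
  induction x using induction_u with
  | zero => simp
  | add x x' hx hx' => simp only [map_add, LinearMap.add_apply, hx, hx']
  | smul r x hx => simp only [map_smul, LinearMap.smul_apply, hx]
  | basis a =>
  induction y using induction_u with
  | zero => simp
  | add y y' hy hy' => simp only [map_add, LinearMap.add_apply, hy, hy']
  | smul r y hy => simp only [map_smul, LinearMap.smul_apply, hy]
  | basis b =>
  induction z using induction_u with
  | zero => simp
  | add z z' hz hz' => simp only [map_add, hz, hz']
  | smul r z hz => simp only [map_smul, hz]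
  | basis c =>
  simp only [mul_apply_u, map_smul, LinearMap.smul_apply, smul_smul]
  rw [← add_assoc a b c]
  congr 1
  simp only [ξ.add_left, ξ.add_right, Units.val_mul]
  ring

theorem one_mul_aux (x : TwistedLie ξ) : mul ξ (u ξ 0) x = x := by
  induction x using induction_u with
  | zero => simp
  | add x x' hx hx' => simp only [map_add, hx, hx']
  | smul r x hx => simp only [map_smul, hx]
  | basis a => rw [mul_apply_u, ξ.map_zero_left, zero_add, Units.val_one, one_smul]

theorem mul_one_aux (x : TwistedLie ξ) : mul ξ x (u ξ 0) = x := by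
  induction x using induction_u with
  | zero => simp
  | add x x' hx hx' => simp only [map_add, LinearMap.add_apply, hx, hx']
  | smul r x hx => simp only [map_smul, LinearMap.smul_apply, hx]
  | basis a => rw [mul_apply_u, ξ.map_zero_right, add_zero, Units.val_one, one_smul]

/-- The twisted group algebra `ℂ^ξ[G]` as a ring. -/
noncomputable abbrev ring : Ring (TwistedLie ξ) where
  __ := (inferInstance : AddCommGroup (TwistedLie ξ))
  mul x y := mul ξ x y
  one := u ξ 0
  left_distrib x y z := map_add (mul ξ x) y z
  right_distrib x y z := by
    change mul ξ (x + y) z = mul ξ x z + mul ξ y z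
    simp
  zero_mul x := by
    change mul ξ 0 x = 0
    simp
  mul_zero x := map_zero (mul ξ x)
  mul_assoc := mul_assoc_aux ξ
  one_mul := one_mul_aux ξ
  mul_one := mul_one_aux ξ

section Ring

attribute [local instance] TwistedLie.ring

/-- The twisted group algebra `ℂ^ξ[G]` as a `ℂ`-algebra. -/
noncomputable abbrev algebra : Algebra ℂ (TwistedLie ξ) :=
  Algebra.ofModule
    (fun r x y => by
      change mul ξ (r • x) y = r • mul ξ x y
      simp)
    (fun r x y => map_smul (mul ξ x) r y)

attribute [local instance] TwistedLie.algebra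

variable {ξ}

theorem u_mul_u (a b : G) : u ξ a * u ξ b = (ξ a b : ℂ) • u ξ (a + b) := mul_apply_u ξ a b

theorem one_def : (1 : TwistedLie ξ) = u ξ 0 := rfl

theorem lie_u (a b : G) : ⁅u ξ a, u ξ b⁆ = ((ξ a b : ℂ) - (ξ b a : ℂ)) • u ξ (a + b) :=
  bracket_u ξ a b

theorem u_ne_zero (a : G) : u ξ a ≠ 0 := by
  rw [← basis_apply]
  exact (basis ξ).ne_zero a

theorem lie_eq_sub (x y : TwistedLie ξ) : ⁅x, y⁆ = x * y - y * x := by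
  induction x using induction_u with
  | zero => simp
  | add x x' hx hx' => rw [add_lie, hx, hx']; noncomm_ring
  | smul r x hx => rw [smul_lie, hx, smul_sub, smul_mul_assoc, mul_smul_comm]
  | basis a =>
  induction y using induction_u with
  | zero => simp
  | add y y' hy hy' => rw [lie_add, hy, hy']; noncomm_ring
  | smul r y hy => rw [lie_smul, hy, smul_sub, smul_mul_assoc, mul_smul_comm]
  | basis b => rw [u_mul_u, u_mul_u, lie_u, add_comm b a, sub_smul]

theorem u_mul_comm {β : Bicharacter G} (h : ξ.IsLift β) (a b : G) :
    u ξ a * u ξ b = (β a b : ℂ) • (u ξ b * u ξ a) := by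
  rw [u_mul_u, u_mul_u, smul_smul, add_comm b a, h a b, ← Units.val_mul]
  simp

theorem isUnit_u (a : G) : IsUnit (u ξ a) := by
  have h1 : u ξ a * u ξ (-a) = (ξ a (-a) : ℂ) • 1 := by rw [u_mul_u, add_neg_cancel, one_def]
  have h2 : u ξ (-a) * u ξ a = (ξ (-a) a : ℂ) • 1 := by rw [u_mul_u, neg_add_cancel, one_def]
  -- Both values are inverse to ξ(a,a), so the left and the right inverse of u_a carry the same
  -- scalar.
  have h3 : ξ (-a) a = ξ a (-a) := by
    have e2 := ξ.add_right a a (-a)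
    have e3 := ξ.add_left a (-a) a
    rw [add_neg_cancel, ξ.map_zero_left] at e3
    rw [add_neg_cancel, ξ.map_zero_right] at e2
    exact mul_left_cancel (e3.symm.trans e2)
  refine ⟨⟨u ξ a, ((ξ a (-a))⁻¹ : ℂˣ) • u ξ (-a), ?_, ?_⟩, rfl⟩
  · rw [Units.smul_def, mul_smul_comm, h1, smul_smul, ← Units.val_mul]
    simp
  · rw [Units.smul_def, smul_mul_assoc, h2, h3, smul_smul, ← Units.val_mul]
    simp

end Ring

/-- The linear map `u_a ↦ χ(a) u_a`. -/
noncomputable def diag (χ : G → ℂˣ) : TwistedLie ξ →ₗ[ℂ] TwistedLie ξ :=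
  (basis ξ).constr ℂ fun a => (χ a : ℂ) • u ξ a

variable {ξ}

@[simp]
theorem diag_u (χ : G → ℂˣ) (a : G) : diag ξ χ (u ξ a) = (χ a : ℂ) • u ξ a := by
  rw [diag, ← basis_apply, Module.Basis.constr_basis, basis_apply]

theorem ext_u {M : Type*} [AddCommGroup M] [Module ℂ M] {f g : TwistedLie ξ →ₗ[ℂ] M}
    (h : ∀ a, f (u ξ a) = g (u ξ a)) : f = g :=
  (basis ξ).ext fun a => by rw [basis_apply, h]

theorem diag_diag (χ χ' : G → ℂˣ) (x : TwistedLie ξ) :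
    diag ξ χ (diag ξ χ' x) = diag ξ (fun a => χ a * χ' a) x := by
  have : diag ξ χ ∘ₗ diag ξ χ' = diag ξ (fun a => χ a * χ' a) :=
    ext_u fun a => by simp [smul_smul, mul_comm]
  exact LinearMap.congr_fun this x

theorem diag_one (x : TwistedLie ξ) : diag ξ (fun _ => 1) x = x := by
  have : diag ξ (fun _ => 1) = LinearMap.id := ext_u fun a => by simp
  exact LinearMap.congr_fun this x

end TwistedLie

/-- A symmetric bicharacter of a finite group is a coboundary. -/
theorem Bicharacter.exists_coboundary_of_symm {G : Type u} [AddCommGroup G] [Finite G]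
    (s : Bicharacter G) (hs : ∀ a b, s a b = s b a) :
    ∃ c : G → ℂˣ, ∀ a b, c a * c b = s a b * c (a + b) := by
  let _ := TwistedLie.ring s
  let _ := TwistedLie.algebra s
  -- Symmetry of s makes the twisted group algebra commutative. A maximal ideal has residue field ℂ
  -- by finite dimensionality, and the values of the resulting algebra character on the units u_a
  -- are the required cochain.
  have hcomm : ∀ x y : TwistedLie s, x * y = y * x := by
    intro x y
    have : ⁅x, y⁆ = 0 := by
      have h0 : TwistedLie.bracket s = 0 := TwistedLie.ext_u fun a => TwistedLie.ext_u fun b => by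
        rw [TwistedLie.bracket_u, hs a b]; simp
      change TwistedLie.bracket s x y = 0
      rw [h0]; rfl
    rw [TwistedLie.lie_eq_sub] at this
    exact sub_eq_zero.mp this
  let _ : CommRing (TwistedLie s) := { TwistedLie.ring s with mul_comm := hcomm }
  have : Nontrivial (TwistedLie s) := ⟨⟨_, _, TwistedLie.u_ne_zero (ξ := s) 0⟩⟩
  have : Module.Finite ℂ (TwistedLie s) := Module.Finite.of_basis (TwistedLie.basis s)
  obtain ⟨I, hI⟩ := Ideal.exists_maximal (TwistedLie s)
  let _ := Ideal.Quotient.field I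
  have hbij : Function.Bijective (algebraMap ℂ (TwistedLie s ⧸ I)) :=
    IsAlgClosed.algebraMap_bijective_of_isIntegral
  let e := (RingEquiv.ofBijective _ hbij).symm
  let θ : TwistedLie s →+* ℂ := e.toRingHom.comp (Ideal.Quotient.mk I)
  have hθ : ∀ r : ℂ, θ (algebraMap ℂ (TwistedLie s) r) = r := by
    intro r
    change e (Ideal.Quotient.mk I (algebraMap ℂ (TwistedLie s) r)) = r
    rw [RingEquiv.symm_apply_eq]
    rfl
  refine ⟨fun a => ((TwistedLie.isUnit_u (ξ := s) a).map θ).unit, fun a b => ?_⟩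
  ext
  simp only [Units.val_mul, IsUnit.unit_spec]
  rw [← map_mul]
  erw [TwistedLie.u_mul_u]
  rw [Algebra.smul_def, map_mul, hθ]

/-! ### Exponentials of inner derivations -/

section Exponential

theorem hasSum_of_forall_eq {f g : ℕ → ℂ} {a : ℂ} (h : HasSum f a) (hfg : ∀ n, f n = g n) :
    HasSum g a :=
  funext hfg ▸ h

variable {V : Type u} [AddCommGroup V] [Module ℂ V]

/-- The exponential of endomorphisms of a finite dimensional space, as determined by its power
series, with its commutation properties. -/
theorem exists_endExp [FiniteDimensional ℂ V] :
    ∃ E : Module.End ℂ V → Module.End ℂ V,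
      (∀ (D : Module.End ℂ V) (y : V) (f : Module.Dual ℂ V),
        HasSum (fun n : ℕ => ((n.factorial : ℂ)⁻¹) * f ((D ^ n) y)) (f (E D y))) ∧
      (∀ D D', Commute D D' → E (D + D') = E D * E D') ∧
      (∀ D D', Commute D D' → Commute (E D) D') := by
  let b := Module.finBasis ℂ V
  -- The norm pulled back from coordinates is auxiliary: it makes the operator exponential
  -- available, and the description through linear functionals does not refer to it.
  let _ : NormedAddCommGroup V :=
    NormedAddCommGroup.induced V (Fin (Module.finrank ℂ V) → ℂ) b.equivFun b.equivFun.injective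
  let _ : NormedSpace ℂ V := NormedSpace.induced ℂ V (Fin (Module.finrank ℂ V) → ℂ) b.equivFun
  have hc : CompleteSpace V := FiniteDimensional.complete ℂ V
  let C : Module.End ℂ V ≃ₗ[ℂ] (V →L[ℂ] V) := LinearMap.toContinuousLinearMap
  have hC : ∀ D y, C D y = D y := fun _ _ => rfl
  have hpow : ∀ D y (n : ℕ), (C D ^ n) y = (D ^ n) y := by
    intro D y n
    induction n with
    | zero => rfl
    | succ n ih => rw [pow_succ', pow_succ', mul_apply_eq_comp, ih, hC]; rfl
  have hcomm : ∀ D D', Commute D D' → Commute (C D) (C D') := by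
    intro D D' h
    ext y
    exact LinearMap.congr_fun h y
  refine ⟨fun D => (NormedSpace.exp (C D) : V →L[ℂ] V), ?_, ?_, ?_⟩
  · intro D y f
    have h := NormedSpace.exp_series_hasSum_exp' (𝕂 := ℂ) (C D)
    have h2 := h.mapL ((LinearMap.toContinuousLinearMap f).comp (ContinuousLinearMap.apply ℂ V y))
    refine hasSum_of_forall_eq h2 fun n => ?_
    change (LinearMap.toContinuousLinearMap f) ((n.factorial : ℂ)⁻¹ • (C D ^ n) y) = _
    rw [hpow, map_smul, smul_eq_mul]
    rfl
  · intro D D' h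
    let _ : NormedAlgebra ℚ (V →L[ℂ] V) := NormedAlgebra.restrictScalars ℚ ℂ _
    have := NormedSpace.exp_add_of_commute (hcomm D D' h)
    rw [← map_add] at this
    ext y
    exact DFunLike.congr_fun this y
  · intro D D' h
    have := (hcomm D D' h).exp_left
    ext y
    exact DFunLike.congr_fun this y

/-- On an eigenvector the series is that of the scalar exponential; comparing exp(ad x) with a
diagonal map thereby reduces to comparing eigenvalues. -/
theorem hasSum_of_eigenvector {D : Module.End ℂ V} {w : V} {μ : ℂ} (hw : D w = μ • w)
    (f : Module.Dual ℂ V) :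
    HasSum (fun n : ℕ => ((n.factorial : ℂ)⁻¹) * f ((D ^ n) w)) (f (Complex.exp μ • w)) := by
  have hpow : ∀ n : ℕ, (D ^ n) w = μ ^ n • w := by
    intro n
    induction n with
    | zero => simp
    | succ n ih => rw [pow_succ', Module.End.mul_apply, ih, map_smul, hw, smul_smul, pow_succ]
  have h := (NormedSpace.exp_series_hasSum_exp' (𝕂 := ℂ) μ).mul_right (f w)
  rw [map_smul, smul_eq_mul, Complex.exp_eq_exp_ℂ]
  refine hasSum_of_forall_eq h fun n => ?_
  rw [hpow, map_smul, smul_eq_mul, smul_eq_mul, mul_assoc]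

/-- An element of finite order of a complex algebra is a combination of orthogonal idempotents, and
the idempotents are polynomials in the element. -/
theorem exists_spectral_idempotents {A : Type*} [Ring A] [Algebra ℂ A] {v : A} {m : ℕ}
    (hm : 0 < m) (hv : v ^ m = 1) {ζ : ℂ} (hζ : IsPrimitiveRoot ζ m) :
    ∃ e : ℕ → A, (∀ i, v * e i = ζ ^ i • e i) ∧ (∀ i, e i * v = ζ ^ i • e i) ∧
      (∑ i ∈ Finset.range m, e i = 1) ∧
      (∀ i ∈ Finset.range m, ∀ k ∈ Finset.range m, e i * e k = if i = k then e k else 0) ∧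
      (∀ i, e i ∈ Submodule.span ℂ (Set.range fun j : ℕ => v ^ j)) := by
  have hζ0 : ζ ≠ 0 := hζ.ne_zero hm.ne'
  have hm0 : (m : ℂ) ≠ 0 := Nat.cast_ne_zero.mpr hm.ne'
  let z : ℕ → A := fun i => (ζ ^ i)⁻¹ • v
  have hz : ∀ i, z i ^ m = 1 := by
    intro i
    simp only [z]
    rw [smul_pow, hv, inv_pow, ← pow_mul, mul_comm, pow_mul, hζ.pow_eq_one]
    simp
  have hvz : ∀ i, v = ζ ^ i • z i := fun i => by
    simp only [z]; rw [smul_smul, mul_inv_cancel₀ (pow_ne_zero _ hζ0), one_smul]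
  -- Averaging the powers of ζ^{-i} v gives the projection to the eigenvalue ζ^i of v, a discrete
  -- Fourier transform.
  let e : ℕ → A := fun i => (m : ℂ)⁻¹ • ∑ j ∈ Finset.range m, z i ^ j
  have h1 : ∀ i, v * e i = ζ ^ i • e i := by
    intro i
    have := mul_geom_sum (z i) m
    rw [hz, sub_self, sub_mul, one_mul, sub_eq_zero] at this
    simp only [e]
    rw [mul_smul_comm, smul_comm]
    congr 1
    conv_lhs => rw [hvz i]
    rw [smul_mul_assoc, this]
  have h2 : ∀ i, e i * v = ζ ^ i • e i := by
    intro i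
    have := geom_sum_mul (z i) m
    rw [hz, sub_self, mul_sub, mul_one, sub_eq_zero] at this
    simp only [e]
    rw [smul_mul_assoc, smul_comm]
    congr 1
    conv_lhs => rw [hvz i]
    rw [mul_smul_comm, this]
  have hgeom : ∀ t : ℂ, t ^ m = 1 → t ≠ 1 → ∑ j ∈ Finset.range m, t ^ j = 0 := by
    intro t ht ht1
    have := mul_geom_sum t m
    rw [ht, sub_self] at this
    exact (mul_eq_zero.mp this).resolve_left (sub_ne_zero.mpr ht1)
  have hroot : ∀ i : ℕ, (ζ ^ i) ^ m = 1 := fun i => by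
    rw [← pow_mul, mul_comm, pow_mul, hζ.pow_eq_one, one_pow]
  refine ⟨e, h1, h2, ?_, ?_, ?_⟩
  · simp only [e, z]
    rw [← Finset.smul_sum, Finset.sum_comm, Finset.sum_eq_single 0]
    · simp only [pow_zero, Finset.sum_const, Finset.card_range]
      rw [← Nat.cast_smul_eq_nsmul ℂ, smul_smul, inv_mul_cancel₀ hm0, one_smul]
    · intro j hj hj0
      have : ∀ i, ((ζ ^ i)⁻¹ • v) ^ j = ((ζ ^ j)⁻¹) ^ i • v ^ j := by
        intro i
        rw [smul_pow, inv_pow, inv_pow, ← pow_mul, ← pow_mul, mul_comm]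
      simp only [this]
      rw [← Finset.sum_smul, hgeom, zero_smul]
      · rw [inv_pow, hroot, inv_one]
      · intro h
        exact hζ.pow_ne_one_of_pos_of_lt hj0 (Finset.mem_range.mp hj) (inv_eq_one.mp h)
    · intro h
      exact absurd (Finset.mem_range.mpr hm) h
  · intro i hi k hk
    have hpow : ∀ j : ℕ, z i ^ j * e k = ((ζ ^ i)⁻¹ * ζ ^ k) ^ j • e k := by
      intro j
      induction j with
      | zero => simp
      | succ j ih =>
        rw [pow_succ', mul_assoc, ih, mul_smul_comm]
        simp only [z]
        rw [smul_mul_assoc, h1, smul_smul, smul_smul, pow_succ, mul_assoc]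
    have : e i * e k = ((m : ℂ)⁻¹ * ∑ j ∈ Finset.range m, ((ζ ^ i)⁻¹ * ζ ^ k) ^ j) • e k := by
      conv_lhs => simp only [e]
      rw [smul_mul_assoc, Finset.sum_mul, mul_smul]
      congr 1
      rw [Finset.sum_smul]
      exact Finset.sum_congr rfl fun j _ => hpow j
    rw [this]
    split_ifs with hik
    · subst hik
      rw [inv_mul_cancel₀ (pow_ne_zero _ hζ0)]
      simp [hm0]
    · rw [hgeom, mul_zero, zero_smul]
      · rw [mul_pow, inv_pow, hroot, hroot, inv_one, one_mul]
      · intro h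
        rw [inv_mul_eq_one₀ (pow_ne_zero _ hζ0)] at h
        exact hik (hζ.pow_inj (Finset.mem_range.mp hi) (Finset.mem_range.mp hk) h)
  · intro i
    refine Submodule.smul_mem _ _ (Submodule.sum_mem _ fun j _ => ?_)
    simp only [z]
    rw [smul_pow]
    exact Submodule.smul_mem _ _ (Submodule.subset_span ⟨j, rfl⟩)

end Exponential

/-! ### Inner automorphisms and the associative structure -/

section Inner

variable {G : Type v} [AddCommGroup G] {ξ : Bicharacter G}
  {L : Type u} [LieRing L] [LieAlgebra ℂ L]

attribute [local instance] TwistedLie.ring TwistedLie.algebra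

theorem lieHom_ad_pow (Φ : L →ₗ⁅ℂ⁆ TwistedLie ξ) (x y : L) (n : ℕ) :
    Φ (((LieAlgebra.ad ℂ L x) ^ n) y) =
      ((LieAlgebra.ad ℂ (TwistedLie ξ) (Φ x)) ^ n) (Φ y) := by
  induction n with
  | zero => rfl
  | succ n ih =>
    rw [pow_succ', pow_succ', Module.End.mul_apply, Module.End.mul_apply, LieAlgebra.ad_apply,
      LieHom.map_lie, ih, LieAlgebra.ad_apply]

theorem eq_of_forall_dual {V : Type*} [AddCommGroup V] [Module ℂ V] {x y : V}
    (h : ∀ f : Module.Dual ℂ V, f x = f y) : x = y := by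
  rw [← sub_eq_zero, ← Module.forall_dual_apply_eq_zero_iff ℂ]
  intro f
  rw [map_sub, h, sub_self]

/-- Inner automorphisms of a Lie algebra that is embedded into a twisted group algebra extend to
automorphisms of the associative algebra. -/
theorem exists_mulEquiv_of_mem_lieInt [Finite G] (Φ : L →ₗ⁅ℂ⁆ TwistedLie ξ) {σ : L ≃ₗ[ℂ] L}
    (hσ : σ ∈ lieInt L) :
    ∃ F : TwistedLie ξ ≃ₗ[ℂ] TwistedLie ξ, (∀ x y, F (x * y) = F x * F y) ∧
      ∀ x, Φ (σ x) = F (Φ x) := by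
  induction hσ using Subgroup.closure_induction with
  | one => exact ⟨LinearEquiv.refl ℂ _, fun _ _ => rfl, fun _ => rfl⟩
  | mul σ τ _ _ hσ hτ =>
    obtain ⟨F, hF, hF'⟩ := hσ
    obtain ⟨F', hF2, hF2'⟩ := hτ
    refine ⟨F' ≪≫ₗ F, fun x y => ?_, fun x => ?_⟩
    · simp [hF, hF2]
    · rw [LinearEquiv.mul_apply, hF', hF2', LinearEquiv.trans_apply]
  | inv σ _ hσ =>
    obtain ⟨F, hF, hF'⟩ := hσ
    refine ⟨F.symm, fun x y => ?_, fun x => ?_⟩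
    · apply F.injective
      rw [hF]
      simp
    · apply F.injective
      rw [← hF', LinearEquiv.apply_symm_apply]
      congr 1
      exact LinearEquiv.apply_symm_apply σ x
  | mem σ hσ =>
    obtain ⟨x, hx⟩ := hσ
    have hfin : FiniteDimensional ℂ (TwistedLie ξ) :=
      Module.Finite.of_basis (TwistedLie.basis ξ)
    obtain ⟨E, hE, hadd, hcomm⟩ := exists_endExp (V := TwistedLie ξ)
    -- The operator ad is a left multiplication plus a right multiplication. These commute, so the
    -- exponential factors; each factor commutes with the multiplications on the other side and is
    -- determined by its value at 1. The result is y ↦ g y g⁻¹ with g = `E l 1`.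
    let l : Module.End ℂ (TwistedLie ξ) := LinearMap.mulLeft ℂ (Φ x)
    let r : Module.End ℂ (TwistedLie ξ) := -LinearMap.mulRight ℂ (Φ x)
    have had : LieAlgebra.ad ℂ (TwistedLie ξ) (Φ x) = l + r := by
      ext y
      rw [LieAlgebra.ad_apply, TwistedLie.lie_eq_sub, sub_eq_add_neg]
      rfl
    have hlr : Commute l r := by
      refine Commute.neg_right ?_
      ext y
      exact (mul_assoc (Φ x) y (Φ x)).symm
    have hl : ∀ y, E l y = E l 1 * y := by
      intro y
      have h := hcomm l (LinearMap.mulRight ℂ y) (by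
        ext z
        exact (mul_assoc (Φ x) z y).symm)
      have := LinearMap.congr_fun h 1
      simpa using this
    have hr : ∀ y, E r y = y * E r 1 := by
      intro y
      have h := hcomm r (LinearMap.mulLeft ℂ y) (by
        ext z
        change -(y * z * Φ x) = y * -(z * Φ x)
        rw [mul_neg, mul_assoc])
      have := LinearMap.congr_fun h 1
      simpa using this
    have hD : ∀ y, E (l + r) y = E l 1 * y * E r 1 := by
      intro y
      rw [hadd l r hlr, Module.End.mul_apply, hl, hr, mul_assoc]
    have h1 : E l 1 * E r 1 = 1 := by
      have : E (l + r) 1 = 1 := by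
        refine eq_of_forall_dual fun f => ?_
        have h0 : (l + r) 1 = (0 : ℂ) • (1 : TwistedLie ξ) := by simp [l, r]
        have := hasSum_of_eigenvector h0 f
        rw [Complex.exp_zero, one_smul] at this
        exact (hE _ _ _).unique this
      rw [hD, mul_one] at this
      exact this
    have h2 : E r 1 * E l 1 = 1 := by
      have h3 : LinearMap.mulLeft ℂ (E l 1) * LinearMap.mulLeft ℂ (E r 1) = 1 := by
        ext y
        simp [← mul_assoc, h1]
      have h4 := LinearMap.congr_fun (mul_eq_one_comm.mp h3) 1
      simpa using h4
    have hinj : Function.Injective (E (l + r)) := by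
      intro y z hyz
      rw [hD, hD] at hyz
      have := congrArg (fun w => E r 1 * w * E l 1) hyz
      simp only [mul_assoc, h2, mul_one] at this
      simpa only [← mul_assoc, h2, one_mul] using this
    have hbij : Function.Bijective (E (l + r)) :=
      ⟨hinj, LinearMap.injective_iff_surjective.mp hinj⟩
    refine ⟨LinearEquiv.ofBijective (E (l + r)) hbij, fun y z => ?_, fun y => ?_⟩
    · simp only [LinearEquiv.ofBijective_apply, hD]
      simp only [mul_assoc]
      rw [← mul_assoc (E r 1) (E l 1), h2, one_mul]
    · refine eq_of_forall_dual fun f => ?_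
      have e1 := hx y (f ∘ₗ (Φ : L →ₗ[ℂ] TwistedLie ξ))
      have e2 := hE (l + r) (Φ y) f
      rw [LinearEquiv.ofBijective_apply]
      refine HasSum.unique e1 (hasSum_of_forall_eq e2 fun n => ?_)
      rw [← had, ← lieHom_ad_pow]
      rfl

theorem TwistedLie.u_pow (a : G) (n : ℕ) :
    ∃ c : ℂˣ, TwistedLie.u ξ a ^ n = (c : ℂ) • TwistedLie.u ξ (n • a) := by
  induction n with
  | zero => exact ⟨1, by rw [pow_zero, zero_smul, Units.val_one, one_smul]; rfl⟩
  | succ n ih =>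
    obtain ⟨c, hc⟩ := ih
    refine ⟨c * ξ (n • a) a, ?_⟩
    rw [pow_succ, hc, smul_mul_assoc, TwistedLie.u_mul_u, smul_smul, succ_nsmul, Units.val_mul]

/-- If `R` contains the nonzero multiples of `a`, then `u_b ↦ β(a,b) u_b` is inner. -/
theorem mem_lieInt_of_diag [Finite G] {β : Bicharacter G} (hβ : ξ.IsLift β)
    (Φ : L →ₗ⁅ℂ⁆ TwistedLie ξ) (hΦ : Function.Injective Φ) {a : G}
    (ha : ∀ n : ℕ, n • a ≠ 0 → ∃ x, Φ x = TwistedLie.u ξ (n • a)) {σ : L ≃ₗ[ℂ] L}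
    (hσ : ∀ x, Φ (σ x) = TwistedLie.diag ξ (β a) (Φ x)) : σ ∈ lieInt L := by
  refine Subgroup.subset_closure ?_
  set m := addOrderOf a with hm
  have hm0 : 0 < m := addOrderOf_pos a
  obtain ⟨c, hc⟩ := TwistedLie.u_pow (ξ := ξ) a m
  rw [hm, addOrderOf_nsmul_eq_zero, ← hm] at hc
  -- u_a^m is a scalar; rescaling u_a by an m-th root gives v with v^m = 1 and the same conjugation
  -- action.
  obtain ⟨s, hs⟩ := IsAlgClosed.exists_pow_nat_eq ((c⁻¹ : ℂˣ) : ℂ) hm0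
  have hs0 : s ≠ 0 := by
    rintro rfl
    rw [zero_pow hm0.ne'] at hs
    exact (c⁻¹).ne_zero hs.symm
  let v : TwistedLie ξ := s • TwistedLie.u ξ a
  have hv : v ^ m = 1 := by
    simp only [v]
    rw [smul_pow, hs, hc, smul_smul, ← Units.val_mul, inv_mul_cancel, Units.val_one, one_smul]
    rfl
  let ζ : ℂ := Complex.exp (2 * Real.pi * Complex.I / m)
  have hζ : IsPrimitiveRoot ζ m := Complex.isPrimitiveRoot_exp m hm0.ne'
  obtain ⟨e, he1, he2, hsum, horth, hmem⟩ := exists_spectral_idempotents hm0 hv hζ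
  -- These are logarithms of the eigenvalues of v, so P below is a logarithm of v. As a polynomial
  -- in v it is a combination of the u_{ja}: those with ja ≠ 0 lie in the image of Φ, and the
  -- multiple of 1 is central, so some x in L has ad(Φ x) = ad P.
  let l : ℕ → ℂ := fun i => i * (2 * Real.pi * Complex.I / m)
  have hl : ∀ i, Complex.exp (l i) = ζ ^ i := fun i => Complex.exp_nat_mul _ i
  let P : TwistedLie ξ := ∑ i ∈ Finset.range m, l i • e i
  have hP : P ∈ LinearMap.range (Φ : L →ₗ[ℂ] TwistedLie ξ) ⊔ Submodule.span ℂ {1} := by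
    refine Submodule.sum_mem _ fun i _ => Submodule.smul_mem _ _ ?_
    refine (Submodule.span_le.mpr ?_) (hmem i)
    rintro _ ⟨j, rfl⟩
    simp only [v]
    rw [smul_pow]
    obtain ⟨c, hc⟩ := TwistedLie.u_pow (ξ := ξ) a j
    rw [hc]
    refine Submodule.smul_mem _ _ (Submodule.smul_mem _ _ ?_)
    by_cases hj : j • a = 0
    · rw [hj]
      exact Submodule.mem_sup_right (Submodule.mem_span_singleton_self _)
    · obtain ⟨x, hx⟩ := ha j hj
      rw [← hx]
      exact Submodule.mem_sup_left ⟨x, rfl⟩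
  obtain ⟨_, ⟨x, rfl⟩, _, hk, hxk⟩ := Submodule.mem_sup.mp hP
  obtain ⟨k, rfl⟩ := Submodule.mem_span_singleton.mp hk
  have hPl : ∀ i ∈ Finset.range m, P * e i = l i • e i := by
    intro i hi
    simp only [P]
    rw [Finset.sum_mul, Finset.sum_eq_single i]
    · rw [smul_mul_assoc, horth i hi i hi, if_pos rfl]
    · intro j hj hji
      rw [smul_mul_assoc, horth j hj i hi, if_neg hji, smul_zero]
    · exact fun h => absurd hi h
  have hPr : ∀ i ∈ Finset.range m, e i * P = l i • e i := by
    intro i hi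
    simp only [P]
    rw [Finset.mul_sum, Finset.sum_eq_single i]
    · rw [mul_smul_comm, horth i hi i hi, if_pos rfl]
    · intro j hj hji
      rw [mul_smul_comm, horth i hi j hj, if_neg hji.symm, smul_zero]
    · exact fun h => absurd hi h
  have had : ∀ y, LieAlgebra.ad ℂ (TwistedLie ξ) (Φ x) y = P * y - y * P := by
    intro y
    rw [LieAlgebra.ad_apply, TwistedLie.lie_eq_sub, ← hxk, add_mul, mul_add]
    simp
  have hdiag : ∀ y, TwistedLie.diag ξ (β a) y = v * y * v ^ (m - 1) := by
    intro y
    have : TwistedLie.diag ξ (β a) =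
        LinearMap.mulRight ℂ (v ^ (m - 1)) ∘ₗ LinearMap.mulLeft ℂ v := by
      refine TwistedLie.ext_u fun b => ?_
      rw [TwistedLie.diag_u, LinearMap.comp_apply, LinearMap.mulLeft_apply,
        LinearMap.mulRight_apply]
      have : v * TwistedLie.u ξ b = (β a b : ℂ) • (TwistedLie.u ξ b * v) := by
        simp only [v]
        rw [smul_mul_assoc, TwistedLie.u_mul_comm hβ, mul_smul_comm, smul_comm]
      rw [this, smul_mul_assoc, mul_assoc, mul_pow_sub_one hm0.ne', hv, mul_one]
    rw [this]
    rfl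
  have hpow : ∀ i j : ℕ, e i * v ^ j = (ζ ^ i) ^ j • e i := by
    intro i j
    induction j with
    | zero => simp
    | succ j ih => rw [pow_succ, ← mul_assoc, ih, smul_mul_assoc, he2, smul_smul, pow_succ]
  have key : ∀ (y : TwistedLie ξ) (f : Module.Dual ℂ (TwistedLie ξ)),
      HasSum (fun n : ℕ => ((n.factorial : ℂ)⁻¹) *
        f (((LieAlgebra.ad ℂ (TwistedLie ξ) (Φ x)) ^ n) y)) (f (TwistedLie.diag ξ (β a) y)) := by
    intro y f
    -- The Peirce decomposition diagonalizes ad P: e_i y e_j has eigenvalue `l i - l j`, and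
    -- conjugation by v multiplies it by ζ^i / ζ^j, the exponential of that number.
    have hy : y = ∑ i ∈ Finset.range m, ∑ j ∈ Finset.range m, e i * y * e j := by
      simp only [← Finset.mul_sum, hsum, mul_one]
      rw [← Finset.sum_mul, hsum, one_mul]
    rw [hy]
    simp only [map_sum, Finset.mul_sum]
    refine hasSum_sum fun i hi => hasSum_sum fun j hj => ?_
    have heig : LieAlgebra.ad ℂ (TwistedLie ξ) (Φ x) (e i * y * e j) =
        (l i - l j) • (e i * y * e j) := by
      rw [had, sub_smul, ← mul_assoc, ← mul_assoc, hPl i hi, mul_assoc (e i * y), hPr j hj]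
      simp
    convert hasSum_of_eigenvector heig f using 2
    rw [hdiag, Complex.exp_sub, hl, hl, ← mul_assoc, ← mul_assoc, he1, mul_assoc, hpow,
      mul_smul_comm, smul_mul_assoc, smul_mul_assoc, smul_smul]
    congr 1
    have hζj : ζ ^ j ≠ 0 := pow_ne_zero _ (hζ.ne_zero hm0.ne')
    rw [eq_div_iff hζj, mul_right_comm, pow_sub_one_mul hm0.ne', ← pow_mul, mul_comm j m, pow_mul,
      hζ.pow_eq_one, one_pow, one_mul]
  refine ⟨x, fun y f => ?_⟩
  -- A linear retraction onto L turns functionals on L into functionals on the algebra.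
  obtain ⟨g, hg⟩ := LinearMap.exists_leftInverse_of_injective (Φ : L →ₗ[ℂ] TwistedLie ξ)
    (LinearMap.ker_eq_bot.mpr hΦ)
  have hg' : ∀ z, g (Φ z) = z := fun z => LinearMap.congr_fun hg z
  have h := key (Φ y) (f ∘ₗ g)
  rw [← hσ] at h
  convert h using 3 with n
  · rw [← lieHom_ad_pow, LinearMap.comp_apply, hg']
  · rw [LinearMap.comp_apply, hg']

end Inner

/-! ### Diagonal groups of automorphisms -/

/-- A point outside a finite set is separated from each of its elements by a linear functional; the
product of the corresponding affine linear polynomials vanishes on the set but not at the point. -/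
theorem isZariskiClosed_of_finite {L : Type u} [LieRing L] [LieAlgebra ℂ L]
    (T : Subgroup (L ≃ₗ[ℂ] L)) [Finite T] : IsZariskiClosed T := by
  classical
  have := Fintype.ofFinite T
  refine ⟨{p | ∀ t ∈ T, MvPolynomial.eval
    (fun f : Module.Dual ℂ (Module.End ℂ L) => f (t : Module.End ℂ L)) p = 0}, fun σ => ?_⟩
  refine ⟨fun h p hp => hp σ h, fun h => ?_⟩
  by_contra hσ
  have hsep : ∀ t : T, ∃ f : Module.Dual ℂ (Module.End ℂ L),
      f (σ : Module.End ℂ L) ≠ f ((t : L ≃ₗ[ℂ] L) : Module.End ℂ L) := by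
    intro t
    by_contra! hf
    refine hσ ?_
    have := eq_of_forall_dual hf
    have h2 : σ = t := LinearEquiv.toLinearMap_injective this
    rw [h2]
    exact t.2
  choose f hf using hsep
  let p : MvPolynomial (Module.Dual ℂ (Module.End ℂ L)) ℂ :=
    ∏ t : T, (MvPolynomial.X (f t) - MvPolynomial.C (f t ((t : L ≃ₗ[ℂ] L) : Module.End ℂ L)))
  have h0 := h p (by
    intro t ht
    simp only [p, map_prod]
    refine Finset.prod_eq_zero (Finset.mem_univ ⟨t, ht⟩) ?_
    simp)
  simp only [p, map_prod, Finset.prod_eq_zero_iff] at h0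
  obtain ⟨t, -, ht⟩ := h0
  simp only [map_sub, MvPolynomial.eval_X, MvPolynomial.eval_C] at ht
  exact hf t (sub_eq_zero.mp ht)

namespace FiniteRootSystem

variable (S : FiniteRootSystem.{v}) {L : Type u} [LieRing L] [LieAlgebra ℂ L]

/-- The group of the maps of `L` that become `u_a ↦ χ(a) u_a`, with `χ` a character of `G`, in the
twisted group algebra. -/
def diagGroup (Φ : L →ₗ⁅ℂ⁆ TwistedLie S.ξ) : Subgroup (L ≃ₗ[ℂ] L) where
  carrier := {σ | ∃ χ : Multiplicative S.G →* ℂˣ,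
    ∀ x, Φ (σ x) = TwistedLie.diag S.ξ (fun a => χ (.ofAdd a)) (Φ x)}
  one_mem' := ⟨1, fun x => by simp [TwistedLie.diag_one]⟩
  mul_mem' := by
    rintro σ τ ⟨χ, hχ⟩ ⟨χ', hχ'⟩
    refine ⟨χ * χ', fun x => ?_⟩
    rw [LinearEquiv.mul_apply, hχ, hχ', TwistedLie.diag_diag]
    rfl
  inv_mem' := by
    rintro σ ⟨χ, hχ⟩
    refine ⟨χ⁻¹, fun x => ?_⟩
    have h := hχ (σ⁻¹ x)
    have h2 : σ (σ⁻¹ x) = x := LinearEquiv.apply_symm_apply σ x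
    rw [h2] at h
    rw [h, TwistedLie.diag_diag]
    simp [TwistedLie.diag_one]

theorem mem_diagGroup {Φ : L →ₗ⁅ℂ⁆ TwistedLie S.ξ} {σ : L ≃ₗ[ℂ] L} :
    σ ∈ S.diagGroup Φ ↔ ∃ χ : Multiplicative S.G →* ℂˣ,
      ∀ x, Φ (σ x) = TwistedLie.diag S.ξ (fun a => χ (.ofAdd a)) (Φ x) :=
  Iff.rfl

/-- `T` is the group of all diagonal maps of `L`, for an isomorphism of `L` onto `L(R)`. -/
def Realizes (T : Subgroup (L ≃ₗ[ℂ] L)) : Prop :=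
  ∃ Φ : L →ₗ⁅ℂ⁆ TwistedLie S.ξ, Function.Injective Φ ∧
    LinearMap.range (Φ : L →ₗ[ℂ] TwistedLie S.ξ) = S.rootSpan ∧ T = S.diagGroup Φ

variable {S}

theorem Realizes.of_pairIso {L' : Type w} [LieRing L'] [LieAlgebra ℂ L']
    {T : Subgroup (L ≃ₗ[ℂ] L)} {T' : Subgroup (L' ≃ₗ[ℂ] L')} (h : PairIso T T')
    (hT' : S.Realizes T') : S.Realizes T := by
  obtain ⟨e, he⟩ := h
  obtain ⟨Φ, hinj, hrange, rfl⟩ := hT'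
  refine ⟨Φ.comp e.toLieHom, hinj.comp e.injective, ?_, ?_⟩
  · rw [← hrange]
    ext y
    constructor
    · rintro ⟨x, rfl⟩
      exact ⟨e x, rfl⟩
    · rintro ⟨x, rfl⟩
      exact ⟨e.symm x, congrArg Φ (e.apply_symm_apply x)⟩
  · ext σ
    rw [he, mem_diagGroup, mem_diagGroup]
    refine exists_congr fun χ => ⟨fun h x => ?_, fun h x => ?_⟩
    · have := h (e x)
      simp only [LinearEquiv.trans_apply] at this
      have h2 : e.toLinearEquiv.symm (e x) = x := e.symm_apply_apply x
      rw [h2] at this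
      exact this
    · have := h (e.symm x)
      have h2 : e (e.symm x) = x := e.apply_symm_apply x
      change Φ (e (σ (e.symm x))) = _
      change Φ (e (σ (e.symm x))) = TwistedLie.diag S.ξ _ (Φ (e (e.symm x))) at this
      rw [h2] at this
      exact this

theorem exists_basis_of_range {Φ : L →ₗ⁅ℂ⁆ TwistedLie S.ξ} (hinj : Function.Injective Φ)
    (hrange : LinearMap.range (Φ : L →ₗ[ℂ] TwistedLie S.ξ) = S.rootSpan) :
    ∃ b : Module.Basis S.R ℂ L, ∀ a : S.R, Φ (b a) = TwistedLie.u S.ξ a := by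
  have h : ∀ a : S.R, ∃ x, Φ x = TwistedLie.u S.ξ a := by
    intro a
    have : TwistedLie.u S.ξ a ∈ LinearMap.range (Φ : L →ₗ[ℂ] TwistedLie S.ξ) := by
      rw [hrange]
      exact Submodule.subset_span ⟨a, a.2, rfl⟩
    exact this
  choose w hw using h
  have hli : LinearIndependent ℂ w := by
    refine LinearIndependent.of_comp (Φ : L →ₗ[ℂ] TwistedLie S.ξ) ?_
    have h1 := (TwistedLie.basis S.ξ).linearIndependent.comp (Subtype.val : S.R → S.G)
      Subtype.val_injective
    have h2 : (Φ : L →ₗ[ℂ] TwistedLie S.ξ) ∘ w = TwistedLie.basis S.ξ ∘ Subtype.val :=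
      funext fun a => (hw a).trans (TwistedLie.basis_apply S.ξ a).symm
    rw [h2]
    exact h1
  have hsp : ⊤ ≤ Submodule.span ℂ (Set.range w) := by
    intro x _
    have hx : Φ x ∈ S.rootSpan := by
      rw [← hrange]
      exact ⟨x, rfl⟩
    have hmap : (Submodule.span ℂ (Set.range w)).map (Φ : L →ₗ[ℂ] TwistedLie S.ξ) =
        S.rootSpan := by
      rw [Submodule.map_span, rootSpan]
      congr 1
      ext y
      constructor
      · rintro ⟨_, ⟨a, rfl⟩, rfl⟩
        exact ⟨a, a.2, (hw a).symm⟩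
      · rintro ⟨a, ha, rfl⟩
        exact ⟨_, ⟨⟨a, ha⟩, rfl⟩, hw ⟨a, ha⟩⟩
    rw [← hmap] at hx
    obtain ⟨y, hy, hyx⟩ := hx
    rw [← hinj hyx]
    exact hy
  exact ⟨Module.Basis.mk hli hsp, fun a => by rw [Module.Basis.mk_apply, hw]⟩

theorem char_ext {χ χ' : Multiplicative S.G →* ℂˣ}
    (h : ∀ a ∈ S.R, χ (.ofAdd a) = χ' (.ofAdd a)) : χ = χ' := by
  have key : ∀ a : S.G, χ (.ofAdd a) = χ' (.ofAdd a) := by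
    intro a
    have ha : a ∈ AddSubgroup.closure S.R := by rw [S.generates]; trivial
    induction ha using AddSubgroup.closure_induction with
    | mem a ha => exact h a ha
    | zero => simp
    | add a b _ _ ha hb => simp [ha, hb]
    | neg a _ ha => simp [ha]
  exact MonoidHom.ext fun a => key a.toAdd

/-- This describes the diagonal group through the basis alone; the duality between G and T and the
reduction of maximality use nothing else about Φ. -/
theorem mem_diagGroup_iff_basis {Φ : L →ₗ⁅ℂ⁆ TwistedLie S.ξ} (hinj : Function.Injective Φ)
    {b : Module.Basis S.R ℂ L} (hb : ∀ a : S.R, Φ (b a) = TwistedLie.u S.ξ a) (σ : L ≃ₗ[ℂ] L) :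
    σ ∈ S.diagGroup Φ ↔ ∃ χ : Multiplicative S.G →* ℂˣ,
      ∀ a : S.R, σ (b a) = (χ (.ofAdd a) : ℂ) • b a := by
  rw [mem_diagGroup]
  refine exists_congr fun χ => ⟨fun h a => hinj ?_, fun h => ?_⟩
  · rw [h, hb, TwistedLie.diag_u, map_smul, hb]
  · have : (Φ : L →ₗ[ℂ] TwistedLie S.ξ) ∘ₗ (σ : L →ₗ[ℂ] L) =
        TwistedLie.diag S.ξ (fun a => χ (.ofAdd a)) ∘ₗ (Φ : L →ₗ[ℂ] TwistedLie S.ξ) := by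
      refine b.ext fun a => ?_
      simp [h, hb]
    exact LinearMap.congr_fun this

/-! ### Duality between the grading group and the diagonal group -/

section Basis

variable (b : Module.Basis S.R ℂ L) {T : Subgroup (L ≃ₗ[ℂ] L)}
  (hT : ∀ σ, σ ∈ T ↔ ∃ χ : Multiplicative S.G →* ℂˣ,
    ∀ a : S.R, σ (b a) = (χ (.ofAdd a) : ℂ) • b a)

/-- The diagonal map with eigenvalues `χ(a)`. -/
noncomputable def diagEquiv (χ : Multiplicative S.G →* ℂˣ) : L ≃ₗ[ℂ] L :=
  b.equiv (b.unitsSMul fun a => χ (.ofAdd (a : S.G))) (Equiv.refl _)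

theorem diagEquiv_basis (χ : Multiplicative S.G →* ℂˣ) (a : S.R) :
    diagEquiv b χ (b a) = (χ (.ofAdd (a : S.G)) : ℂ) • b a := by
  rw [diagEquiv, Module.Basis.equiv_apply, Equiv.refl_apply, Module.Basis.unitsSMul_apply]
  rfl

theorem linearEquiv_ext_basis {σ τ : L ≃ₗ[ℂ] L} (h : ∀ a, σ (b a) = τ (b a)) : σ = τ :=
  LinearEquiv.toLinearMap_injective (b.ext h)

include hT in
theorem bijective_diagEquiv : Function.Bijective
    (fun χ => (⟨diagEquiv b χ, (hT _).mpr ⟨χ, diagEquiv_basis b χ⟩⟩ : T)) := by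
  constructor
  · intro χ χ' h
    refine char_ext fun a ha => ?_
    have h1 : diagEquiv b χ (b ⟨a, ha⟩) = diagEquiv b χ' (b ⟨a, ha⟩) := by
      rw [Subtype.mk.inj h]
    rw [diagEquiv_basis, diagEquiv_basis] at h1
    exact Units.ext (smul_left_injective ℂ (b.ne_zero _) h1)
  · rintro ⟨σ, hσ⟩
    obtain ⟨χ, hχ⟩ := (hT σ).mp hσ
    refine ⟨χ, Subtype.ext ?_⟩
    exact linearEquiv_ext_basis b fun a => by rw [diagEquiv_basis, hχ]

/-- The group of diagonal maps is the dual group of `G`. -/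
noncomputable def dualEquiv : (Multiplicative S.G →* ℂˣ) ≃* T :=
  MulEquiv.ofBijective (MonoidHom.mk' (fun χ =>
      (⟨diagEquiv b χ, (hT _).mpr ⟨χ, diagEquiv_basis b χ⟩⟩ : T)) (fun χ χ' => Subtype.ext <|
        linearEquiv_ext_basis b fun a => by
          change diagEquiv b (χ * χ') (b a) = diagEquiv b χ (diagEquiv b χ' (b a))
          rw [diagEquiv_basis, diagEquiv_basis, map_smul, diagEquiv_basis, smul_smul, mul_comm,
            MonoidHom.mul_apply, Units.val_mul, mul_comm]))
    (bijective_diagEquiv b hT)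

theorem dualEquiv_basis (χ : Multiplicative S.G →* ℂˣ) (a : S.R) :
    (dualEquiv b hT χ : L ≃ₗ[ℂ] L) (b a) = (χ (.ofAdd (a : S.G)) : ℂ) • b a :=
  diagEquiv_basis b χ a

/-- `G` is the dual group of the group of diagonal maps. -/
noncomputable def degreeEquiv : S.G ≃+ Additive (T →* ℂˣ) :=
  have : NeZero (Monoid.exponent (Multiplicative S.G)) := ⟨Monoid.exponent_ne_zero_of_finite⟩
  MulEquiv.toAdditiveRight ((CommGroup.monoidHomMonoidHomEquiv (Multiplicative S.G) ℂ).symm.trans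
    (dualEquiv b hT).monoidHomCongrLeft)

theorem degreeEquiv_apply (a : S.G) (χ : Multiplicative S.G →* ℂˣ) :
    (degreeEquiv b hT a).toMul (dualEquiv b hT χ) = χ (.ofAdd a) := by
  have : NeZero (Monoid.exponent (Multiplicative S.G)) := ⟨Monoid.exponent_ne_zero_of_finite⟩
  refine Eq.trans ?_ (CommGroup.monoidHomMonoidHomEquiv_symm_apply_apply (Multiplicative S.G) ℂ
    (.ofAdd a) χ)
  exact congrArg (fun φ => (CommGroup.monoidHomMonoidHomEquiv (Multiplicative S.G) ℂ).symm
    (.ofAdd a) φ) ((dualEquiv b hT).symm_apply_apply χ)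

/-- Characters of a finite abelian group separate its points, so a vector of degree a cannot involve
basis vectors of other degrees. -/
theorem mem_inducedGrading_degreeEquiv (a : S.G) (x : L) :
    x ∈ inducedGrading T (degreeEquiv b hT a) ↔ ∀ c : S.R, (c : S.G) ≠ a → b.repr x c = 0 := by
  have hrepr : ∀ (χ : Multiplicative S.G →* ℂˣ) (c : S.R),
      b.repr ((dualEquiv b hT χ : L ≃ₗ[ℂ] L) x) c = χ (.ofAdd (c : S.G)) * b.repr x c := by
    intro χ c
    have : b.coord c ∘ₗ ((dualEquiv b hT χ : L ≃ₗ[ℂ] L) : L →ₗ[ℂ] L) =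
        (χ (.ofAdd (c : S.G)) : ℂ) • b.coord c := by
      refine b.ext fun d => ?_
      rw [LinearMap.comp_apply, LinearEquiv.coe_coe, dualEquiv_basis, map_smul,
        LinearMap.smul_apply, Module.Basis.coord_apply, Module.Basis.repr_self]
      by_cases hcd : d = c
      · rw [hcd]
      · simp [hcd]
    exact LinearMap.congr_fun this x
  have hmem : x ∈ inducedGrading T (degreeEquiv b hT a) ↔
      ∀ χ : Multiplicative S.G →* ℂˣ, (dualEquiv b hT χ : L ≃ₗ[ℂ] L) x =
          (χ (.ofAdd a) : ℂ) • x := by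
    change (∀ t : T, _) ↔ _
    exact (dualEquiv b hT).surjective.forall.trans
      (forall_congr' fun χ => by rw [degreeEquiv_apply])
  have : NeZero (Monoid.exponent (Multiplicative S.G)) := ⟨Monoid.exponent_ne_zero_of_finite⟩
  rw [hmem]
  constructor
  · intro h c hc
    by_contra h0
    refine hc ?_
    have : (Multiplicative.ofAdd (c : S.G)) = .ofAdd a := by
      rw [← CommGroup.forall_apply_eq_apply_iff (Multiplicative S.G) (M := ℂ)]
      intro χ
      have h1 := hrepr χ c
      rw [h χ, map_smul, Finsupp.smul_apply, smul_eq_mul] at h1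
      exact Units.ext (mul_right_cancel₀ h0 h1).symm
    exact this
  · intro h χ
    refine b.repr.injective (Finsupp.ext fun c => ?_)
    rw [hrepr, map_smul, Finsupp.smul_apply, smul_eq_mul]
    by_cases hc : (c : S.G) = a
    · rw [hc]
    · rw [h c hc, mul_zero, mul_zero]

theorem inducedGrading_degreeEquiv_of_mem (a : S.R) :
    inducedGrading T (degreeEquiv b hT a) = Submodule.span ℂ {b a} := by
  ext x
  rw [mem_inducedGrading_degreeEquiv, Submodule.mem_span_singleton]
  constructor
  · intro h
    refine ⟨b.repr x a, b.repr.injective (Finsupp.ext fun c => ?_)⟩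
    rw [map_smul, Module.Basis.repr_self, Finsupp.smul_apply]
    by_cases hc : a = c
    · subst hc
      simp
    · rw [h c fun h => hc (Subtype.ext h.symm), Finsupp.single_eq_of_ne' hc, smul_zero]
  · rintro ⟨r, rfl⟩ c hc
    rw [map_smul, Module.Basis.repr_self, Finsupp.smul_apply,
      Finsupp.single_eq_of_ne' (fun h => hc (by rw [h])), smul_zero]

theorem inducedGrading_degreeEquiv_of_notMem {a : S.G} (ha : a ∉ S.R) :
    inducedGrading T (degreeEquiv b hT a) = ⊥ := by
  rw [eq_bot_iff]
  intro x hx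
  rw [mem_inducedGrading_degreeEquiv] at hx
  refine b.repr.injective (Finsupp.ext fun c => ?_)
  rw [hx c fun h => ha (h ▸ c.2), map_zero, Finsupp.zero_apply]

theorem zero_notMem : (0 : S.G) ∉ S.R := fun h =>
  S.disjoint_radical h fun b => S.β.map_zero_left b

-- A finite subgroup is Zariski closed, and an element of order n is annihilated by X^n - 1, which
-- is squarefree in characteristic zero.
include b hT in
theorem isQuasitorus_of_basis : Finite T ∧ IsQuasitorus T := by
  have : NeZero (Monoid.exponent (Multiplicative S.G)) := ⟨Monoid.exponent_ne_zero_of_finite⟩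
  have hfin : Finite T := Finite.of_equiv _ (dualEquiv b hT).toEquiv
  refine ⟨hfin, isZariskiClosed_of_finite T, fun σ hσ τ hτ => ?_, fun σ hσ => ?_⟩
  · obtain ⟨χ, hχ⟩ := (hT σ).mp hσ
    obtain ⟨χ', hχ'⟩ := (hT τ).mp hτ
    refine linearEquiv_ext_basis b fun a => ?_
    rw [LinearEquiv.mul_apply, LinearEquiv.mul_apply, hχ, hχ', map_smul, map_smul, hχ, hχ',
      smul_comm]
  · obtain ⟨n, hn, hσn⟩ := isOfFinOrder_iff_pow_eq_one.mp (isOfFinOrder_of_finite (⟨σ, hσ⟩ : T))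
    have hσn' : σ ^ n = 1 := congrArg Subtype.val hσn
    refine Module.End.isSemisimple_of_squarefree_aeval_eq_zero
      (p := Polynomial.X ^ n - Polynomial.C (1 : ℂ)) ?_ ?_
    · refine (Polynomial.separable_X_pow_sub_C (1 : ℂ) ?_ one_ne_zero).squarefree
      exact_mod_cast hn.ne'
    · have h2 : ((σ : Module.End ℂ L)) ^ n = 1 := by
        have h3 := congrArg (fun τ : L ≃ₗ[ℂ] L => (τ : Module.End ℂ L)) hσn'
        have h4 : ∀ k : ℕ, ((σ ^ k : L ≃ₗ[ℂ] L) : Module.End ℂ L) = (σ : Module.End ℂ L) ^ k := by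
          intro k
          induction k with
          | zero => rfl
          | succ k ih => rw [pow_succ, pow_succ, ← ih]; rfl
        rw [← h4]
        exact h3
      simp [h2]

-- A larger quasitorus commutes with T, so it preserves the one-dimensional components and acts
-- diagonally on b. Maximality therefore reduces to the diagonal elements of K, which are the
-- subject of `hK`.
include b hT in
theorem isGood_of_basis {K : Subgroup (L ≃ₗ[ℂ] L)} (hTK : T ≤ K)
    (hK : ∀ σ ∈ K, ∀ μ : S.R → ℂˣ, (∀ a, σ (b a) = (μ a : ℂ) • b a) →
      ∃ χ : Multiplicative S.G →* ℂˣ, ∀ a : S.R, χ (.ofAdd (a : S.G)) = μ a) :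
    IsGoodFiniteMaximalQuasitorus K T := by
  obtain ⟨hfin, hq⟩ := isQuasitorus_of_basis b hT
  refine ⟨hfin, ⟨⟨hTK, hq⟩, ?_⟩, ?_, ?_⟩
  · rintro T' ⟨hT'K, hT'⟩ hTT' σ hσ
    have hmem : ∀ a : S.R, ∃ r : ℂ, r • b a = σ (b a) := by
      intro a
      rw [← Submodule.mem_span_singleton, ← inducedGrading_degreeEquiv_of_mem b hT a]
      intro t
      have ha : b a ∈ inducedGrading T (degreeEquiv b hT a) := by
        rw [inducedGrading_degreeEquiv_of_mem]
        exact Submodule.mem_span_singleton_self _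
      have hc := LinearEquiv.congr_fun (hT'.comm t (hTT' t.2) σ hσ) (b a)
      rw [LinearEquiv.mul_apply, LinearEquiv.mul_apply, ha t, map_smul] at hc
      exact hc
    choose r hr using hmem
    have hr0 : ∀ a, r a ≠ 0 := by
      intro a h0
      have := hr a
      rw [h0, zero_smul, eq_comm, LinearEquiv.map_eq_zero_iff] at this
      exact b.ne_zero a this
    obtain ⟨χ, hχ⟩ := hK σ (hT'K hσ) (fun a => Units.mk0 (r a) (hr0 a)) fun a => (hr a).symm
    refine (hT σ).mpr ⟨χ, fun a => ?_⟩
    rw [hχ, ← hr]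
    rfl
  · rw [← map_zero (degreeEquiv b hT)]
    exact inducedGrading_degreeEquiv_of_notMem b hT zero_notMem
  · intro α hα
    obtain ⟨a, rfl⟩ := (degreeEquiv b hT).surjective α
    by_cases ha : a ∈ S.R
    · rw [inducedGrading_degreeEquiv_of_mem b hT ⟨a, ha⟩]
      exact finrank_span_singleton (b.ne_zero _)
    · exact absurd (inducedGrading_degreeEquiv_of_notMem b hT ha) hα

end Basis

theorem Realizes.correspondsTo {T : Subgroup (L ≃ₗ[ℂ] L)} (h : S.Realizes T) :
    S.CorrespondsTo T := by
  obtain ⟨Φ, hinj, hrange, rfl⟩ := h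
  obtain ⟨b, hb⟩ := exists_basis_of_range hinj hrange
  have hT := mem_diagGroup_iff_basis hinj hb
  have hr : Φ.range = S.lieAlgebra := by
    ext x
    have : x ∈ LinearMap.range (Φ : L →ₗ[ℂ] TwistedLie S.ξ) ↔ x ∈ S.rootSpan := by rw [hrange]
    exact this
  let φ : L ≃ₗ⁅ℂ⁆ S.lieAlgebra :=
    (LieEquiv.ofInjective Φ hinj).trans (LieEquiv.ofEq _ _ (by rw [hr]))
  have hφ : ∀ x, (φ x : TwistedLie S.ξ) = Φ x := fun x => rfl
  refine ⟨φ.symm, degreeEquiv b hT, fun a => ?_⟩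
  rw [standardGrading, Submodule.map_span]
  by_cases ha : a ∈ S.R
  · rw [inducedGrading_degreeEquiv_of_mem b hT ⟨a, ha⟩]
    congr 1
    ext x
    constructor
    · rintro ⟨y, ⟨-, hy⟩, rfl⟩
      refine φ.injective (Subtype.ext ?_)
      refine (congrArg Subtype.val (φ.apply_symm_apply y)).trans ?_
      rw [hy]
      exact (hb ⟨a, ha⟩).symm
    · rintro rfl
      exact ⟨φ (b ⟨a, ha⟩), ⟨ha, by rw [hφ, hb]⟩, φ.symm_apply_apply _⟩
  · rw [inducedGrading_degreeEquiv_of_notMem b hT ha]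
    have : {x : S.lieAlgebra | a ∈ S.R ∧ (x : TwistedLie S.ξ) = TwistedLie.u S.ξ a} = ∅ := by
      ext x
      simp [ha]
    rw [this, Set.image_empty, Submodule.span_empty]

theorem lie_basis {Φ : L →ₗ⁅ℂ⁆ TwistedLie S.ξ} (hinj : Function.Injective Φ)
    {b : Module.Basis S.R ℂ L} (hb : ∀ a : S.R, Φ (b a) = TwistedLie.u S.ξ a) {a c : S.R}
    (hac : S.β a c ≠ 1) :
    ⁅b a, b c⁆ = ((S.ξ a c : ℂ) - (S.ξ c a : ℂ)) •
      b ⟨(a : S.G) + c, S.add_closed a a.2 c c.2 hac⟩ := by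
  apply hinj
  rw [LieHom.map_lie, map_smul, hb, hb, hb, TwistedLie.lie_u]

theorem lie_basis_eq_zero {Φ : L →ₗ⁅ℂ⁆ TwistedLie S.ξ} (hinj : Function.Injective Φ)
    {b : Module.Basis S.R ℂ L} (hb : ∀ a : S.R, Φ (b a) = TwistedLie.u S.ξ a) {a c : S.R}
    (hac : S.β a c = 1) : ⁅b a, b c⁆ = 0 := by
  apply hinj
  have h' : S.ξ a c = S.ξ c a := mul_inv_eq_one.mp ((S.ξ_isLift a c).symm.trans hac)
  rw [LieHom.map_lie, hb, hb, TwistedLie.lie_u, h', sub_self, zero_smul, map_zero]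

variable (S) in
theorem ξ_sub_ne_zero {a c : S.G} (hac : S.β a c ≠ 1) : (S.ξ a c : ℂ) - (S.ξ c a : ℂ) ≠ 0 := by
  intro h
  refine hac ?_
  rw [S.ξ_isLift, mul_inv_eq_one]
  exact Units.ext (sub_eq_zero.mp h)

/-- Good maximality in `Aut(L)`: the case that `G` is the universal group of the grading. -/
theorem Realizes.isGood_lieAut {T : Subgroup (L ≃ₗ[ℂ] L)} (h : S.Realizes T)
    (huniv : ∀ μ : S.G → ℂˣ, (∀ a ∈ S.R, ∀ c ∈ S.R, S.β a c ≠ 1 → μ (a + c) = μ a * μ c) →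
      ∃ χ : Multiplicative S.G →* ℂˣ, ∀ a ∈ S.R, χ (.ofAdd a) = μ a) :
    IsGoodFiniteMaximalQuasitorus (lieAut L) T := by
  classical
  obtain ⟨Φ, hinj, hrange, rfl⟩ := h
  obtain ⟨b, hb⟩ := exists_basis_of_range hinj hrange
  have hT := mem_diagGroup_iff_basis hinj hb
  refine isGood_of_basis b hT ?_ ?_
  · intro σ hσ
    obtain ⟨χ, hχ⟩ := (hT σ).mp hσ
    change ∀ x y : L, σ ⁅x, y⁆ = ⁅σ x, σ y⁆
    have key : (LieModule.toEnd ℂ L L : L →ₗ[ℂ] L →ₗ[ℂ] L).compr₂ (σ : L →ₗ[ℂ] L) =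
        (LieModule.toEnd ℂ L L : L →ₗ[ℂ] L →ₗ[ℂ] L).compl₁₂ (σ : L →ₗ[ℂ] L) (σ : L →ₗ[ℂ] L) := by
      refine b.ext fun a => b.ext fun c => ?_
      change σ ⁅b a, b c⁆ = ⁅σ (b a), σ (b c)⁆
      rw [hχ, hχ, smul_lie, lie_smul]
      by_cases hac : S.β a c = 1
      · rw [lie_basis_eq_zero hinj hb hac, map_zero, smul_zero, smul_zero]
      · rw [lie_basis hinj hb hac, map_smul, hχ, smul_smul, smul_smul, smul_smul, ofAdd_add,
          map_mul, Units.val_mul]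
        congr 1
        ring
    intro x y
    exact LinearMap.congr_fun (LinearMap.congr_fun key x) y
  · intro σ hσ μ hμ
    obtain ⟨χ, hχ⟩ := huniv (fun a => if h : a ∈ S.R then μ ⟨a, h⟩ else 1) (by
      intro a ha c hc hac
      have hac' := S.add_closed a ha c hc hac
      rw [dif_pos ha, dif_pos hc, dif_pos hac']
      have h1 := hσ (b ⟨a, ha⟩) (b ⟨c, hc⟩)
      rw [hμ, hμ, smul_lie, lie_smul, lie_basis hinj hb hac, map_smul, hμ, smul_smul, smul_smul,
        smul_smul] at h1
      have h2 := smul_left_injective ℂ (b.ne_zero _) h1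
      have h3 := S.ξ_sub_ne_zero hac
      ext
      rw [Units.val_mul]
      refine mul_left_cancel₀ h3 ?_
      simp only at h2 ⊢
      rw [h2]
      ring)
    exact ⟨χ, fun a => by rw [hχ a a.2, dif_pos a.2]⟩

/-- Good maximality in `Int(L)`: the case of a nondegenerate bicharacter. -/
theorem Realizes.isGood_lieInt {T : Subgroup (L ≃ₗ[ℂ] L)} (h : S.Realizes T)
    (hβ : ∀ a, (∀ c, S.β a c = 1) → a = 0)
    (hR : ∀ a ∈ S.R, ∀ n : ℕ, n • a ≠ 0 → n • a ∈ S.R) :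
    IsGoodFiniteMaximalQuasitorus (lieInt L) T := by
  obtain ⟨Φ, hinj, hrange, rfl⟩ := h
  obtain ⟨b, hb⟩ := exists_basis_of_range hinj hrange
  have hT := mem_diagGroup_iff_basis hinj hb
  have hexp : NeZero (Monoid.exponent (Multiplicative S.G)) := ⟨Monoid.exponent_ne_zero_of_finite⟩
  refine isGood_of_basis b hT ?_ ?_
  · -- the characters `β(a, ·)` with `a ∈ R` generate the dual group
    let B : S.G → Multiplicative S.G →* ℂˣ := fun a =>
      MonoidHom.mk' (fun c => S.β a c.toAdd) fun c d => S.β.add_right a _ _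
    have hBbij : Function.Bijective B := by
      have hinj : Function.Injective B := by
        intro a c hac
        rw [← sub_eq_zero]
        refine hβ _ fun d => ?_
        have h1 : S.β a d = S.β c d := DFunLike.congr_fun hac (Multiplicative.ofAdd d)
        have h2 := S.β.add_left (a - c) c d
        rw [sub_add_cancel, h1] at h2
        exact right_eq_mul.mp h2
      refine (Nat.bijective_iff_injective_and_card B).mpr ⟨hinj, ?_⟩
      exact (CommGroup.card_monoidHom_of_hasEnoughRootsOfUnity (Multiplicative S.G) ℂ).symm
    have key : ∀ a : S.G, (dualEquiv b hT (B a) : L ≃ₗ[ℂ] L) ∈ lieInt L := by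
      intro a
      -- In a finite group R generates already as a monoid, so the induction needs no inverses.
      have ha : a ∈ AddSubmonoid.closure S.R := by
        rw [← AddSubgroup.closure_toAddSubmonoid_of_finite, S.generates]
        trivial
      have hBadd : ∀ a c, B (a + c) = B a * B c := fun a c => by
        exact MonoidHom.ext fun d => S.β.add_left a c d.toAdd
      have hBzero : B 0 = 1 := by
        exact MonoidHom.ext fun d => S.β.map_zero_left d.toAdd
      induction ha using AddSubmonoid.closure_induction with
      | mem a ha =>
        refine mem_lieInt_of_diag S.ξ_isLift Φ hinj (a := a) ?_ ?_
        · intro n hn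
          exact ⟨b ⟨n • a, hR a ha n hn⟩, hb _⟩
        · have h1 : (Φ : L →ₗ[ℂ] TwistedLie S.ξ) ∘ₗ
              ((dualEquiv b hT (B a) : L ≃ₗ[ℂ] L) : L →ₗ[ℂ] L) =
              TwistedLie.diag S.ξ (S.β a) ∘ₗ (Φ : L →ₗ[ℂ] TwistedLie S.ξ) := by
            refine b.ext fun c => ?_
            change Φ ((dualEquiv b hT (B a) : L ≃ₗ[ℂ] L) (b c)) =
              TwistedLie.diag S.ξ (S.β a) (Φ (b c))
            rw [dualEquiv_basis, map_smul, hb, TwistedLie.diag_u]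
            rfl
          exact LinearMap.congr_fun h1
      | zero =>
        rw [hBzero, map_one]
        exact one_mem _
      | add a c _ _ ha hc =>
        rw [hBadd, map_mul]
        exact mul_mem ha hc
    intro σ hσ
    obtain ⟨χ, hχ⟩ := (dualEquiv b hT).surjective ⟨σ, hσ⟩
    obtain ⟨a, rfl⟩ := hBbij.2 χ
    have := key a
    rw [hχ] at this
    exact this
  · intro σ hσ μ hμ
    let _ := TwistedLie.ring S.ξ
    let _ := TwistedLie.algebra S.ξ
    -- The extension F respects the associative product, where u_a u_c never vanishes. Being
    -- diagonal on the u_a with a ∈ R, it is diagonal on all of them, with eigenvalues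
    -- multiplicative in a, also on commuting pairs.
    obtain ⟨F, hmul, hF⟩ := exists_mulEquiv_of_mem_lieInt Φ hσ
    have hμF : ∀ a : S.R, F (TwistedLie.u S.ξ a) = (μ a : ℂ) • TwistedLie.u S.ξ a := by
      intro a
      rw [← hb, ← hF, hμ, map_smul]
    have hne : ∀ (a : S.G) (r : ℂ), F (TwistedLie.u S.ξ a) = r • TwistedLie.u S.ξ a → r ≠ 0 := by
      rintro a r h rfl
      rw [zero_smul, LinearEquiv.map_eq_zero_iff] at h
      exact TwistedLie.u_ne_zero a h
    have hprod : ∀ (a c : S.G) (r s : ℂ), F (TwistedLie.u S.ξ a) = r • TwistedLie.u S.ξ a →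
        F (TwistedLie.u S.ξ c) = s • TwistedLie.u S.ξ c →
        F (TwistedLie.u S.ξ (a + c)) = (r * s) • TwistedLie.u S.ξ (a + c) := by
      intro a c r s ha hc
      have h1 := hmul (TwistedLie.u S.ξ a) (TwistedLie.u S.ξ c)
      rw [ha, hc, TwistedLie.u_mul_u, map_smul, smul_mul_assoc, mul_smul_comm,
        TwistedLie.u_mul_u, smul_smul, smul_smul, mul_comm (r * s), mul_smul] at h1
      exact (smul_right_injective _ (Units.ne_zero _)) h1
    have hex : ∀ a : S.G, ∃ r : ℂ, F (TwistedLie.u S.ξ a) = r • TwistedLie.u S.ξ a := by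
      intro a
      have ha : a ∈ AddSubmonoid.closure S.R := by
        rw [← AddSubgroup.closure_toAddSubmonoid_of_finite, S.generates]
        trivial
      induction ha using AddSubmonoid.closure_induction with
      | mem a ha => exact ⟨_, hμF ⟨a, ha⟩⟩
      | zero =>
        refine ⟨1, ?_⟩
        rw [one_smul]
        change F 1 = 1
        obtain ⟨y, hy⟩ := F.surjective 1
        have := hmul 1 y
        rw [one_mul, hy, mul_one] at this
        exact this.symm
      | add a c _ _ ha hc =>
        obtain ⟨r, hr⟩ := ha
        obtain ⟨s, hs⟩ := hc
        exact ⟨r * s, hprod a c r s hr hs⟩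
    choose r hr using hex
    have huniq : ∀ (a : S.G) (s : ℂ), F (TwistedLie.u S.ξ a) = s • TwistedLie.u S.ξ a → r a = s :=
      fun a s h => smul_left_injective ℂ (TwistedLie.u_ne_zero a) ((hr a).symm.trans h)
    refine ⟨MonoidHom.mk' (fun a => Units.mk0 (r a.toAdd) (hne _ _ (hr _))) fun a c => ?_,
      fun a => ?_⟩
    · ext
      exact huniq _ _ (hprod _ _ _ _ (hr _) (hr _))
    · ext
      exact huniq a _ (hμF a)

end FiniteRootSystem

/-! ### Uniqueness of the root system -/

namespace FiniteRootSystem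

variable {S : FiniteRootSystem.{u}} {S' : FiniteRootSystem.{v}}

theorem gradingIso_of_correspondsTo {L : Type w} [LieRing L] [LieAlgebra ℂ L]
    {T : Subgroup (L ≃ₗ[ℂ] L)} (h' : S'.CorrespondsTo T) (h : S.CorrespondsTo T) :
    GradingIso S'.standardGrading S.standardGrading := by
  obtain ⟨φ', ψ', h'⟩ := h'
  obtain ⟨φ, ψ, h⟩ := h
  refine ⟨φ'.trans φ.symm, ψ'.trans ψ.symm, fun a => ?_⟩
  have h1 := h (ψ.symm (ψ' a))
  rw [AddEquiv.apply_symm_apply, ← h' a] at h1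
  change _ = S.standardGrading (ψ.symm (ψ' a))
  ext x
  constructor
  · rintro ⟨y, hy, rfl⟩
    have hy' : φ' y ∈ (S'.standardGrading a).map (φ'.toLinearEquiv : S'.lieAlgebra →ₗ[ℂ] L) :=
      ⟨y, hy, rfl⟩
    rw [← h1] at hy'
    obtain ⟨z, hz, hzy⟩ := hy'
    have : φ.symm (φ' y) = z := by
      rw [← hzy]
      exact φ.symm_apply_apply z
    change φ.symm (φ' y) ∈ _
    rw [this]
    exact hz
  · intro hx
    have hx' : φ x ∈ (S.standardGrading (ψ.symm (ψ' a))).map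
        (φ.toLinearEquiv : S.lieAlgebra →ₗ[ℂ] L) := ⟨x, hx, rfl⟩
    rw [h1] at hx'
    obtain ⟨y, hy, hyx⟩ := hx'
    refine ⟨y, hy, ?_⟩
    change φ.symm (φ' y) = x
    change φ' y = φ x at hyx
    rw [hyx]
    exact φ.symm_apply_apply x

theorem exists_smul_of_mem_standardGrading {a : S.G} {x : S.lieAlgebra}
    (hx : x ∈ S.standardGrading a) :
    (∃ r : ℂ, (x : TwistedLie S.ξ) = r • TwistedLie.u S.ξ a) ∧ (a ∉ S.R → x = 0) := by
  induction hx using Submodule.span_induction with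
  | mem x hx => exact ⟨⟨1, by rw [hx.2, one_smul]⟩, fun h => absurd hx.1 h⟩
  | zero => exact ⟨⟨0, by rw [zero_smul]; rfl⟩, fun _ => rfl⟩
  | add x y _ _ hx hy =>
    obtain ⟨⟨r, hr⟩, h1⟩ := hx
    obtain ⟨⟨s, hs⟩, h2⟩ := hy
    refine ⟨⟨r + s, ?_⟩, fun h => by rw [h1 h, h2 h, add_zero]⟩
    rw [add_smul, ← hr, ← hs]
    rfl
  | smul r x _ hx =>
    obtain ⟨⟨s, hs⟩, h1⟩ := hx
    refine ⟨⟨r * s, ?_⟩, fun h => by rw [h1 h, smul_zero]⟩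
    rw [mul_smul, ← hs]
    rfl

theorem β_eq_one_iff (S : FiniteRootSystem.{u}) (a b : S.G) :
    S.β a b = 1 ↔ (S.ξ a b : ℂ) - S.ξ b a = 0 := by
  rw [S.ξ_isLift, mul_inv_eq_one, sub_eq_zero]
  exact Units.ext_iff

/-- An isomorphism of the standard gradings, in terms of the structure constants. -/
theorem exists_structure_constants (h : GradingIso S'.standardGrading S.standardGrading) :
    ∃ (ψ : S'.G ≃+ S.G) (c : S'.G → ℂ), (∀ a, a ∈ S'.R ↔ ψ a ∈ S.R) ∧ (∀ a ∈ S'.R, c a ≠ 0) ∧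
      (∀ a ∈ S'.R, ∀ b ∈ S'.R, (S'.β a b = 1 ↔ S.β (ψ a) (ψ b) = 1)) ∧
      ∀ a ∈ S'.R, ∀ b ∈ S'.R, ((S'.ξ a b : ℂ) - S'.ξ b a) * c (a + b) =
        c a * c b * ((S.ξ (ψ a) (ψ b) : ℂ) - S.ξ (ψ b) (ψ a)) := by
  classical
  obtain ⟨φ, ψ, h⟩ := h
  let U : ∀ a ∈ S'.R, S'.lieAlgebra := fun a ha =>
    ⟨TwistedLie.u S'.ξ a, Submodule.subset_span ⟨a, ha, rfl⟩⟩
  have hU : ∀ a ha, U a ha ∈ S'.standardGrading a := fun a ha =>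
    Submodule.subset_span ⟨ha, rfl⟩
  have hU0 : ∀ a ha, U a ha ≠ 0 := fun a ha h0 =>
    TwistedLie.u_ne_zero (ξ := S'.ξ) a (congrArg Subtype.val h0)
  have hφU : ∀ a ha, φ (U a ha) ∈ S.standardGrading (ψ a) := by
    intro a ha
    rw [← h a]
    exact ⟨_, hU a ha, rfl⟩
  have hφ0 : ∀ x, φ x = 0 → x = 0 := fun x hx => φ.injective (hx.trans (map_zero φ).symm)
  have hc : ∀ a, ∃ r : ℂ, ∀ ha : a ∈ S'.R,
      r ≠ 0 ∧ (φ (U a ha) : TwistedLie S.ξ) = r • TwistedLie.u S.ξ (ψ a) := by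
    intro a
    by_cases ha : a ∈ S'.R
    · obtain ⟨⟨r, hr⟩, -⟩ := exists_smul_of_mem_standardGrading (hφU a ha)
      refine ⟨r, fun _ => ⟨?_, hr⟩⟩
      rintro rfl
      rw [zero_smul] at hr
      exact hU0 a ha (hφ0 _ (Subtype.ext hr))
    · exact ⟨0, fun h => absurd h ha⟩
  choose c hc using hc
  have hR : ∀ a, a ∈ S'.R ↔ ψ a ∈ S.R := by
    intro a
    constructor
    · intro ha
      by_contra hψ
      exact hU0 a ha (hφ0 _ ((exists_smul_of_mem_standardGrading (hφU a ha)).2 hψ))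
    · intro ha
      by_contra ha'
      have hV : (⟨TwistedLie.u S.ξ (ψ a), Submodule.subset_span ⟨_, ha, rfl⟩⟩ : S.lieAlgebra) ∈
          S.standardGrading (ψ a) := Submodule.subset_span ⟨ha, rfl⟩
      rw [← h a] at hV
      obtain ⟨y, hy, hyV⟩ := hV
      rw [(exists_smul_of_mem_standardGrading hy).2 ha', map_zero] at hyV
      exact TwistedLie.u_ne_zero (ξ := S.ξ) (ψ a) (congrArg Subtype.val hyV).symm
  have hbr : ∀ a ha b hb, (φ ⁅U a ha, U b hb⁆ : TwistedLie S.ξ) =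
      (c a * c b * ((S.ξ (ψ a) (ψ b) : ℂ) - S.ξ (ψ b) (ψ a))) • TwistedLie.u S.ξ (ψ a + ψ b) := by
    intro a ha b hb
    rw [LieEquiv.map_lie, LieSubalgebra.coe_bracket, (hc a ha).2, (hc b hb).2, smul_lie, lie_smul,
      TwistedLie.lie_u, smul_smul, smul_smul]
  have hlie : ∀ a ha b hb, ((⁅U a ha, U b hb⁆ : S'.lieAlgebra) : TwistedLie S'.ξ) =
      ((S'.ξ a b : ℂ) - S'.ξ b a) • TwistedLie.u S'.ξ (a + b) :=
    fun a ha b hb => TwistedLie.lie_u a b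
  have hβ : ∀ a ∈ S'.R, ∀ b ∈ S'.R, (S'.β a b = 1 ↔ S.β (ψ a) (ψ b) = 1) := by
    intro a ha b hb
    have h2 : (S.ξ (ψ a) (ψ b) : ℂ) - S.ξ (ψ b) (ψ a) = 0 ↔
        φ ⁅U a ha, U b hb⁆ = 0 := by
      rw [Subtype.ext_iff, hbr a ha b hb]
      simp [TwistedLie.u_ne_zero, (hc a ha).1, (hc b hb).1]
    have h1 : (S'.ξ a b : ℂ) - S'.ξ b a = 0 ↔ ⁅U a ha, U b hb⁆ = 0 := by
      rw [Subtype.ext_iff, hlie a ha b hb]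
      simp [TwistedLie.u_ne_zero]
    rw [β_eq_one_iff S', β_eq_one_iff S, h1, h2]
    exact ⟨fun h => by rw [h, map_zero], hφ0 _⟩
  refine ⟨ψ, c, hR, fun a ha => (hc a ha).1, hβ, fun a ha b hb => ?_⟩
  by_cases hab : S'.β a b = 1
  · rw [(β_eq_one_iff S' a b).mp hab, (β_eq_one_iff S _ _).mp ((hβ a ha b hb).mp hab),
      zero_mul, mul_zero]
  · have hab' := S'.add_closed a ha b hb hab
    have h1 : ⁅U a ha, U b hb⁆ = ((S'.ξ a b : ℂ) - S'.ξ b a) • U (a + b) hab' :=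
      Subtype.ext (hlie a ha b hb)
    have h2 := hbr a ha b hb
    rw [h1, map_smul] at h2
    change ((S'.ξ a b : ℂ) - S'.ξ b a) • (φ (U (a + b) hab') : TwistedLie S.ξ) = _ at h2
    rw [(hc _ hab').2, smul_smul, map_add] at h2
    exact smul_left_injective ℂ (TwistedLie.u_ne_zero _) h2

theorem image_eq_of_mem_iff {ψ : S'.G ≃+ S.G} (h : ∀ a, a ∈ S'.R ↔ ψ a ∈ S.R) :
    ψ '' S'.R = S.R := by
  ext a
  constructor
  · rintro ⟨b, hb, rfl⟩
    exact (h b).mp hb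
  · intro ha
    exact ⟨ψ.symm a, (h _).mpr (by rwa [AddEquiv.apply_symm_apply]), ψ.apply_symm_apply a⟩

/-- Two bicharacters that agree on a generating set are equal. -/
theorem bicharacter_eq_of_closure {G : Type*} [AddCommGroup G] {β β' : Bicharacter G} {R : Set G}
    (hR : AddSubgroup.closure R = ⊤) (h : ∀ a ∈ R, ∀ b ∈ R, β a b = β' a b) (a b : G) :
    β a b = β' a b := by
  have hneg_left : ∀ (β : Bicharacter G) a b, β (-a) b = (β a b)⁻¹ := fun β a b => by
    rw [eq_inv_iff_mul_eq_one, ← β.add_left, neg_add_cancel, β.map_zero_left]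
  have hneg_right : ∀ (β : Bicharacter G) a b, β a (-b) = (β a b)⁻¹ := fun β a b => by
    rw [eq_inv_iff_mul_eq_one, ← β.add_right, neg_add_cancel, β.map_zero_right]
  have hmem : ∀ a : G, a ∈ AddSubgroup.closure R := fun a => by rw [hR]; trivial
  have h1 : ∀ a ∈ R, ∀ b, β a b = β' a b := by
    intro a ha b
    induction hmem b using AddSubgroup.closure_induction with
    | mem b hb => exact h a ha b hb
    | zero => rw [β.map_zero_right, β'.map_zero_right]
    | add b c _ _ hb hc => rw [β.add_right, β'.add_right, hb, hc]
    | neg b _ hb => rw [hneg_right, hneg_right, hb]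
  induction hmem a using AddSubgroup.closure_induction with
  | mem a ha => exact h1 a ha b
  | zero => rw [β.map_zero_left, β'.map_zero_left]
  | add a c _ _ ha hc => rw [β.add_left, β'.add_left, ha, hc]
  | neg a _ ha => rw [hneg_left, hneg_left, ha]

theorem eq_neg_one_of_two_torsion {G : Type*} [AddCommGroup G] (h2 : ∀ a : G, a + a = 0)
    (β : Bicharacter G) {a b : G} (h : β a b ≠ 1) : β a b = -1 := by
  have h1 : β a b * β a b = 1 := by rw [← β.add_left, h2, β.map_zero_left]
  rcases mul_self_eq_one_iff.mp ((Units.val_mul _ _).symm.trans (congrArg Units.val h1)) with h | h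
  · exact absurd (Units.ext h) ‹_›
  · exact Units.ext h

/-- The pullback of a bicharacter. -/
def _root_.Bicharacter.comap {G H : Type*} [AddCommGroup G] [AddCommGroup H] (β : Bicharacter H)
    (f : G →+ H) : Bicharacter G where
  toFun a b := β (f a) (f b)
  add_left a b c := by rw [map_add, β.add_left]
  add_right a b c := by rw [map_add, β.add_right]

/-- Here β has values ±1, so on R it is determined by which brackets vanish, and R generates the
group. -/
theorem iso_of_gradingIso_of_two_torsion (h2 : ∀ a : S.G, a + a = 0)
    (h : GradingIso S'.standardGrading S.standardGrading) : S'.Iso S := by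
  obtain ⟨ψ, c, hR, -, hβ, -⟩ := exists_structure_constants h
  have h2' : ∀ a : S'.G, a + a = 0 := fun a => ψ.injective (by rw [map_add, h2, map_zero])
  refine ⟨ψ, fun a b => ?_, image_eq_of_mem_iff hR⟩
  refine bicharacter_eq_of_closure (β := S.β.comap ψ.toAddMonoidHom) S'.generates
    (fun a ha b hb => ?_) a b
  change S.β (ψ a) (ψ b) = S'.β a b
  by_cases hab : S'.β a b = 1
  · rw [hab, (hβ a ha b hb).mp hab]
  · rw [eq_neg_one_of_two_torsion h2' S'.β hab,
      eq_neg_one_of_two_torsion h2 S.β (mt (hβ a ha b hb).mpr hab)]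

/-- A group is not the union of two proper subgroups. -/
theorem forall_eq_or_forall_eq_inv {G A : Type*} [AddCommGroup G] [CommGroup A] {f g : G → A}
    (hf : ∀ a b, f (a + b) = f a * f b) (hg : ∀ a b, g (a + b) = g a * g b)
    (h : ∀ a, g a = f a ∨ g a = (f a)⁻¹) : (∀ a, g a = f a) ∨ ∀ a, g a = (f a)⁻¹ := by
  by_contra! hne
  obtain ⟨⟨a, ha⟩, b, hb⟩ := hne
  have ha' := (h a).resolve_left ha
  have hb' := (h b).resolve_right hb
  rcases h (a + b) with h1 | h1
  · rw [hf, hg, hb'] at h1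
    exact ha (mul_right_cancel h1)
  · rw [hf, hg, ha', mul_inv] at h1
    exact hb (mul_left_cancel h1)

theorem norm_bicharacter {G : Type*} [AddCommGroup G] [Finite G] (β : Bicharacter G) (a b : G) :
    ‖(β a b : ℂ)‖ = 1 := by
  have h : β a b ^ addOrderOf a = 1 := by
    rw [← β.map_nsmul_left, addOrderOf_nsmul_eq_zero, β.map_zero_left]
  refine Complex.norm_eq_one_of_pow_eq_one (n := addOrderOf a) ?_ (addOrderOf_pos a).ne'
  rw [← Units.val_pow_eq_pow_val, h, Units.val_one]

/-- Expand |f - 1|² = 2 - 2 Re f and use that a nontrivial character sums to zero. The value is the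
same for all such f, which later forces the scaling factors between two gradings to have modulus 1.
-/
theorem sum_normSq_sub_one {G : Type*} [AddCommGroup G] [Fintype G] {f : G → ℂ}
    (hf : ∀ a b, f (a + b) = f a * f b) (hnorm : ∀ a, ‖f a‖ = 1) (hne : ∃ a, f a ≠ 1) :
    ∑ a, ‖f a - 1‖ ^ 2 = 2 * Fintype.card G := by
  obtain ⟨a, ha⟩ := hne
  have h0 : ∑ b, f b = 0 := by
    have h1 : f a * ∑ b, f b = ∑ b, f b := by
      rw [Finset.mul_sum]
      simp only [← hf]
      exact Fintype.sum_equiv (Equiv.addLeft a) _ _ fun b => rfl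
    have h2 : (f a - 1) * ∑ b, f b = 0 := by rw [sub_mul, h1, one_mul, sub_self]
    exact (mul_eq_zero.mp h2).resolve_left (sub_ne_zero.mpr ha)
  have h1 : ∀ b, ‖f b - 1‖ ^ 2 = 2 - 2 * (f b).re := by
    intro b
    have h2 := hnorm b
    rw [Complex.norm_eq_sqrt_sq_add_sq, Real.sqrt_eq_one] at h2
    rw [Complex.sq_norm, Complex.normSq_apply]
    simp only [Complex.sub_re, Complex.one_re, Complex.sub_im, Complex.one_im]
    linarith
  simp only [h1]
  rw [Finset.sum_sub_distrib, ← Finset.mul_sum, ← Complex.re_sum, h0]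
  simp [mul_comm]

/-- Points of the unit circle at equal distance from 1 have equal real parts, so they coincide or
are complex conjugates. -/
theorem eq_or_eq_inv_of_norm_sub_one {z w : ℂˣ} (hz : ‖(z : ℂ)‖ = 1) (hw : ‖(w : ℂ)‖ = 1)
    (h : ‖(w : ℂ) - 1‖ = ‖(z : ℂ) - 1‖) : w = z ∨ w = z⁻¹ := by
  have h1 : ‖(w : ℂ) - 1‖ ^ 2 = ‖(z : ℂ) - 1‖ ^ 2 := by rw [h]
  have hz2 : ‖(z : ℂ)‖ ^ 2 = 1 := by rw [hz, one_pow]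
  have hw2 : ‖(w : ℂ)‖ ^ 2 = 1 := by rw [hw, one_pow]
  rw [Complex.sq_norm, Complex.normSq_apply] at hz2 hw2
  rw [Complex.sq_norm, Complex.sq_norm, Complex.normSq_apply, Complex.normSq_apply] at h1
  simp only [Complex.sub_re, Complex.one_re, Complex.sub_im, Complex.one_im, sub_zero] at h1
  have hre : (w : ℂ).re = (z : ℂ).re := by linarith
  have him : (w : ℂ).im = (z : ℂ).im ∨ (w : ℂ).im = -(z : ℂ).im := by
    rw [← mul_self_eq_mul_self_iff]
    rw [hre] at hw2
    linarith
  rcases him with him | him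
  · exact Or.inl (Units.ext (Complex.ext hre him))
  · refine Or.inr (eq_inv_of_mul_eq_one_left (Units.ext (Complex.ext ?_ ?_)))
    · rw [Units.val_mul, Complex.mul_re, hre, him]
      simp only [Units.val_one, Complex.one_re]
      linarith
    · rw [Units.val_mul, Complex.mul_im, hre, him]
      simp only [Units.val_one, Complex.one_im]
      ring

/-- Since ξ has values of modulus 1, the moduli of the structure constants depend on β only and not
on the choice of ξ. -/
theorem norm_ξ_sub (S : FiniteRootSystem.{u}) (a b : S.G) :
    ‖(S.ξ a b : ℂ) - S.ξ b a‖ = ‖(S.β a b : ℂ) - 1‖ := by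
  have : (S.ξ a b : ℂ) - S.ξ b a = S.ξ b a * ((S.β a b : ℂ) - 1) := by
    rw [S.ξ_isLift a b, mul_sub, mul_one, ← Units.val_mul, mul_comm (S.ξ a b), mul_inv_cancel_left]
  rw [this, norm_mul, norm_bicharacter, one_mul]

/-- Uniqueness in the case `R = G \ {0}`, if `β` is isomorphic to its inverse. -/
theorem iso_of_gradingIso_of_forall_mem (hS : ∀ a : S.G, a ≠ 0 → a ∈ S.R)
    (τ : S.G ≃+ S.G) (hτ : ∀ a b, S.β (τ a) (τ b) = (S.β a b)⁻¹)
    (h : GradingIso S'.standardGrading S.standardGrading) : S'.Iso S := by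
  classical
  have hfin := Fintype.ofFinite S'.G
  obtain ⟨ψ, c, hR, hc0, hβ, hc⟩ := exists_structure_constants h
  have hR' : ∀ a : S'.G, a ≠ 0 → a ∈ S'.R := fun a ha =>
    (hR a).mpr (hS _ fun h => ha (ψ.injective (h.trans (map_zero ψ).symm)))
  have hnorm : ∀ a ∈ S'.R, ∀ b,
      ‖(S'.β a b : ℂ) - 1‖ = ‖c a‖ * ‖(S.β (ψ a) (ψ b) : ℂ) - 1‖ := by
    intro a ha b
    by_cases hb : b = 0
    · rw [hb, map_zero, S.β.map_zero_right, S'.β.map_zero_right]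
      simp
    by_cases hab : S'.β a b = 1
    · rw [hab, (hβ a ha b (hR' b hb)).mp hab]
      simp
    -- β(a,·) is constant along b, a + b, 2a + b, …. Multiplying the relations between moduli along
    -- this cycle, which closes after the order of a, leaves the factor |c(b)| on both sides and an
    -- equality of powers.
    have hmul : ∀ n : ℕ, S'.β a (n • a + b) = S'.β a b := fun n => by
      rw [S'.β.add_right, S'.β.map_nsmul_right, S'.alternating, one_pow, one_mul]
    have hmul' : ∀ n : ℕ, S.β (ψ a) (ψ (n • a + b)) = S.β (ψ a) (ψ b) := fun n => by
      rw [map_add, map_nsmul, S.β.add_right, S.β.map_nsmul_right, S.alternating, one_pow, one_mul]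
    have hmem : ∀ n : ℕ, n • a + b ∈ S'.R := by
      intro n
      refine hR' _ fun h0 => hab ?_
      rw [← hmul n, h0, S'.β.map_zero_right]
    have hstep : ∀ n : ℕ, ‖c ((n + 1) • a + b)‖ * ‖(S'.β a b : ℂ) - 1‖ =
        ‖c (n • a + b)‖ * (‖c a‖ * ‖(S.β (ψ a) (ψ b) : ℂ) - 1‖) := by
      intro n
      have h1 := congrArg norm (hc a ha _ (hmem n))
      rw [norm_mul, norm_mul, norm_mul, norm_ξ_sub, norm_ξ_sub, hmul, hmul', ← add_assoc,
        add_comm a,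
        ← succ_nsmul] at h1
      linarith
    have hpow : ∀ n : ℕ, ‖c (n • a + b)‖ * ‖(S'.β a b : ℂ) - 1‖ ^ n =
        ‖c b‖ * (‖c a‖ * ‖(S.β (ψ a) (ψ b) : ℂ) - 1‖) ^ n := by
      intro n
      induction n with
      | zero => simp
      | succ n ih =>
        rw [pow_succ', ← mul_assoc, hstep, mul_right_comm, ih, mul_assoc, ← pow_succ]
    have h1 := hpow (addOrderOf a)
    rw [addOrderOf_nsmul_eq_zero, zero_add] at h1
    have h2 := mul_left_cancel₀ (norm_ne_zero_iff.mpr (hc0 b (hR' b hb))) h1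
    exact (pow_left_inj₀ (norm_nonneg _) (by positivity) (addOrderOf_pos a).ne').mp h2
  have hψadd : ∀ a b d, S.β (ψ a) (ψ (b + d)) = S.β (ψ a) (ψ b) * S.β (ψ a) (ψ d) :=
    fun a b d => by rw [map_add, S.β.add_right]
  have hpt : ∀ a b, S.β (ψ a) (ψ b) = S'.β a b ∨ S.β (ψ a) (ψ b) = (S'.β a b)⁻¹ := by
    intro a b
    by_cases ha : a = 0
    · rw [ha, map_zero, S.β.map_zero_left, S'.β.map_zero_left]
      exact Or.inl rfl
    have haR := hR' a ha
    have hex : ∃ b, (S'.β a b : ℂ) ≠ 1 := by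
      by_contra! hall
      exact S'.disjoint_radical haR fun b => Units.ext (hall b)
    have hex' : ∃ b, (S.β (ψ a) (ψ b) : ℂ) ≠ 1 := by
      by_contra! hall
      refine S.disjoint_radical ((hR a).mp haR) fun b => Units.ext ?_
      rw [← ψ.apply_symm_apply b]
      exact hall _
    have s1 := sum_normSq_sub_one (f := fun b => (S'.β a b : ℂ))
      (fun b d => by rw [S'.β.add_right, Units.val_mul]) (fun b => norm_bicharacter _ _ _) hex
    have s2 := sum_normSq_sub_one (f := fun b => (S.β (ψ a) (ψ b) : ℂ))
      (fun b d => by rw [hψadd, Units.val_mul]) (fun b => norm_bicharacter _ _ _) hex'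
    -- Both b ↦ β'(a,b) and b ↦ β(ψ a, ψ b) are nontrivial characters, so the squares in `hnorm`
    -- have the same total on either side.
    have hK : ‖c a‖ ^ 2 = 1 := by
      simp only [hnorm a haR, mul_pow] at s1
      rw [← Finset.mul_sum, s2] at s1
      have hcard : (2 * Fintype.card S'.G : ℝ) ≠ 0 := by
        have := Fintype.card_pos (α := S'.G)
        positivity
      exact mul_right_cancel₀ hcard (s1.trans (one_mul _).symm)
    have hK1 : ‖c a‖ = 1 := (pow_eq_one_iff_of_nonneg (norm_nonneg _) two_ne_zero).mp hK
    have := hnorm a haR b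
    rw [hK1, one_mul] at this
    exact eq_or_eq_inv_of_norm_sub_one (norm_bicharacter _ _ _) (norm_bicharacter _ _ _) this.symm
  -- The choice between a value and its inverse is made uniform twice: in b for fixed a, and then in
  -- a, with whole rows as elements of a group of functions.
  have hrow : ∀ a, (fun b => S.β (ψ a) (ψ b)) = (fun b => S'.β a b) ∨
      (fun b => S.β (ψ a) (ψ b)) = (fun b => S'.β a b)⁻¹ := by
    intro a
    rcases forall_eq_or_forall_eq_inv (f := fun b => S'.β a b) (g := fun b => S.β (ψ a) (ψ b))
      (S'.β.add_right a) (hψadd a) (hpt a) with h | h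
    · exact Or.inl (funext h)
    · exact Or.inr (funext h)
  rcases forall_eq_or_forall_eq_inv (f := fun a b => S'.β a b) (g := fun a b => S.β (ψ a) (ψ b))
      (fun a b => funext (S'.β.add_left a b))
      (fun a b => funext fun d => by rw [map_add, S.β.add_left]; rfl) hrow with h | h
  · exact ⟨ψ, fun a b => congrFun (h a) b, image_eq_of_mem_iff hR⟩
  -- In this case ψ inverts the bicharacter, and τ inverts it back.
  · refine ⟨ψ.trans τ, fun a b => ?_, image_eq_of_mem_iff fun a => ?_⟩
    · change S.β (τ (ψ a)) (τ (ψ b)) = _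
      rw [hτ, congrFun (h a) b]
      simp
    · have hτψ : (ψ.trans τ) a = 0 ↔ a = 0 := AddEquiv.map_eq_zero_iff _
      refine ⟨fun ha => hS _ fun h => ?_, fun ha => hR' _ fun h => ?_⟩
      · rw [hτψ.mp h] at ha
        exact zero_notMem ha
      · rw [hτψ.mpr h] at ha
        exact zero_notMem ha

end FiniteRootSystem

/-! ### Orthogonal Lie algebras inside twisted group algebras -/

section Clifford

variable {ι : Type*} [Fintype ι] [DecidableEq ι] {A : Type*} [Ring A] [Algebra ℂ A]

/-- Elements that behave like the products of pairs of Clifford generators span an image of the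
orthogonal Lie algebra. -/
theorem clifford_commutator {E E' : ι → A}
    (h1 : ∀ j k, E j * E' k + E k * E' j = (2 * (1 : Matrix ι ι ℂ) j k) • (1 : A))
    (h2 : ∀ i k, E' i * E k + E' k * E i = (2 * (1 : Matrix ι ι ℂ) i k) • (1 : A))
    {x y : Matrix ι ι ℂ} (hx : xᵀ = -x) :
    (∑ p : ι × ι, x p.1 p.2 • (E' p.1 * E p.2)) * (∑ q : ι × ι, y q.1 q.2 • (E' q.1 * E q.2)) -
      (∑ q : ι × ι, y q.1 q.2 • (E' q.1 * E q.2)) * (∑ p : ι × ι, x p.1 p.2 • (E' p.1 * E p.2)) =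
      (4 : ℂ) • ∑ p : ι × ι, (x * y - y * x) p.1 p.2 • (E' p.1 * E p.2) := by
  let M : ι → ι → A := fun i j => E' i * E j
  let δ : ι → ι → ℂ := (1 : Matrix ι ι ℂ)
  have hM : ∀ i j, E' i * E j = M i j := fun i j => rfl
  -- `r1` exchanges the two inner factors and `r2` the two factors of one M. Two uses of each reduce
  -- both products in the commutator to M_{ki} M_{jl}, which cancels and leaves the contraction
  -- terms.
  have r1 : ∀ i j k l, M i j * M k l = (2 * δ j k) • M i l - M i k * M j l := by
    intro i j k l
    have e1 : M i j * M k l = E' i * (E j * E' k) * E l := by simp only [M, mul_assoc]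
    have e2 : M i k * M j l = E' i * (E k * E' j) * E l := by simp only [M, mul_assoc]
    rw [e1, e2, eq_sub_iff_add_eq, ← add_mul, ← mul_add, h1, mul_smul_comm, mul_one,
      smul_mul_assoc]
  have r2 : ∀ i k, M i k = (2 * δ i k) • 1 - M k i := fun i k =>
    eq_sub_of_add_eq (h2 i k)
  have comm : ∀ i j k l, M i j * M k l - M k l * M i j =
      (2 : ℂ) • (δ j k • M i l - δ i k • M j l - δ l i • M k j + δ l j • M k i) := by
    intro i j k l
    have e1 : M i k * M j l = (2 * δ i k) • M j l - M k i * M j l := by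
      rw [r2 i k, sub_mul, smul_mul_assoc, one_mul]
    have e2 : M k i * M l j = (2 * δ l j) • M k i - M k i * M j l := by
      rw [r2 l j, mul_sub, mul_smul_comm, mul_one]
    rw [r1 i j k l, r1 k l i j, e1, e2]
    simp only [smul_add, smul_sub, smul_smul]
    abel
  have contract : ∀ x y : Matrix ι ι ℂ, ∑ p : ι × ι, ∑ q : ι × ι,
      (x p.1 p.2 * y q.1 q.2 * δ p.2 q.1) • M p.1 q.2 =
        ∑ p : ι × ι, (x * y) p.1 p.2 • M p.1 p.2 := by
    intro x y
    simp only [Fintype.sum_prod_type, δ, Matrix.one_apply, mul_ite, mul_one, mul_zero, ite_smul,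
      zero_smul, Matrix.mul_apply, Finset.sum_smul]
    refine Finset.sum_congr rfl fun i _ => ?_
    rw [Finset.sum_comm (s := Finset.univ) (t := Finset.univ)
      (f := fun l j => (x i j * y j l) • M i l)]
    refine Finset.sum_congr rfl fun j _ => ?_
    rw [Finset.sum_eq_single j]
    · simp
    · intro k _ hk
      simp [hk.symm]
    · simp
  have hx' : ∀ i j, x i j = -x j i := fun i j => congrFun (congrFun hx j) i
  -- Transposing x costs a sign; this turns the contractions over the first index of x in `s2`, and
  -- over both second indices in `s4`, into matrix products.
  have s2 : ∑ p : ι × ι, ∑ q : ι × ι, (x p.1 p.2 * y q.1 q.2 * δ p.1 q.1) • M p.2 q.2 =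
      -∑ p : ι × ι, (x * y) p.1 p.2 • M p.1 p.2 := by
    rw [← contract, ← Finset.sum_neg_distrib]
    refine Fintype.sum_equiv (Equiv.prodComm ι ι) _ _ fun p => ?_
    rw [← Finset.sum_neg_distrib]
    refine Finset.sum_congr rfl fun q _ => ?_
    change _ = -((x p.2 p.1 * y q.1 q.2 * δ p.1 q.1) • M p.2 q.2)
    rw [hx' p.1 p.2, ← neg_smul]
    congr 1
    ring
  have s3 : ∑ p : ι × ι, ∑ q : ι × ι, (x p.1 p.2 * y q.1 q.2 * δ q.2 p.1) • M q.1 p.2 =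
      ∑ p : ι × ι, (y * x) p.1 p.2 • M p.1 p.2 := by
    rw [← contract, Finset.sum_comm]
    refine Finset.sum_congr rfl fun q _ => Finset.sum_congr rfl fun p _ => ?_
    rw [mul_comm (x _ _)]
  have s4 : ∑ p : ι × ι, ∑ q : ι × ι, (x p.1 p.2 * y q.1 q.2 * δ q.2 p.2) • M q.1 p.1 =
      -∑ p : ι × ι, (y * x) p.1 p.2 • M p.1 p.2 := by
    rw [← s3, ← Finset.sum_neg_distrib]
    refine Fintype.sum_equiv (Equiv.prodComm ι ι) _ _ fun p => ?_
    rw [← Finset.sum_neg_distrib]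
    refine Finset.sum_congr rfl fun q _ => ?_
    change _ = -((x p.2 p.1 * y q.1 q.2 * δ q.2 p.2) • M q.1 p.1)
    rw [hx' p.1 p.2, ← neg_smul]
    congr 1
    ring
  have expand : (∑ p : ι × ι, x p.1 p.2 • (E' p.1 * E p.2)) *
      (∑ q : ι × ι, y q.1 q.2 • (E' q.1 * E q.2)) -
      (∑ q : ι × ι, y q.1 q.2 • (E' q.1 * E q.2)) * (∑ p : ι × ι, x p.1 p.2 • (E' p.1 * E p.2)) =
      ∑ p : ι × ι, ∑ q : ι × ι, (x p.1 p.2 * y q.1 q.2) •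
        (M p.1 p.2 * M q.1 q.2 - M q.1 q.2 * M p.1 p.2) := by
    rw [Finset.sum_mul_sum, Finset.sum_mul_sum]
    rw [Finset.sum_comm (γ := ι × ι), ← Finset.sum_sub_distrib]
    rw [Finset.sum_comm]
    refine Finset.sum_congr rfl fun p _ => ?_
    rw [← Finset.sum_sub_distrib]
    refine Finset.sum_congr rfl fun q _ => ?_
    rw [smul_mul_smul_comm, smul_mul_smul_comm, smul_sub, mul_comm (y _ _)]
  have pointwise : ∀ p q : ι × ι, (x p.1 p.2 * y q.1 q.2) •
      (M p.1 p.2 * M q.1 q.2 - M q.1 q.2 * M p.1 p.2) =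
      (2 : ℂ) • ((x p.1 p.2 * y q.1 q.2 * δ p.2 q.1) • M p.1 q.2 -
        (x p.1 p.2 * y q.1 q.2 * δ p.1 q.1) • M p.2 q.2 -
        (x p.1 p.2 * y q.1 q.2 * δ q.2 p.1) • M q.1 p.2 +
        (x p.1 p.2 * y q.1 q.2 * δ q.2 p.2) • M q.1 p.1) := by
    intro p q
    rw [comm]
    module
  have final : ∑ p : ι × ι, (x * y - y * x) p.1 p.2 • (E' p.1 * E p.2) =
      ∑ p : ι × ι, (x * y) p.1 p.2 • M p.1 p.2 - ∑ p : ι × ι, (y * x) p.1 p.2 • M p.1 p.2 := by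
    rw [← Finset.sum_sub_distrib]
    exact Finset.sum_congr rfl fun p _ => by rw [Matrix.sub_apply, sub_smul]
  rw [expand, final]
  simp only [pointwise, ← Finset.smul_sum, Finset.sum_add_distrib, Finset.sum_sub_distrib]
  rw [contract, s2, s3, s4]
  module

end Clifford

namespace FiniteRootSystem

section Orthogonal

variable {S : FiniteRootSystem.{v}} {ι : Type u} [Fintype ι] [DecidableEq ι] {i₀ : ι}
  {h : ι → S.G}

section

attribute [local instance] TwistedLie.ring TwistedLie.algebra

/-- For i ≠ i₀ the u_{h i}, rescaled to have square -1, are Clifford generators E_i. Adjoining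
E_{i₀} = 1 and the conjugate family E' makes the products E'_i E_j behave like e_i e_j for one
generator more, the even part of a larger Clifford algebra. The scalars m relate E'_i E_j to u_{h i
+ h j}. -/
theorem exists_clifford_coefficients (h2 : ∀ a : S.G, a + a = 0) (h0 : h i₀ = 0)
    (hβ : ∀ i j, i ≠ j → i ≠ i₀ → j ≠ i₀ → S.β (h i) (h j) = -1) :
    ∃ m : ι → ι → ℂ, (∀ i j, m i j ≠ 0) ∧ (∀ i j, i ≠ j → m j i = -m i j) ∧
      ∀ x y : Matrix ι ι ℂ, xᵀ = -x →
        ⁅∑ p : ι × ι, (x p.1 p.2 * m p.1 p.2) • TwistedLie.u S.ξ (h p.1 + h p.2),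
          ∑ p : ι × ι, (y p.1 p.2 * m p.1 p.2) • TwistedLie.u S.ξ (h p.1 + h p.2)⁆ =
        (4 : ℂ) • ∑ p : ι × ι, ((x * y - y * x) p.1 p.2 * m p.1 p.2) •
          TwistedLie.u S.ξ (h p.1 + h p.2) := by
  have hc : ∀ i, ∃ c : ℂ, c ^ 2 = -((S.ξ (h i) (h i))⁻¹ : ℂˣ) := fun i =>
    IsAlgClosed.exists_pow_nat_eq _ two_pos
  choose c hc using hc
  have hc0 : ∀ i, c i ≠ 0 := by
    intro i hi
    have := hc i
    rw [hi, zero_pow two_ne_zero, eq_comm, neg_eq_zero] at this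
    exact Units.ne_zero _ this
  let E : ι → TwistedLie S.ξ := fun i => if i = i₀ then 1 else c i • TwistedLie.u S.ξ (h i)
  let E' : ι → TwistedLie S.ξ := fun i => if i = i₀ then 1 else -E i
  have hE0 : E i₀ = 1 := if_pos rfl
  have hE0' : E' i₀ = 1 := if_pos rfl
  have hE' : ∀ i, i ≠ i₀ → E' i = -E i := fun i hi => if_neg hi
  have hEi : ∀ i, i ≠ i₀ → E i = c i • TwistedLie.u S.ξ (h i) := fun i hi => if_neg hi
  have hsq : ∀ i, i ≠ i₀ → E i * E i = -1 := by
    intro i hi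
    rw [hEi i hi, smul_mul_smul_comm, TwistedLie.u_mul_u, smul_smul, h2, ← pow_two, hc, neg_mul,
      ← Units.val_mul, inv_mul_cancel, Units.val_one, neg_smul, one_smul]
    rfl
  have hanti : ∀ i j, i ≠ j → i ≠ i₀ → j ≠ i₀ → E i * E j = -(E j * E i) := by
    intro i j hij hi hj
    rw [hEi i hi, hEi j hj, smul_mul_smul_comm, smul_mul_smul_comm,
      TwistedLie.u_mul_comm S.ξ_isLift, hβ i j hij hi hj, mul_comm (c i)]
    simp
  have h1 : ∀ j k, E j * E' k + E k * E' j =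
      (2 * (1 : Matrix ι ι ℂ) j k) • (1 : TwistedLie S.ξ) := by
    intro j k
    by_cases hjk : j = k
    · subst hjk
      rw [Matrix.one_apply_eq, mul_one, two_smul]
      by_cases hj : j = i₀
      · rw [hj, hE0, hE0', mul_one]
      · rw [hE' j hj, mul_neg, hsq j hj, neg_neg]
    · rw [Matrix.one_apply_ne hjk, mul_zero, zero_smul]
      by_cases hj : j = i₀
      · have hk : k ≠ i₀ := fun h => hjk (hj.trans h.symm)
        rw [hj, hE0, hE0', hE' k hk]
        simp
      · by_cases hk : k = i₀
        · rw [hk, hE0, hE0', hE' j hj]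
          simp
        · rw [hE' j hj, hE' k hk, mul_neg, mul_neg, hanti j k hjk hj hk]
          simp
  have h1' : ∀ j k, E' j * E k + E' k * E j =
      (2 * (1 : Matrix ι ι ℂ) j k) • (1 : TwistedLie S.ξ) := by
    intro j k
    by_cases hjk : j = k
    · subst hjk
      rw [Matrix.one_apply_eq, mul_one, two_smul]
      by_cases hj : j = i₀
      · rw [hj, hE0, hE0', mul_one]
      · rw [hE' j hj, neg_mul, hsq j hj, neg_neg]
    · rw [Matrix.one_apply_ne hjk, mul_zero, zero_smul]
      by_cases hj : j = i₀
      · have hk : k ≠ i₀ := fun h => hjk (hj.trans h.symm)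
        rw [hj, hE0, hE0', hE' k hk]
        simp
      · by_cases hk : k = i₀
        · rw [hk, hE0, hE0', hE' j hj]
          simp
        · rw [hE' j hj, hE' k hk, neg_mul, neg_mul, hanti j k hjk hj hk]
          simp
  have hu : ∀ i, ∃ r : ℂ, r ≠ 0 ∧ E i = r • TwistedLie.u S.ξ (h i) := by
    intro i
    by_cases hi : i = i₀
    · exact ⟨1, one_ne_zero, by rw [hi, hE0, h0, one_smul]; rfl⟩
    · exact ⟨c i, hc0 i, hEi i hi⟩
  have hu' : ∀ i, ∃ r : ℂ, r ≠ 0 ∧ E' i = r • TwistedLie.u S.ξ (h i) := by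
    intro i
    by_cases hi : i = i₀
    · exact ⟨1, one_ne_zero, by rw [hi, hE0', h0, one_smul]; rfl⟩
    · exact ⟨-c i, neg_ne_zero.mpr (hc0 i), by rw [hE' i hi, hEi i hi, neg_smul]⟩
  have hM : ∀ i j, ∃ r : ℂ, r ≠ 0 ∧ E' i * E j = r • TwistedLie.u S.ξ (h i + h j) := by
    intro i j
    obtain ⟨r, hr, hri⟩ := hu' i
    obtain ⟨s, hs, hsj⟩ := hu j
    refine ⟨r * s * S.ξ (h i) (h j), mul_ne_zero (mul_ne_zero hr hs) (Units.ne_zero _), ?_⟩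
    rw [hri, hsj, smul_mul_smul_comm, TwistedLie.u_mul_u, smul_smul]
  choose m hm0 hm using hM
  refine ⟨m, hm0, fun i j hij => ?_, fun x y hx => ?_⟩
  · have := h1' i j
    rw [hm, hm, Matrix.one_apply_ne hij, mul_zero, zero_smul, add_comm (h j), ← add_smul,
      smul_eq_zero] at this
    exact (eq_neg_of_add_eq_zero_right (this.resolve_right (TwistedLie.u_ne_zero _)))
  · simp only [mul_smul, ← hm]
    rw [TwistedLie.lie_eq_sub]
    exact clifford_commutator h1 h1' hx

end

attribute [local instance] LieRing.ofAssociativeRing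

theorem diagonal_conj_of_signs {n : Type*} [Fintype n] [DecidableEq n] {d : n → ℂ}
    (hd : ∀ i, d i = 1 ∨ d i = -1) (x : Matrix n n ℂ) (i j : n) :
    (Matrix.diagonal d * x * (Matrix.diagonal d)⁻¹) i j = d i * d j * x i j := by
  have hdd : ∀ i, d i * d i = 1 := fun i => by rcases hd i with h | h <;> rw [h] <;> norm_num
  have : (Matrix.diagonal d)⁻¹ = Matrix.diagonal d := by
    refine Matrix.inv_eq_right_inv ?_
    rw [Matrix.diagonal_mul_diagonal]
    simp [hdd]
  rw [this, Matrix.mul_diagonal, Matrix.diagonal_mul]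
  ring

theorem isUnit_diagonal_of_signs {n : Type*} [Fintype n] [DecidableEq n] {d : n → ℂ}
    (hd : ∀ i, d i = 1 ∨ d i = -1) : IsUnit (Matrix.diagonal d) := by
  have hdd : ∀ i, d i * d i = 1 := fun i => by rcases hd i with h | h <;> rw [h] <;> norm_num
  have : Matrix.diagonal d * Matrix.diagonal d = 1 := by
    rw [Matrix.diagonal_mul_diagonal]
    simp [hdd]
  exact IsUnit.of_mul_eq_one _ this

/-- The embedding sends a skew matrix x to (1/4) ∑ x_ij m_ij u_{h i + h j}, where 1/4 compensates
the 4 in the commutator formula. By `hdist` different unordered pairs have different degrees, so the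
entries can be read off; conjugation by diag(d) scales entry (i,j) by d_i d_j, which is compared
with χ(h i + h j). -/
theorem realizes_adGroup_so {ι : Type} [Fintype ι] [DecidableEq ι] {i₀ : ι} {h : ι → S.G}
    (h2 : ∀ a : S.G, a + a = 0) (h0 : h i₀ = 0)
    (hβ : ∀ i j, i ≠ j → i ≠ i₀ → j ≠ i₀ → S.β (h i) (h j) = -1)
    (hR : ∀ a, a ∈ S.R ↔ ∃ i j, i ≠ j ∧ a = h i + h j)
    (hdist : ∀ i j k l, i ≠ j → k ≠ l → h k + h l = h i + h j → (k, l) = (i, j) ∨ (k, l) = (j, i))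
    {A : Set (Matrix ι ι ℂ)}
    (hA : ∀ g ∈ A, ∃ d : ι → ℂ, (∀ i, d i = 1 ∨ d i = -1) ∧ g = Matrix.diagonal d ∧
      ∃ χ : Multiplicative S.G →* ℂˣ, ∀ i j, (χ (.ofAdd (h i + h j)) : ℂ) = d i * d j)
    (hA' : ∀ χ : Multiplicative S.G →* ℂˣ, ∃ d : ι → ℂ, (∀ i, d i = 1 ∨ d i = -1) ∧
      Matrix.diagonal d ∈ A ∧ ∀ i j, (χ (.ofAdd (h i + h j)) : ℂ) = d i * d j) :
    S.Realizes (adGroup (LieAlgebra.Orthogonal.so ι ℂ) A) := by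
  obtain ⟨m, hm0, hmanti, hm⟩ := exists_clifford_coefficients (S := S) h2 h0 hβ
  let ψ : Matrix ι ι ℂ →ₗ[ℂ] TwistedLie S.ξ :=
    { toFun := fun x => ∑ p : ι × ι, (x p.1 p.2 * m p.1 p.2) • TwistedLie.u S.ξ (h p.1 + h p.2)
      map_add' := fun x y => by
        rw [← Finset.sum_add_distrib]
        exact Finset.sum_congr rfl fun p _ => by rw [Matrix.add_apply, add_mul, add_smul]
      map_smul' := fun r x => by
        rw [RingHom.id_apply, Finset.smul_sum]
        exact Finset.sum_congr rfl fun p _ => by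
          rw [Matrix.smul_apply, smul_eq_mul, mul_assoc, mul_smul] }
  have hψ : ∀ x, ψ x =
    ∑ p : ι × ι, (x p.1 p.2 * m p.1 p.2) • TwistedLie.u S.ξ (h p.1 + h p.2) := fun _ => rfl
  have hskew : ∀ x : LieAlgebra.Orthogonal.so ι ℂ, (x : Matrix ι ι ℂ)ᵀ = -(x : Matrix ι ι ℂ) :=
    fun x => (LieAlgebra.Orthogonal.mem_so ι ℂ _).mp x.2
  let Φ : LieAlgebra.Orthogonal.so ι ℂ →ₗ⁅ℂ⁆ TwistedLie S.ξ :=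
    { (4 : ℂ)⁻¹ • ψ ∘ₗ (LieAlgebra.Orthogonal.so ι ℂ).toSubmodule.subtype with
      map_lie' := by
        intro x y
        change (4 : ℂ)⁻¹ • ψ ((x : Matrix ι ι ℂ) * y - (y : Matrix ι ι ℂ) * x) =
          ⁅(4 : ℂ)⁻¹ • ψ x, (4 : ℂ)⁻¹ • ψ y⁆
        rw [smul_lie, lie_smul]
        have := hm x y (hskew x)
        rw [← hψ, ← hψ, ← hψ] at this
        rw [this, smul_smul (4 : ℂ)⁻¹ (4 : ℂ), inv_mul_cancel₀ (by norm_num : (4 : ℂ) ≠ 0),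
          one_smul] }
  have hΦ : ∀ x : LieAlgebra.Orthogonal.so ι ℂ, Φ x = (4 : ℂ)⁻¹ • ψ x := fun _ => rfl
  have hψdiag : ∀ (χ : Multiplicative S.G →* ℂˣ) (d : ι → ℂ),
      (∀ i j, (χ (.ofAdd (h i + h j)) : ℂ) = d i * d j) → ∀ x y : Matrix ι ι ℂ,
      (∀ i j, y i j = d i * d j * x i j) →
      ψ y = TwistedLie.diag S.ξ (fun a => χ (.ofAdd a)) (ψ x) := by
    intro χ d hχ x y hxy
    rw [hψ, hψ, map_sum]
    refine Finset.sum_congr rfl fun p _ => ?_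
    rw [map_smul, TwistedLie.diag_u, hχ, hxy, smul_smul]
    congr 1
    ring
  have hrepr : ∀ x : Matrix ι ι ℂ, xᵀ = -x → ∀ i j, i ≠ j →
      (TwistedLie.basis S.ξ).repr (ψ x) (h i + h j) = 2 * (x i j * m i j) := by
    intro x hx i j hij
    have hx' : ∀ i j, x i j = -x j i := fun i j => congrFun (congrFun hx j) i
    have hu : ∀ a, (TwistedLie.basis S.ξ).repr (TwistedLie.u S.ξ a) = Finsupp.single a 1 :=
      fun a => by rw [← TwistedLie.basis_apply, Module.Basis.repr_self]
    rw [hψ, map_sum, Finsupp.finsetSum_apply]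
    simp only [map_smul, hu, Finsupp.smul_apply]
    rw [Fintype.sum_eq_add (i, j) (j, i)]
    · simp only
      rw [add_comm (h j), Finsupp.single_eq_same, hmanti i j hij, hx' j i]
      simp only [smul_eq_mul]
      ring
    · intro heq
      exact hij (Prod.mk.inj heq).1
    · rintro ⟨k, l⟩ ⟨h1, h1'⟩
      by_cases hkl : k = l
      · subst hkl
        have : x k k = 0 := by
          have := hx' k k
          linear_combination this / 2
        rw [this, zero_mul, zero_smul]
      · rw [Finsupp.single_eq_of_ne, smul_zero]
        intro heq
        rcases hdist i j k l hij hkl heq.symm with h3 | h3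
        · exact h1 h3
        · exact h1' h3
  have hinj : Function.Injective Φ := by
    rw [← LieHom.coe_toLinearMap, ← LinearMap.ker_eq_bot, LinearMap.ker_eq_bot']
    intro x hx
    have hx0 : ψ x = 0 := by
      have : (4 : ℂ)⁻¹ • ψ x = 0 := hx
      exact (smul_eq_zero.mp this).resolve_left (inv_ne_zero (by norm_num))
    ext i j
    by_cases hij : i = j
    · subst hij
      have h1 : (x : Matrix ι ι ℂ) i i = -(x : Matrix ι ι ℂ) i i :=
        congrFun (congrFun (hskew x) i) i
      change (x : Matrix ι ι ℂ) i i = 0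
      linear_combination h1 / 2
    · have h1 := hrepr x (hskew x) i j hij
      rw [hx0, map_zero, Finsupp.zero_apply, eq_comm] at h1
      have h3 := (mul_eq_zero.mp h1).resolve_left two_ne_zero
      exact (mul_eq_zero.mp h3).resolve_right (hm0 i j)
  refine ⟨Φ, hinj, ?_, ?_⟩
  · refine le_antisymm ?_ ?_
    · rintro _ ⟨x, rfl⟩
      change (4 : ℂ)⁻¹ • ψ x ∈ S.rootSpan
      refine Submodule.smul_mem _ _ ?_
      rw [hψ]
      refine Submodule.sum_mem _ fun p _ => ?_
      by_cases hp : p.1 = p.2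
      · have h1 : (x : Matrix ι ι ℂ) p.2 p.2 = -(x : Matrix ι ι ℂ) p.2 p.2 :=
          congrFun (congrFun (hskew x) p.2) p.2
        have h3 : (x : Matrix ι ι ℂ) p.2 p.2 = 0 := by linear_combination h1 / 2
        rw [hp, h3, zero_mul, zero_smul]
        exact zero_mem _
      · exact Submodule.smul_mem _ _
          (Submodule.subset_span ⟨_, (hR _).mpr ⟨p.1, p.2, hp, rfl⟩, rfl⟩)
    · refine Submodule.span_le.mpr ?_
      rintro _ ⟨a, ha, rfl⟩
      obtain ⟨i, j, hij, rfl⟩ := (hR a).mp ha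
      let x : Matrix ι ι ℂ := Matrix.single i j 1 - Matrix.single j i 1
      have hx : x ∈ LieAlgebra.Orthogonal.so ι ℂ := by
        rw [LieAlgebra.Orthogonal.mem_so]
        simp [x]
      have hs : ∀ k l, ψ (Matrix.single k l 1) = m k l • TwistedLie.u S.ξ (h k + h l) := by
        intro k l
        rw [hψ, Finset.sum_eq_single (k, l)]
        · simp
        · rintro ⟨k', l'⟩ _ hne
          rw [Matrix.single_apply_of_ne, zero_mul, zero_smul]
          rintro ⟨rfl, rfl⟩
          exact hne rfl
        · exact fun h => absurd (Finset.mem_univ _) h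
      have hψx : ψ x = (2 * m i j) • TwistedLie.u S.ξ (h i + h j) := by
        rw [map_sub, hs, hs, hmanti i j hij, add_comm (h j), ← sub_smul]
        congr 1
        ring
      -- The entries (i,j) and (j,i) contribute equally, so the image of x is (1/4)(2 m_ij) u_{h i +
      -- h j}; the scalar undoes this.
      refine ⟨(2 * (m i j)⁻¹) • ⟨x, hx⟩, ?_⟩
      rw [map_smul]
      change (2 * (m i j)⁻¹) • (4 : ℂ)⁻¹ • ψ x = _
      rw [hψx, smul_smul, smul_smul]
      have : 2 * (m i j)⁻¹ * ((4 : ℂ)⁻¹ * (2 * m i j)) = 1 := by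
        field_simp [hm0 i j]
        norm_num
      rw [mul_assoc, this, one_smul]
  · refine le_antisymm ((Subgroup.closure_le _).mpr ?_) ?_
    · rintro σ ⟨g, hg, -, hσ⟩
      obtain ⟨d, hd, rfl, χ, hχ⟩ := hA g hg
      refine ⟨χ, fun x => ?_⟩
      rw [hΦ, hΦ, map_smul]
      congr 1
      refine hψdiag χ d hχ _ _ fun i j => ?_
      rw [hσ, diagonal_conj_of_signs hd]
    · rintro σ ⟨χ, hχ⟩
      obtain ⟨d, hd, hdA, hχd⟩ := hA' χ
      refine Subgroup.subset_closure ⟨_, hdA, isUnit_diagonal_of_signs hd, fun x => ?_⟩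
      have hmem : Matrix.diagonal d * (x : Matrix ι ι ℂ) * (Matrix.diagonal d)⁻¹ ∈
          LieAlgebra.Orthogonal.so ι ℂ := by
        rw [LieAlgebra.Orthogonal.mem_so]
        ext i j
        rw [Matrix.transpose_apply, Matrix.neg_apply, diagonal_conj_of_signs hd,
          diagonal_conj_of_signs hd]
        have h1 : (x : Matrix ι ι ℂ) j i = -(x : Matrix ι ι ℂ) i j :=
          congrFun (congrFun (hskew x) i) j
        rw [h1]
        ring
      have : σ x = ⟨_, hmem⟩ := by
        apply hinj
        rw [hχ, hΦ, hΦ, map_smul]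
        congr 1
        exact (hψdiag χ d hχd _ _ fun i j => diagonal_conj_of_signs hd _ i j).symm
      rw [this]

end Orthogonal

end FiniteRootSystem

/-! ### The root systems of the orthogonal Lie algebras -/

theorem nsmul_eq_of_two_torsion {G : Type*} [AddCommGroup G] (h2 : ∀ a : G, a + a = 0) (n : ℕ)
    (a : G) (h : n • a ≠ 0) : n • a = a := by
  have key : n • a = 0 ∨ n • a = a := by
    induction n with
    | zero => exact Or.inl (zero_nsmul a)
    | succ n ih =>
      by_cases h0 : n • a = 0
      · exact Or.inr (by rw [succ_nsmul, h0, zero_add])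
      · exact Or.inl (by rw [succ_nsmul, (ih h0).resolve_left h0, h2])
  exact key.resolve_left h

/-- Elements of a symplectic group that pairwise do not commute, together with `0`. -/
structure CliffordFamily {G : Type u} [AddCommGroup G] {ι : Type w} (β : Bicharacter G) (i₀ : ι)
    (h : ι → G) : Prop where
  two_torsion : ∀ a : G, a + a = 0
  alternating : β.IsAlternating
  zero : h i₀ = 0
  anticommute : ∀ i j, i ≠ j → i ≠ i₀ → j ≠ i₀ → β (h i) (h j) = -1
  closure : AddSubgroup.closure (Set.range h) = ⊤
  third : ∀ i j : ι, ∃ k, k ≠ i ∧ k ≠ j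
  fifth : ∀ i j k l : ι, i ≠ j → i ≠ k → i ≠ l → j ≠ k → j ≠ l → k ≠ l →
    ∃ p, p ≠ i ∧ p ≠ j ∧ p ≠ k ∧ p ≠ l

namespace CliffordFamily

variable {G : Type u} [AddCommGroup G] {ι : Type w} {β : Bicharacter G} {i₀ : ι} {h : ι → G}
  (H : CliffordFamily β i₀ h)

include H

theorem add_add_cancel (a b : G) : a + (a + b) = b := by
  rw [← add_assoc, H.two_torsion, zero_add]

theorem bichar_zero_left (a : G) : β (h i₀) a = 1 := by
  rw [H.zero, β.map_zero_left]

theorem bichar_zero_right (a : G) : β a (h i₀) = 1 := by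
  rw [H.zero, β.map_zero_right]

theorem ne_zero {i : ι} (hi : i ≠ i₀) : h i ≠ 0 := by
  intro h0
  obtain ⟨k, hki, hk⟩ := H.third i i₀
  have := H.anticommute i k hki.symm hi hk
  rw [h0, β.map_zero_left] at this
  exact absurd (congrArg Units.val this) (by norm_num)

theorem injective : Function.Injective h := by
  intro i j hij
  by_contra hne
  by_cases hi : i = i₀
  · rw [hi, H.zero] at hij
    exact H.ne_zero (fun h => hne (hi.trans h.symm)) hij.symm
  · by_cases hj : j = i₀
    · rw [hj, H.zero] at hij
      exact H.ne_zero hi hij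
    · have := H.anticommute i j hne hi hj
      rw [hij, H.alternating] at this
      exact absurd (congrArg Units.val this) (by norm_num)

/-- Pairing the two sides with a suitable h p gives opposite signs: p = i works if i₀ is not among
the four indices, and otherwise a fifth index serves. With four indices only, the claim can fail, as
for 0, e_1, e_2, e_1 + e_2. -/
theorem ne_of_four {i j k l : ι} (hij : i ≠ j) (hik : i ≠ k) (hil : i ≠ l) (hjk : j ≠ k)
    (hjl : j ≠ l) (hkl : k ≠ l) : h k + h l ≠ h i + h j := by
  -- it suffices to treat the case `i ≠ i₀`, exchanging `i` and `j` if necessary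
  have key : ∀ i j k l : ι, i ≠ j → i ≠ k → i ≠ l → j ≠ k → j ≠ l → k ≠ l → i ≠ i₀ →
      h k + h l ≠ h i + h j := by
    intro i j k l hij hik hil hjk hjl hkl hi heq
    by_cases hz : j = i₀ ∨ k = i₀ ∨ l = i₀
    · obtain ⟨p, hpi, hpj, hpk, hpl⟩ := H.fifth i j k l hij hik hil hjk hjl hkl
      have hp : p ≠ i₀ := by rcases hz with h | h | h <;> rw [← h] <;> assumption
      have e := congrArg (fun a => β a (h p)) heq
      simp only [β.add_left] at e
      rw [H.anticommute i p hpi.symm hi hp] at e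
      rcases hz with rfl | rfl | rfl
      · rw [H.anticommute k p hpk.symm hjk.symm hp, H.anticommute l p hpl.symm hjl.symm hp,
          H.bichar_zero_left] at e
        exact absurd (congrArg Units.val e) (by norm_num)
      · rw [H.anticommute j p hpj.symm hjk hp, H.anticommute l p hpl.symm hkl.symm hp,
          H.bichar_zero_left] at e
        exact absurd (congrArg Units.val e) (by norm_num)
      · rw [H.anticommute j p hpj.symm hjl hp, H.anticommute k p hpk.symm hkl hp,
          H.bichar_zero_left] at e
        exact absurd (congrArg Units.val e) (by norm_num)
    · push Not at hz
      obtain ⟨hj, hk, hl⟩ := hz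
      have e := congrArg (fun a => β a (h i)) heq
      simp only [β.add_left] at e
      rw [H.anticommute k i hik.symm hk hi, H.anticommute l i hil.symm hl hi, H.alternating,
        H.anticommute j i hij.symm hj hi] at e
      exact absurd (congrArg Units.val e) (by norm_num)
  by_cases hi : i = i₀
  · rw [add_comm (h i)]
    exact key j i k l hij.symm hjk hjl hik hil hkl (fun hj => hij (hi.trans hj.symm))
  · exact key i j k l hij hik hil hjk hjl hkl hi

theorem pair_eq {i j k l : ι} (hij : i ≠ j) (hkl : k ≠ l) (heq : h k + h l = h i + h j) :
    (k, l) = (i, j) ∨ (k, l) = (j, i) := by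
  have hinj := H.injective
  by_cases hki : k = i
  · subst hki
    exact Or.inl (by rw [hinj (add_left_cancel heq)])
  · by_cases hkj : k = j
    · subst hkj
      rw [add_comm (h i)] at heq
      exact Or.inr (by rw [hinj (add_left_cancel heq)])
    · by_cases hli : l = i
      · subst hli
        rw [add_comm (h l)] at heq
        exact absurd (hinj (add_right_cancel heq)) hkj
      · by_cases hlj : l = j
        · subst hlj
          exact absurd (hinj (add_right_cancel heq)) hki
        · exact absurd heq (H.ne_of_four hij (Ne.symm hki) (Ne.symm hli) (Ne.symm hkj)
            (Ne.symm hlj) hkl)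

open Classical in
theorem bichar_pair_left {i j k : ι} (hij : i ≠ j) (hi : i ≠ k) (hj : j ≠ k) (hk : k ≠ i₀) :
    β (h i + h j) (h k) = if i = i₀ ∨ j = i₀ then -1 else 1 := by
  rw [β.add_left]
  by_cases hi0 : i = i₀
  · rw [if_pos (Or.inl hi0), hi0, H.bichar_zero_left, one_mul]
    exact H.anticommute j k hj (fun h => hij (hi0.trans h.symm)) hk
  · by_cases hj0 : j = i₀
    · rw [if_pos (Or.inr hj0), hj0, H.bichar_zero_left, mul_one]
      exact H.anticommute i k hi hi0 hk
    · rw [if_neg (by tauto), H.anticommute i k hi hi0 hk, H.anticommute j k hj hj0 hk]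
      simp

/-- Together with `bichar_shared`, this says that two different roots fail to commute exactly if
their index pairs overlap, as for the elementary skew-symmetric matrices. -/
theorem bichar_disjoint {i j k l : ι} (hij : i ≠ j) (hik : i ≠ k) (hil : i ≠ l) (hjk : j ≠ k)
    (hjl : j ≠ l) (hkl : k ≠ l) : β (h i + h j) (h k + h l) = 1 := by
  rw [β.add_right]
  by_cases hk : k = i₀
  · rw [hk, H.bichar_zero_right, one_mul, H.bichar_pair_left hij hil hjl
      (fun h => hkl (hk.trans h.symm)),
      if_neg]
    rintro (h | h)
    · exact hik (h.trans hk.symm)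
    · exact hjk (h.trans hk.symm)
  · by_cases hl : l = i₀
    · rw [hl, H.bichar_zero_right, mul_one, H.bichar_pair_left hij hik hjk hk, if_neg]
      rintro (h | h)
      · exact hil (h.trans hl.symm)
      · exact hjl (h.trans hl.symm)
    · rw [H.bichar_pair_left hij hik hjk hk, H.bichar_pair_left hij hil hjl hl]
      split_ifs <;> simp

theorem bichar_shared {i j k : ι} (hij : i ≠ j) (hik : i ≠ k) (hjk : j ≠ k) :
    β (h i + h j) (h i + h k) = -1 := by
  have hmm : (-1 : ℂˣ) * -1 = 1 := by simp
  rw [β.add_left, β.add_right, β.add_right, H.alternating]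
  by_cases hi : i = i₀
  · rw [hi, H.bichar_zero_left, H.bichar_zero_right, one_mul, one_mul, one_mul]
    exact H.anticommute j k hjk (fun h => hij (hi.trans h.symm)) fun h => hik (hi.trans h.symm)
  · by_cases hj : j = i₀
    · have hk : k ≠ i₀ := fun h => hjk (hj.trans h.symm)
      rw [hj, H.bichar_zero_left, H.bichar_zero_left, one_mul, mul_one, mul_one,
        H.anticommute i k hik hi hk]
    · by_cases hk : k = i₀
      · rw [hk, H.bichar_zero_right, H.bichar_zero_right, one_mul, mul_one, one_mul,
          H.anticommute j i hij.symm hj hi]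
      · rw [H.anticommute i k hik hi hk, H.anticommute j i hij.symm hj hi,
          H.anticommute j k hjk hj hk, hmm, one_mul, mul_one]

theorem add_mem {i j k l : ι} (hij : i ≠ j) (hkl : k ≠ l)
    (hβ : β (h i + h j) (h k + h l) ≠ 1) :
    ∃ p q, p ≠ q ∧ (h i + h j) + (h k + h l) = h p + h q := by
  have key : ∀ i j l : ι, β (h i + h j) (h i + h l) ≠ 1 →
      ∃ p q, p ≠ q ∧ (h i + h j) + (h i + h l) = h p + h q := by
    intro i j l hne
    refine ⟨j, l, ?_, ?_⟩
    · rintro rfl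
      exact hne (H.alternating _)
    · rw [add_add_add_comm, H.two_torsion, zero_add]
  by_cases hik : i = k
  · subst hik
    exact key i j l hβ
  by_cases hil : i = l
  · subst hil
    rw [add_comm (h k)] at hβ ⊢
    exact key i j k hβ
  by_cases hjk : j = k
  · subst hjk
    rw [add_comm (h i)] at hβ ⊢
    exact key j i l hβ
  by_cases hjl : j = l
  · subst hjl
    rw [add_comm (h i), add_comm (h k)] at hβ ⊢
    exact key j i k hβ
  exact absurd (H.bichar_disjoint hij hik hil hjk hjl hkl) hβ

theorem neg_eq (a : G) : -a = a := neg_eq_of_add_eq_zero_left (H.two_torsion a)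

theorem not_mem_radical {i j : ι} (hij : i ≠ j) : h i + h j ∉ β.radical := by
  intro hrad
  obtain ⟨k, hki, hkj⟩ := H.third i j
  have := H.bichar_shared hij hki.symm hkj.symm
  rw [hrad] at this
  exact absurd (congrArg Units.val this) (by norm_num)

/-- The root system consisting of the sums of two different elements of the family. -/
def rootSystem [Finite G] : FiniteRootSystem.{u} where
  G := G
  β := β
  alternating := H.alternating
  nontrivial := fun htop => by
    obtain ⟨k, hk, -⟩ := H.third i₀ i₀
    refine H.not_mem_radical hk ?_
    rw [htop]
    trivial
  R := {a | ∃ i j, i ≠ j ∧ a = h i + h j}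
  disjoint_radical := by
    rintro _ ⟨i, j, hij, rfl⟩
    exact H.not_mem_radical hij
  generates := by
    rw [← top_le_iff, ← H.closure, AddSubgroup.closure_le]
    rintro _ ⟨i, rfl⟩
    by_cases hi : i = i₀
    · rw [hi, H.zero]
      exact zero_mem _
    · exact AddSubgroup.subset_closure ⟨i, i₀, hi, by rw [H.zero, add_zero]⟩
  neg_closed := by
    rintro a ha
    rwa [H.neg_eq]
  add_closed := by
    rintro _ ⟨i, j, hij, rfl⟩ _ ⟨k, l, hkl, rfl⟩ hβ
    exact H.add_mem hij hkl hβ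

end CliffordFamily

/-- Only the products d_i d_j matter, so a diagonal matrix may be changed by a global sign r. As h
i₀ = 0, a character has to take the value d_{i₀} d_i at h i. -/
theorem CliffordFamily.realizes {G : Type u} [AddCommGroup G] {β : Bicharacter G}
    [Finite G] {ι : Type}
    [Fintype ι] [DecidableEq ι] {i₀ : ι} {h : ι → G}
    (H : CliffordFamily β i₀ h) {A : Set (Matrix ι ι ℂ)}
    (hA : ∀ g ∈ A, ∃ d : ι → ℂ, (∀ i, d i = 1 ∨ d i = -1) ∧ g = Matrix.diagonal d ∧
      ∃ χ : Multiplicative G →* ℂˣ, ∀ i, (χ (.ofAdd (h i)) : ℂ) = d i₀ * d i)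
    (hA' : ∀ χ : Multiplicative G →* ℂˣ, ∃ r : ℂ, r * r = 1 ∧
      Matrix.diagonal (fun i => r * χ (.ofAdd (h i))) ∈ A) :
    H.rootSystem.Realizes (adGroup (LieAlgebra.Orthogonal.so ι ℂ) A) := by
  refine FiniteRootSystem.realizes_adGroup_so (S := H.rootSystem) (h := h) (i₀ := i₀) H.two_torsion
    H.zero H.anticommute (fun a => Iff.rfl) (fun i j k l hij hkl => H.pair_eq hij hkl) ?_ ?_
  · intro g hg
    obtain ⟨d, hd, hgd, χ, hχ⟩ := hA g hg
    refine ⟨d, hd, hgd, χ, fun i j => ?_⟩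
    have h1 : d i₀ * d i₀ = 1 := by rcases hd i₀ with h | h <;> rw [h] <;> norm_num
    have h3 : χ (.ofAdd (h i + h j)) = χ (.ofAdd (h i)) * χ (.ofAdd (h j)) :=
      map_mul χ (.ofAdd (h i)) (.ofAdd (h j))
    have h4 : ((χ (.ofAdd (h i)) * χ (.ofAdd (h j)) : ℂˣ) : ℂ) = d i * d j := by
      rw [Units.val_mul, hχ, hχ]
      linear_combination d i * d j * h1
    exact (congrArg Units.val h3).trans h4
  · intro χ
    obtain ⟨r, hr, hrA⟩ := hA' χ
    refine ⟨fun i => r * χ (.ofAdd (h i)), fun i => ?_, hrA, fun i j => ?_⟩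
    · have h1 : χ (.ofAdd (h i)) * χ (.ofAdd (h i)) = 1 := by
        have h3 : χ (.ofAdd (h i + h i)) = χ (.ofAdd (h i)) * χ (.ofAdd (h i)) :=
          map_mul χ (.ofAdd (h i)) (.ofAdd (h i))
        rw [← h3, H.two_torsion]
        exact map_one χ
      have h3 : ((χ (.ofAdd (h i)) : ℂˣ) : ℂ) * χ (.ofAdd (h i)) = 1 := by
        rw [← Units.val_mul, h1, Units.val_one]
      rw [← mul_self_eq_one_iff]
      linear_combination r * r * h3 + hr
    · have h3 : χ (.ofAdd (h i + h j)) = χ (.ofAdd (h i)) * χ (.ofAdd (h j)) :=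
        map_mul χ (.ofAdd (h i)) (.ofAdd (h j))
      have h4 : ((χ (.ofAdd (h i)) * χ (.ofAdd (h j)) : ℂˣ) : ℂ) =
          r * χ (.ofAdd (h i)) * (r * χ (.ofAdd (h j))) := by
        rw [Units.val_mul]
        linear_combination -(χ (.ofAdd (h i)) : ℂ) * χ (.ofAdd (h j)) * hr
      exact (congrArg Units.val h3).trans h4

/-! ### Elementary abelian `2`-groups -/

/-- The nontrivial character of `ℤ/2`. -/
def signChar (x : ZMod 2) : ℂˣ := if x = 0 then 1 else -1

theorem zmod_two_cases (x : ZMod 2) : x = 0 ∨ x = 1 := by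
  fin_cases x
  · exact Or.inl rfl
  · exact Or.inr rfl

theorem signChar_zero : signChar 0 = 1 := if_pos rfl

theorem signChar_one : signChar 1 = -1 := if_neg (by decide)

theorem signChar_add (x y : ZMod 2) : signChar (x + y) = signChar x * signChar y := by
  have h11 : (1 : ZMod 2) + 1 = 0 := by decide
  rcases zmod_two_cases x with rfl | rfl <;> rcases zmod_two_cases y with rfl | rfl <;>
    simp [signChar_zero, signChar_one, h11]

theorem signChar_eq_one_iff {x : ZMod 2} : signChar x = 1 ↔ x = 0 := by
  rcases zmod_two_cases x with rfl | rfl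
  · simp [signChar_zero]
  · rw [signChar_one]
    refine ⟨fun h => absurd (congrArg Units.val h) (by norm_num), fun h => absurd h (by decide)⟩

theorem zmod_two_add_self (x : ZMod 2) : x + x = 0 := CharTwo.add_self_eq_zero x

theorem zmod_two_mul_self (x : ZMod 2) : x * x = x := by
  rcases zmod_two_cases x with rfl | rfl <;> decide

/-- The bicharacter on `(ℤ/2)^m` for which the standard basis vectors do not commute. -/
def cliffordBicharacter (m : ℕ) : Bicharacter (Fin m → ZMod 2) where
  toFun a b := signChar ((∑ i, a i) * (∑ i, b i) + a ⬝ᵥ b)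
  add_left a b c := by
    rw [← signChar_add]
    simp only [Pi.add_apply, Finset.sum_add_distrib, add_dotProduct]
    congr 1
    ring
  add_right a b c := by
    rw [← signChar_add]
    simp only [Pi.add_apply, Finset.sum_add_distrib, dotProduct_add]
    congr 1
    ring

theorem cliffordBicharacter_apply (m : ℕ) (a b : Fin m → ZMod 2) :
    cliffordBicharacter m a b = signChar ((∑ i, a i) * (∑ i, b i) + a ⬝ᵥ b) := rfl

theorem cliffordBicharacter_isAlternating (m : ℕ) : (cliffordBicharacter m).IsAlternating := by
  intro a
  rw [cliffordBicharacter_apply, signChar_eq_one_iff, zmod_two_mul_self, dotProduct]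
  simp only [zmod_two_mul_self]
  exact zmod_two_add_self _

theorem cliffordBicharacter_single_right (m : ℕ) (a : Fin m → ZMod 2) (j : Fin m) :
    cliffordBicharacter m a (Pi.single j 1) = signChar ((∑ i, a i) + a j) := by
  rw [cliffordBicharacter_apply, dotProduct_single, Finset.sum_pi_single']
  simp

/-- In a vector of the radical every coordinate equals the sum of all coordinates, and the sum of an
even number of equal elements of ℤ/2 is zero. -/
theorem cliffordBicharacter_nondegenerate {m : ℕ} (hm : Even m) {a : Fin m → ZMod 2}
    (h : ∀ b, cliffordBicharacter m a b = 1) : a = 0 := by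
  have h1 : ∀ j, a j = ∑ i, a i := by
    intro j
    have := h (Pi.single j 1)
    rw [cliffordBicharacter_single_right, signChar_eq_one_iff] at this
    exact (CharTwo.add_eq_zero.mp this).symm
  have h2 : ∑ i, a i = 0 := by
    have h3 : ∑ i, a i = ∑ _i : Fin m, ∑ i, a i := Finset.sum_congr rfl fun j _ => h1 j
    rw [Finset.sum_const, Finset.card_univ, Fintype.card_fin] at h3
    obtain ⟨k, rfl⟩ := hm
    rw [h3, add_nsmul]
    exact zmod_two_add_self _
  funext j
  rw [h1 j, h2, Pi.zero_apply]

theorem pi_zmod_two_add_self {ι : Type*} (a : ι → ZMod 2) : a + a = 0 :=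
  funext fun i => zmod_two_add_self (a i)

/-- Characters of `(ℤ/2)^m` with prescribed signs. -/
theorem exists_char_of_signs {m : ℕ} (s : Fin m → ℂˣ) (hs : ∀ i, s i * s i = 1) :
    ∃ χ : Multiplicative (Fin m → ZMod 2) →* ℂˣ, ∀ i, χ (.ofAdd (Pi.single i 1)) = s i := by
  refine ⟨MonoidHom.mk' (fun a => ∏ i, if a.toAdd i = 0 then 1 else s i) fun a b => ?_, fun i => ?_⟩
  · rw [← Finset.prod_mul_distrib]
    refine Finset.prod_congr rfl fun i _ => ?_
    have h11 : (1 : ZMod 2) + 1 = 0 := by decide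
    rw [toAdd_mul, Pi.add_apply]
    rcases zmod_two_cases (a.toAdd i) with ha | ha <;>
      rcases zmod_two_cases (b.toAdd i) with hb | hb <;> rw [ha, hb] <;> simp [h11, hs]
  · change ∏ j, (if (Pi.single i 1 : Fin m → ZMod 2) j = 0 then 1 else s j) = s i
    rw [Finset.prod_eq_single i]
    · rw [Pi.single_eq_same, if_neg (by decide)]
    · intro j _ hj
      rw [Pi.single_eq_of_ne hj, if_pos rfl]
    · simp

theorem closure_single_eq_top {m : ℕ} {s : Set (Fin m → ZMod 2)}
    (hs : ∀ i, Pi.single i 1 ∈ s) : AddSubgroup.closure s = ⊤ := by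
  rw [eq_top_iff]
  rintro a -
  have : a = ∑ i, Pi.single i (a i) := (Finset.univ_sum_single a).symm
  rw [this]
  refine sum_mem fun i _ => ?_
  rcases zmod_two_cases (a i) with h | h
  · rw [h, Pi.single_zero]
    exact zero_mem _
  · rw [h]
    exact AddSubgroup.subset_closure (hs i)

theorem sum_single_one (m : ℕ) (i : Fin m) : ∑ j, (Pi.single i 1 : Fin m → ZMod 2) j = 1 := by
  rw [Finset.sum_pi_single']
  simp

theorem fin_exists_ne_two {n : ℕ} (hn : 3 ≤ n) (i j : Fin n) : ∃ k, k ≠ i ∧ k ≠ j := by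
  have : ∃ k, k ∉ ({i, j} : Finset (Fin n)) := by
    by_contra! hall
    have h1 := Finset.card_le_card (fun x _ => hall x : (Finset.univ : Finset (Fin n)) ⊆ {i, j})
    have h2 := Finset.card_le_two (a := i) (b := j)
    rw [Finset.card_univ, Fintype.card_fin] at h1
    omega
  obtain ⟨k, hk⟩ := this
  exact ⟨k, by simpa using hk⟩

theorem fin_exists_ne_four {n : ℕ} (hn : n ≠ 4) {i j k l : Fin n} (hij : i ≠ j) (hik : i ≠ k)
    (hil : i ≠ l) (hjk : j ≠ k) (hjl : j ≠ l) (hkl : k ≠ l) :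
    ∃ p, p ≠ i ∧ p ≠ j ∧ p ≠ k ∧ p ≠ l := by
  have hcard : ({i, j, k, l} : Finset (Fin n)).card = 4 := by
    rw [Finset.card_insert_of_notMem (by simp [hij, hik, hil]),
      Finset.card_insert_of_notMem (by simp [hjk, hjl]),
      Finset.card_insert_of_notMem (by simp [hkl]), Finset.card_singleton]
  have : ∃ p, p ∉ ({i, j, k, l} : Finset (Fin n)) := by
    by_contra! hall
    have h1 := Finset.eq_univ_iff_forall.mpr hall
    rw [h1, Finset.card_univ, Fintype.card_fin] at hcard
    exact hn hcard
  obtain ⟨p, hp⟩ := this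
  exact ⟨p, by simpa using hp⟩

theorem cliffordBicharacter_single_single {m : ℕ} {i j : Fin m} (hij : i ≠ j) :
    cliffordBicharacter m (Pi.single i 1) (Pi.single j 1) = -1 := by
  rw [cliffordBicharacter_single_right, sum_single_one, Pi.single_eq_of_ne hij.symm, add_zero,
    signChar_one]

/-- The family `0, e_1, …, e_m`. -/
def basisFamily (m : ℕ) : Fin (m + 1) → Fin m → ZMod 2 := Fin.cons 0 fun i => Pi.single i 1

theorem basisFamily_zero (m : ℕ) : basisFamily m 0 = 0 := rfl

theorem basisFamily_succ (m : ℕ) (i : Fin m) : basisFamily m i.succ = Pi.single i 1 := rfl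

/-- The excluded m = 3 would give an index set of exactly four elements, for which `fifth` fails. -/
theorem cliffordFamily_basisFamily {m : ℕ} (hm : 2 ≤ m) (hm3 : m ≠ 3) :
    CliffordFamily (cliffordBicharacter m) 0 (basisFamily m) where
  two_torsion := pi_zmod_two_add_self
  alternating := cliffordBicharacter_isAlternating m
  zero := rfl
  anticommute i j hij hi hj := by
    obtain ⟨i, rfl⟩ := Fin.exists_succ_eq.mpr hi
    obtain ⟨j, rfl⟩ := Fin.exists_succ_eq.mpr hj
    exact cliffordBicharacter_single_single fun h => hij (congrArg Fin.succ h)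
  closure := closure_single_eq_top fun i => ⟨i.succ, rfl⟩
  third := fin_exists_ne_two (by omega)
  fifth _ _ _ _ := fin_exists_ne_four (by omega)

/-- The family `0, e_1, …, e_m, e_1 + ⋯ + e_m`. -/
def extendedFamily (m : ℕ) : Fin (m + 2) → Fin m → ZMod 2 := Fin.snoc (basisFamily m) 1

theorem extendedFamily_castSucc (m : ℕ) (i : Fin (m + 1)) :
    extendedFamily m i.castSucc = basisFamily m i := Fin.snoc_castSucc _ _ _

theorem extendedFamily_last (m : ℕ) : extendedFamily m (Fin.last (m + 1)) = 1 := Fin.snoc_last _ _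

/-- For even m the coordinates of the all-ones vector sum to zero, so it anticommutes with every e_i
and can join the family. -/
theorem cliffordBicharacter_single_one {m : ℕ} (hm : Even m) (i : Fin m) :
    cliffordBicharacter m 1 (Pi.single i 1) = -1 := by
  rw [cliffordBicharacter_single_right]
  have : ∑ i : Fin m, (1 : Fin m → ZMod 2) i = 0 := by
    simp only [Pi.one_apply, Finset.sum_const, Finset.card_univ, Fintype.card_fin]
    obtain ⟨k, rfl⟩ := hm
    rw [add_nsmul]
    exact zmod_two_add_self _
  rw [this, zero_add, Pi.one_apply, signChar_one]

theorem cliffordFamily_extendedFamily {m : ℕ} (hm : 4 ≤ m) (hm2 : Even m) :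
    CliffordFamily (cliffordBicharacter m) 0 (extendedFamily m) where
  two_torsion := pi_zmod_two_add_self
  alternating := cliffordBicharacter_isAlternating m
  zero := extendedFamily_castSucc m 0
  anticommute i j hij hi hj := by
    have hswap := (cliffordBicharacter_isAlternating m).swap
    induction i using Fin.lastCases with
    | last =>
      induction j using Fin.lastCases with
      | last => exact absurd rfl hij
      | cast j =>
        have hj' : j ≠ 0 := fun h => hj (by rw [h]; rfl)
        obtain ⟨j, rfl⟩ := Fin.exists_succ_eq.mpr hj'
        rw [extendedFamily_last, extendedFamily_castSucc, basisFamily_succ,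
          cliffordBicharacter_single_one hm2]
    | cast i =>
      have hi' : i ≠ 0 := fun h => hi (by rw [h]; rfl)
      obtain ⟨i, rfl⟩ := Fin.exists_succ_eq.mpr hi'
      induction j using Fin.lastCases with
      | last =>
        rw [extendedFamily_last, extendedFamily_castSucc, basisFamily_succ, hswap,
          cliffordBicharacter_single_one hm2]
        simp
      | cast j =>
        have hj' : j ≠ 0 := fun h => hj (by rw [h]; rfl)
        obtain ⟨j, rfl⟩ := Fin.exists_succ_eq.mpr hj'
        rw [extendedFamily_castSucc, extendedFamily_castSucc, basisFamily_succ, basisFamily_succ]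
        exact cliffordBicharacter_single_single fun h =>
          hij (congrArg (fun i : Fin m => i.succ.castSucc) h)
  closure := closure_single_eq_top fun i =>
    ⟨i.succ.castSucc, by rw [extendedFamily_castSucc, basisFamily_succ]⟩
  third := fin_exists_ne_two (by omega)
  fifth _ _ _ _ := fin_exists_ne_four (by omega)

/-- `S` realizes `T`, and `β` and `R` satisfy conditions under which `T` is a maximal quasitorus of
`Int(L)`. -/
def IsInnerRealization {L : Type w} [LieRing L] [LieAlgebra ℂ L] (T : Subgroup (L ≃ₗ[ℂ] L))
    (S : FiniteRootSystem.{0}) : Prop :=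
  S.Realizes T ∧ (∀ a, (∀ c, S.β a c = 1) → a = 0) ∧
    ∀ a ∈ S.R, ∀ n : ℕ, n • a ≠ 0 → n • a ∈ S.R

/-- `S` realizes `T`, and every function on `R` that is multiplicative on the pairs that do not
commute is a character, so that `T` is a maximal quasitorus of `Aut(L)`. -/
def IsOuterRealization {L : Type w} [LieRing L] [LieAlgebra ℂ L] (T : Subgroup (L ≃ₗ[ℂ] L))
    (S : FiniteRootSystem.{0}) : Prop :=
  S.Realizes T ∧
    ∀ μ : S.G → ℂˣ, (∀ a ∈ S.R, ∀ c ∈ S.R, S.β a c ≠ 1 → μ (a + c) = μ a * μ c) →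
      ∃ χ : Multiplicative S.G →* ℂˣ, ∀ a ∈ S.R, χ (.ofAdd a) = μ a

theorem nsmul_mem_of_two_torsion {S : FiniteRootSystem.{u}} (h2 : ∀ a : S.G, a + a = 0) :
    ∀ a ∈ S.R, ∀ n : ℕ, n • a ≠ 0 → n • a ∈ S.R := fun a ha n hn => by
  rwa [nsmul_eq_of_two_torsion h2 n a hn]

theorem mul_self_of_sign {r : ℂ} (h : r = 1 ∨ r = -1) : r * r = 1 := by
  rcases h with h | h <;> rw [h] <;> norm_num

/-- A sign as a unit. -/
theorem exists_unit_of_sign {r : ℂ} (h : r = 1 ∨ r = -1) : ∃ s : ℂˣ, (s : ℂ) = r ∧ s * s = 1 :=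
  ⟨⟨r, r, mul_self_of_sign h, mul_self_of_sign h⟩, rfl, Units.ext (mul_self_of_sign h)⟩

theorem exists_char_basisFamily {m : ℕ} {d : Fin (m + 1) → ℂ} (hd : ∀ i, d i = 1 ∨ d i = -1) :
    ∃ χ : Multiplicative (Fin m → ZMod 2) →* ℂˣ,
      ∀ i, (χ (.ofAdd (basisFamily m i)) : ℂ) = d 0 * d i := by
  choose s hs hs1 using fun i => exists_unit_of_sign (hd i)
  obtain ⟨χ, hχ⟩ := exists_char_of_signs (fun i : Fin m => s 0 * s i.succ) fun i => by
    rw [mul_mul_mul_comm, hs1, hs1, mul_one]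
  refine ⟨χ, fun i => ?_⟩
  induction i using Fin.cases with
  | zero =>
    rw [mul_self_of_sign (hd 0), basisFamily_zero]
    exact congrArg Units.val (map_one χ)
  | succ i => rw [basisFamily_succ, hχ, Units.val_mul, hs, hs]

theorem char_sign {G : Type*} [AddCommGroup G] (h2 : ∀ a : G, a + a = 0)
    (χ : Multiplicative G →* ℂˣ) (a : G) :
    (χ (.ofAdd a) : ℂ) = 1 ∨ (χ (.ofAdd a) : ℂ) = -1 := by
  rw [← mul_self_eq_one_iff, ← Units.val_mul, ← map_mul, ← ofAdd_add, h2]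
  simp

/-- In odd size the matrix -1 has determinant -1. Every sign matrix is thus brought to determinant
one by a global sign, which is the product of its entries, and the determinant condition imposes
nothing on the characters of (ℤ/2)^{2k}. -/
theorem exists_isInnerRealization_so_odd {k : ℕ} (hk : 1 ≤ k) :
    ∃ S : FiniteRootSystem.{0}, IsInnerRealization
      (adGroup (LieAlgebra.Orthogonal.so (Fin (2 * k + 1)) ℂ) (specialDiagSigns (2 * k + 1))) S ∧
      ∀ a : S.G, a + a = 0 := by
  have H := cliffordFamily_basisFamily (m := 2 * k) (by omega) (by omega)
  refine ⟨H.rootSystem, ⟨H.realizes ?_ ?_, fun a ha => ?_, nsmul_mem_of_two_torsion H.two_torsion⟩,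
    H.two_torsion⟩
  · rintro _ ⟨⟨d, hd, rfl⟩, -⟩
    exact ⟨d, hd, rfl, exists_char_basisFamily hd⟩
  · intro χ
    have hsign := char_sign H.two_torsion χ
    have hprod : (∏ i, (χ (.ofAdd (basisFamily (2 * k) i)) : ℂ)) *
        (∏ i, (χ (.ofAdd (basisFamily (2 * k) i)) : ℂ)) = 1 := by
      rw [← Finset.prod_mul_distrib]
      exact Finset.prod_eq_one fun i _ => mul_self_of_sign (hsign _)
    refine ⟨∏ i, (χ (.ofAdd (basisFamily (2 * k) i)) : ℂ), hprod, ⟨_, fun i => ?_, rfl⟩, ?_⟩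
    · rw [← mul_self_eq_one_iff]
      linear_combination hprod * χ (.ofAdd (basisFamily (2 * k) i)) *
        χ (.ofAdd (basisFamily (2 * k) i)) + mul_self_of_sign (hsign (basisFamily (2 * k) i))
    · rw [Matrix.det_diagonal, Finset.prod_mul_distrib, Finset.prod_const, Finset.card_univ,
        Fintype.card_fin, pow_succ, pow_mul, pow_two, hprod, one_pow, one_mul, hprod]
  · exact cliffordBicharacter_nondegenerate (even_two_mul k) ha

/-- In even size a global sign does not change the determinant. Determinant one makes the last sign
the product of the others, which corresponds to the value of a character at e_1 + ⋯ + e_m; so the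
extended family in rank n - 2 is the right one. -/
theorem exists_isInnerRealization_so_even {n : ℕ} (hn : 6 ≤ n) (hn2 : Even n) :
    ∃ S : FiniteRootSystem.{0}, IsInnerRealization
      (adGroup (LieAlgebra.Orthogonal.so (Fin n) ℂ) (specialDiagSigns n)) S ∧
      ∀ a : S.G, a + a = 0 := by
  obtain ⟨m, rfl⟩ : ∃ m, n = m + 2 := ⟨n - 2, by omega⟩
  have hm2 : Even m := by
    rw [Nat.even_add] at hn2
    exact hn2.mpr even_two
  have H := cliffordFamily_extendedFamily (m := m) (by omega) hm2
  have hone : (1 : Fin m → ZMod 2) = ∑ i, Pi.single i 1 :=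
    (Finset.univ_sum_single (1 : Fin m → ZMod 2)).symm
  have hχone : ∀ χ : Multiplicative (Fin m → ZMod 2) →* ℂˣ,
      (χ (.ofAdd 1) : ℂ) = ∏ i, (χ (.ofAdd (Pi.single i 1)) : ℂ) := by
    intro χ
    rw [hone, ofAdd_sum, map_prod]
    exact map_prod (Units.coeHom ℂ) _ _
  refine ⟨H.rootSystem, ⟨H.realizes ?_ ?_, fun a ha => ?_, nsmul_mem_of_two_torsion H.two_torsion⟩,
    H.two_torsion⟩
  · rintro _ ⟨⟨d, hd, rfl⟩, hdet⟩
    refine ⟨d, hd, rfl, ?_⟩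
    obtain ⟨χ, hχ⟩ := exists_char_basisFamily (m := m) (d := fun i => d i.castSucc)
      fun i => hd _
    refine ⟨χ, fun i => ?_⟩
    induction i using Fin.lastCases with
    | cast i => rw [extendedFamily_castSucc, hχ]; rfl
    | last =>
      rw [extendedFamily_last, hχone]
      have h1 : ∀ i : Fin m, (χ (.ofAdd (Pi.single i 1)) : ℂ) = d 0 * d i.succ.castSucc :=
        fun i => hχ i.succ
      simp only [h1]
      rw [Matrix.det_diagonal, Fin.prod_univ_castSucc, Fin.prod_univ_succ] at hdet
      rw [Finset.prod_mul_distrib, Finset.prod_const, Finset.card_univ, Fintype.card_fin]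
      obtain ⟨l, rfl⟩ := hm2
      rw [pow_add, ← mul_pow, mul_self_of_sign (hd 0), one_pow, one_mul]
      have e1 := mul_self_of_sign (hd 0)
      have e2 := mul_self_of_sign (hd (Fin.last _))
      have e3 : d (Fin.castSucc 0) = d 0 := rfl
      rw [e3] at hdet
      linear_combination (d 0 * d (Fin.last _)) * hdet -
        (∏ i : Fin (l + l), d i.succ.castSucc) * d (Fin.last _) * d (Fin.last _) * e1 -
        (∏ i : Fin (l + l), d i.succ.castSucc) * e2
  · intro χ
    have hsign := char_sign H.two_torsion χ
    refine ⟨1, one_mul 1, ⟨_, fun i => ?_, rfl⟩, ?_⟩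
    · rw [one_mul]
      exact hsign _
    · simp only [one_mul]
      rw [Matrix.det_diagonal, Fin.prod_univ_castSucc, Fin.prod_univ_succ, extendedFamily_last,
        hχone]
      have h1 : ∀ i : Fin m, extendedFamily m i.succ.castSucc = Pi.single i 1 := fun i => by
        rw [extendedFamily_castSucc, basisFamily_succ]
      simp only [h1]
      have h3 : (χ (.ofAdd (extendedFamily m (Fin.castSucc 0))) : ℂ) = 1 := by
        rw [extendedFamily_castSucc, basisFamily_zero]
        exact congrArg Units.val (map_one χ)
      rw [h3, one_mul, ← Finset.prod_mul_distrib]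
      exact Finset.prod_eq_one fun i _ => mul_self_of_sign (hsign _)
  · exact cliffordBicharacter_nondegenerate hm2 ha

/-- Without a determinant condition the n - 1 signs d_0 d_i are independent. For even n the form β
is then degenerate, so universality is checked instead: e_i and e_i + e_j do not commute and have
sum e_j, whence μ(e_j) = μ(e_i)² μ(e_j), and the signs μ(e_i) define a character. -/
theorem exists_isOuterRealization_so_even {n : ℕ} (hn : 6 ≤ n) :
    ∃ S : FiniteRootSystem.{0}, IsOuterRealization
      (adGroup (LieAlgebra.Orthogonal.so (Fin n) ℂ) (diagSigns n)) S ∧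
      ∀ a : S.G, a + a = 0 := by
  obtain ⟨m, rfl⟩ : ∃ m, n = m + 1 := ⟨n - 1, by omega⟩
  have H := cliffordFamily_basisFamily (m := m) (by omega) (by omega)
  refine ⟨H.rootSystem, ⟨H.realizes ?_ ?_, fun μ hμ => ?_⟩, H.two_torsion⟩
  · rintro _ ⟨d, hd, rfl⟩
    exact ⟨d, hd, rfl, exists_char_basisFamily hd⟩
  · intro χ
    refine ⟨1, one_mul 1, ⟨_, fun i => ?_, rfl⟩⟩
    rw [one_mul]
    exact char_sign H.two_torsion χ _
  · change (Fin m → ZMod 2) → ℂˣ at μ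
    have hμ' : ∀ i j k l : Fin (m + 1), i ≠ j → k ≠ l →
        cliffordBicharacter m (basisFamily m i + basisFamily m j)
          (basisFamily m k + basisFamily m l) = -1 →
        μ ((basisFamily m i + basisFamily m j) + (basisFamily m k + basisFamily m l)) =
        μ (basisFamily m i + basisFamily m j) * μ (basisFamily m k + basisFamily m l) :=
      fun i j k l hij hkl hβ => hμ _ ⟨i, j, hij, rfl⟩ _ ⟨k, l, hkl, rfl⟩ fun h1 => by
        have h1 : cliffordBicharacter m (basisFamily m i + basisFamily m j)
          (basisFamily m k + basisFamily m l) = 1 := h1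
        rw [hβ] at h1
        exact absurd (congrArg Units.val h1) (by norm_num)
    have hb0 : ∀ a, basisFamily m 0 + a = a := fun a => zero_add a
    have hadd : ∀ i j : Fin (m + 1), i ≠ 0 → j ≠ 0 → i ≠ j →
        μ (basisFamily m i + basisFamily m j) = μ (basisFamily m i) * μ (basisFamily m j) := by
      intro i j hi hj hij
      have := hμ' 0 i 0 j hi.symm hj.symm (H.bichar_shared hi.symm hj.symm hij)
      simpa only [hb0] using this
    have hsq : ∀ i : Fin m, μ (Pi.single i 1) * μ (Pi.single i 1) = 1 := by
      intro i
      obtain ⟨j, hj, hji⟩ := H.third 0 i.succ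
      have hi : i.succ ≠ 0 := Fin.succ_ne_zero i
      have h1 := hμ' i.succ 0 i.succ j hi hji.symm (H.bichar_shared hi hji.symm hj.symm)
      rw [add_comm (basisFamily m i.succ) (basisFamily m 0), hb0, H.add_add_cancel,
        hadd _ _ hi hj hji.symm, ← mul_assoc] at h1
      exact (right_eq_mul.mp h1)
    obtain ⟨χ, hχ⟩ := exists_char_of_signs (fun i => μ (Pi.single i 1)) hsq
    have hχ' : ∀ i : Fin (m + 1), i ≠ 0 → χ (.ofAdd (basisFamily m i)) = μ (basisFamily m i) := by
      intro i hi
      obtain ⟨i, rfl⟩ := Fin.exists_succ_eq.mpr hi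
      exact hχ i
    refine ⟨χ, ?_⟩
    rintro _ ⟨i, j, hij, rfl⟩
    by_cases hi : i = 0
    · subst hi
      have e := hb0 (basisFamily m j)
      rw [e]
      exact hχ' j hij.symm
    · by_cases hj : j = 0
      · subst hj
        have e : basisFamily m i + basisFamily m 0 = basisFamily m i := add_zero _
        rw [e]
        exact hχ' i hij
      · rw [hadd i j hi hj hij, ← hχ' i hi, ← hχ' j hj]
        exact map_mul χ (.ofAdd (basisFamily m i)) (.ofAdd (basisFamily m j))

/-! ### Bases of matrix algebras that multiply like twisted group algebras -/

/-- Nondegeneracy makes a ↦ β(a,·) injective, and the dual group has the same order as V. -/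
theorem Bicharacter.exists_eq_of_nondegenerate {V : Type u} [AddCommGroup V] [Finite V]
    {β : Bicharacter V} (hβ : ∀ a, (∀ c, β a c = 1) → a = 0) (χ : Multiplicative V →* ℂˣ) :
    ∃ a, ∀ c, χ (.ofAdd c) = β a c := by
  have hexp : NeZero (Monoid.exponent (Multiplicative V)) := ⟨Monoid.exponent_ne_zero_of_finite⟩
  let B : V → Multiplicative V →* ℂˣ := fun a =>
    MonoidHom.mk' (fun c => β a c.toAdd) fun c d => β.add_right a _ _
  have hinj : Function.Injective B := by
    intro a c hac
    rw [← sub_eq_zero]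
    refine hβ _ fun d => ?_
    have h1 : β a d = β c d := DFunLike.congr_fun hac (.ofAdd d)
    have h2 := β.add_left (a - c) c d
    rw [sub_add_cancel, h1] at h2
    exact right_eq_mul.mp h2
  obtain ⟨a, ha⟩ := ((Nat.bijective_iff_injective_and_card B).mpr ⟨hinj,
    (CommGroup.card_monoidHom_of_hasEnoughRootsOfUnity (Multiplicative V) ℂ).symm⟩).2 χ
  exact ⟨a, fun c => by rw [← ha]; rfl⟩

theorem mul_inv_eq_of_mul_eq {A : Type*} [CommGroup A] {x y z g w : A}
    (h : x * y = w * g⁻¹ * z) : g * z⁻¹ = y⁻¹ * (x⁻¹ * w) := by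
  rw [eq_inv_mul_iff_mul_eq, eq_inv_mul_iff_mul_eq, ← mul_assoc, h, mul_comm g,
    mul_assoc (w * g⁻¹), mul_inv_cancel_left, inv_mul_cancel_right]

/-- Matrices `v_a` with `v_a v_c = γ(a,c) v_{a+c}` for a bicharacter `γ` whose alternating
bicharacter `β` is nondegenerate. -/
structure WeylFamily {V : Type u} [AddCommGroup V] {ι : Type} [Fintype ι] [DecidableEq ι]
    (γ β : Bicharacter V) (v : V → Matrix ι ι ℂ) : Prop where
  lift : γ.IsLift β
  nondegenerate : ∀ a, (∀ c, β a c = 1) → a = 0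
  apply_zero : v 0 = 1
  mul : ∀ a c, v a * v c = (γ a c : ℂ) • v (a + c)
  card : Nat.card V = Fintype.card ι ^ 2
  nonempty : Nonempty ι

namespace WeylFamily

variable {V : Type u} [AddCommGroup V] {ι : Type} [Fintype ι] [DecidableEq ι]
  {γ β : Bicharacter V} {v : V → Matrix ι ι ℂ} (H : WeylFamily γ β v)

include H

theorem alternating : β.IsAlternating := fun a => by rw [H.lift, mul_inv_cancel]

theorem mul_swap (a c : V) : v a * v c = (β a c : ℂ) • (v c * v a) := by
  rw [H.mul, H.mul, smul_smul, add_comm c a, H.lift, ← Units.val_mul]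
  simp

theorem isUnit (a : V) : IsUnit (v a) := by
  rw [Matrix.isUnit_iff_isUnit_det]
  have h1 := congrArg Matrix.det (H.mul a (-a))
  rw [add_neg_cancel, H.apply_zero, Matrix.det_mul, Matrix.det_smul, Matrix.det_one, mul_one] at h1
  exact isUnit_of_mul_isUnit_left (h1 ▸ ((γ a (-a)).isUnit.pow _))

theorem conj (a c : V) : v a * v c * (v a)⁻¹ = (β a c : ℂ) • v c := by
  rw [H.mul_swap, smul_mul_assoc, mul_assoc, Matrix.mul_nonsing_inv, mul_one]
  exact (Matrix.isUnit_iff_isUnit_det _).mp (H.isUnit a)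

/-- Some v_c conjugates v_a to a multiple of itself by a factor different from 1, while the trace is
invariant under conjugation. -/
theorem trace_eq_zero {a : V} (ha : a ≠ 0) : (v a).trace = 0 := by
  obtain ⟨c, hc⟩ : ∃ c, β c a ≠ 1 := by
    by_contra! hall
    exact ha (H.nondegenerate a fun c => by rw [H.alternating.swap, hall c, inv_one])
  have h1 := congrArg Matrix.trace (H.conj c a)
  rw [Matrix.trace_mul_cycle, Matrix.nonsing_inv_mul _
    ((Matrix.isUnit_iff_isUnit_det _).mp (H.isUnit c)), one_mul, Matrix.trace_smul,
    smul_eq_mul] at h1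
  have h2 : ((β c a : ℂ) - 1) * (v a).trace = 0 := by linear_combination -h1
  refine (mul_eq_zero.mp h2).resolve_left fun h3 => hc (Units.ext ?_)
  rw [Units.val_one]
  linear_combination h3

theorem trace_zero : (v 0).trace ≠ 0 := by
  have := H.nonempty
  rw [H.apply_zero, Matrix.trace_one]
  exact Nat.cast_ne_zero.mpr Fintype.card_ne_zero

/-- Multiplying a relation by v_{-a} and taking the trace isolates the coefficient of v_a. -/
theorem linearIndependent [Finite V] : LinearIndependent ℂ v := by
  have := Fintype.ofFinite V
  rw [Fintype.linearIndependent_iff]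
  intro r hr a
  have h1 := congrArg (fun M => (M * v (-a)).trace) hr
  simp only [Finset.sum_mul, zero_mul, Matrix.trace_zero, smul_mul_assoc, H.mul,
    Matrix.trace_sum, Matrix.trace_smul, smul_eq_mul] at h1
  rw [Finset.sum_eq_single a] at h1
  · rw [add_neg_cancel] at h1
    exact (mul_eq_zero.mp h1).resolve_right (mul_ne_zero (γ a (-a)).ne_zero H.trace_zero)
  · intro c _ hca
    rw [H.trace_eq_zero fun h => hca (add_neg_eq_zero.mp h), mul_zero, mul_zero]
  · simp

theorem exists_basis [Finite V] : ∃ b : Module.Basis V ℂ (Matrix ι ι ℂ), ∀ a, b a = v a := by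
  have := Fintype.ofFinite V
  have : Nonempty V := ⟨0⟩
  refine ⟨basisOfLinearIndependentOfCardEqFinrank H.linearIndependent ?_, fun a => ?_⟩
  · rw [Module.finrank_matrix, Module.finrank_self, mul_one, ← pow_two, ← H.card,
      Nat.card_eq_fintype_card]
  · rw [coe_basisOfLinearIndependentOfCardEqFinrank]

/-- The basis `(v_a)`. -/
noncomputable def basis [Finite V] : Module.Basis V ℂ (Matrix ι ι ℂ) := H.exists_basis.choose

theorem basis_apply [Finite V] (a : V) : H.basis a = v a := H.exists_basis.choose_spec a

theorem repr_eq_of_basis [Finite V] {f : Matrix ι ι ℂ →ₗ[ℂ] Matrix ι ι ℂ} {r : V → ℂ}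
    (hf : ∀ a, f (v a) = r a • v a) (x : Matrix ι ι ℂ) (a : V) :
    H.basis.repr (f x) a = r a * H.basis.repr x a := by
  have h1 : H.basis.coord a ∘ₗ f = r a • H.basis.coord a := by
    refine H.basis.ext fun c => ?_
    simp only [LinearMap.comp_apply, LinearMap.smul_apply, Module.Basis.coord_apply, H.basis_apply,
      hf, map_smul]
    rw [← H.basis_apply c, Module.Basis.repr_self]
    by_cases hca : c = a
    · subst hca
      rfl
    · rw [Finsupp.single_eq_of_ne (Ne.symm hca)]
      simp
  exact LinearMap.congr_fun h1 x

theorem repr_conj [Finite V] (c : V) (x : Matrix ι ι ℂ) (a : V) :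
    H.basis.repr (v c * x * (v c)⁻¹) a = β c a * H.basis.repr x a :=
  H.repr_eq_of_basis (f := LinearMap.mulRight ℂ (v c)⁻¹ ∘ₗ LinearMap.mulLeft ℂ (v c))
    (fun a => H.conj c a) x a

theorem trace_eq [Finite V] (x : Matrix ι ι ℂ) :
    x.trace = H.basis.repr x 0 * (v 0).trace := by
  have h1 : Matrix.traceLinearMap ι ℂ ℂ = (v 0).trace • H.basis.coord 0 := by
    refine H.basis.ext fun c => ?_
    rw [LinearMap.smul_apply, Module.Basis.coord_apply, Module.Basis.repr_self, H.basis_apply,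
      Matrix.traceLinearMap_apply]
    by_cases hc : c = 0
    · rw [hc, Finsupp.single_eq_same, smul_eq_mul, mul_one]
    · rw [H.trace_eq_zero hc, Finsupp.single_eq_of_ne (Ne.symm hc), smul_zero]
  rw [mul_comm]
  exact LinearMap.congr_fun h1 x

attribute [local instance] LieRing.ofAssociativeRing

/-- ξ and the pullback of γ induce the same alternating bicharacter, so their quotient is symmetric
and a coboundary; rescaling by it matches the structure constants. The section s need be additive
only on noncommuting pairs, because the other brackets vanish on both sides. This freedom serves the
section a ↦ (a, q a + 1) of the outer case. -/
theorem exists_lieHom [Finite V] {S : FiniteRootSystem.{w}} (p : S.G →+ V) (s : V → S.G)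
    (hβ : ∀ a c, S.β a c = β (p a) (p c)) (hps : ∀ a, p (s a) = a)
    (hs : ∀ a c, β a c ≠ 1 → s a + s c = s (a + c)) :
    ∃ (m : V → ℂˣ) (ψ : Matrix ι ι ℂ →ₗ⁅ℂ⁆ TwistedLie S.ξ),
      ∀ a, ψ (v a) = (m a : ℂ) • TwistedLie.u S.ξ (s a) := by
  have hγξ : ∀ a c, S.ξ a c * (γ (p a) (p c))⁻¹ = S.ξ c a * (γ (p c) (p a))⁻¹ := by
    intro a c
    have h1 := S.ξ_isLift a c
    rw [hβ, H.lift] at h1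
    rw [mul_inv_eq_iff_eq_mul, mul_assoc, mul_comm (γ (p c) (p a))⁻¹, h1,
      mul_left_comm, mul_inv_cancel, mul_one]
  obtain ⟨c, hc⟩ := Bicharacter.exists_coboundary_of_symm
    (G := S.G) ⟨fun a c => S.ξ a c * (γ (p a) (p c))⁻¹,
      fun a b c => by rw [map_add, S.ξ.add_left, γ.add_left, mul_inv, mul_mul_mul_comm],
      fun a b c => by rw [map_add, S.ξ.add_right, γ.add_right, mul_inv, mul_mul_mul_comm]⟩ hγξ
  have hc' : ∀ a d, c a * c d = S.ξ a d * (γ (p a) (p d))⁻¹ * c (a + d) := hc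
  let ψ : Matrix ι ι ℂ →ₗ[ℂ] TwistedLie S.ξ :=
    H.basis.constr ℂ fun a => ((c (s a))⁻¹ : ℂˣ) • TwistedLie.u S.ξ (s a)
  have hψ : ∀ a, ψ (v a) = (((c (s a))⁻¹ : ℂˣ) : ℂ) • TwistedLie.u S.ξ (s a) := by
    intro a
    rw [← H.basis_apply, Module.Basis.constr_basis]
    rfl
  have hlie : ∀ x y : Matrix ι ι ℂ, ψ (x * y - y * x) = ⁅ψ x, ψ y⁆ := by
    have h1 : (LinearMap.mul ℂ (Matrix ι ι ℂ) - (LinearMap.mul ℂ (Matrix ι ι ℂ)).flip).compr₂ ψ =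
        (TwistedLie.bracket S.ξ).compl₁₂ ψ ψ := by
      refine H.basis.ext fun a => H.basis.ext fun d => ?_
      simp only [LinearMap.compr₂_apply, LinearMap.compl₁₂_apply, LinearMap.sub_apply,
        LinearMap.flip_apply, LinearMap.mul_apply', H.basis_apply]
      rw [H.mul, H.mul, add_comm d a, ← sub_smul, map_smul, hψ, hψ, hψ, map_smul,
        LinearMap.map_smul₂, TwistedLie.bracket_u, smul_smul, smul_smul, smul_smul]
      by_cases hb : β a d = 1
      · have h2 : γ a d = γ d a := mul_inv_eq_one.mp ((H.lift a d).symm.trans hb)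
        have h3 : S.ξ (s a) (s d) = S.ξ (s d) (s a) := by
          refine mul_inv_eq_one.mp ((S.ξ_isLift _ _).symm.trans ?_)
          rw [hβ, hps, hps, hb]
        rw [h2, h3, sub_self, sub_self, zero_mul, mul_zero, zero_smul, zero_smul]
      · have e1 := hc' (s a) (s d)
        have e2 := hc' (s d) (s a)
        rw [hs a d hb, hps, hps] at e1
        rw [add_comm (s d), hs a d hb, hps, hps] at e2
        rw [hs a d hb]
        have e1' := mul_inv_eq_of_mul_eq e1
        have e2' := mul_inv_eq_of_mul_eq e2
        rw [← mul_assoc, mul_comm (c (s a))⁻¹, mul_assoc] at e2'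
        congr 1
        have f1 := congrArg Units.val e1'
        have f2 := congrArg Units.val e2'
        simp only [Units.val_mul] at f1 f2
        linear_combination f1 - f2
    intro x y
    exact LinearMap.congr_fun₂ h1 x y
  refine ⟨fun a => (c (s a))⁻¹, { ψ with map_lie' := fun {x y} => hlie x y }, hψ⟩

theorem exists_realization [Finite V] {S : FiniteRootSystem.{w}} (p : S.G →+ V) (s : V → S.G)
    (hβ : ∀ a c, S.β a c = β (p a) (p c)) (hps : ∀ a, p (s a) = a)
    (hs : ∀ a c, β a c ≠ 1 → s a + s c = s (a + c)) {P : Set V} (hP : S.R = s '' P)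
    {L : LieSubalgebra ℂ (Matrix ι ι ℂ)} (hL : ∀ x, x ∈ L ↔ ∀ a ∉ P, H.basis.repr x a = 0) :
    ∃ Φ : L →ₗ⁅ℂ⁆ TwistedLie S.ξ, Function.Injective Φ ∧
      LinearMap.range (Φ : L →ₗ[ℂ] TwistedLie S.ξ) = S.rootSpan ∧
      ∀ (σ : L ≃ₗ[ℂ] L) (χ : Multiplicative S.G →* ℂˣ),
        (∀ x, Φ (σ x) = TwistedLie.diag S.ξ (fun a => χ (.ofAdd a)) (Φ x)) ↔
        ∀ (x : L) (a : V), H.basis.repr (σ x : Matrix ι ι ℂ) a =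
          χ (.ofAdd (s a)) * H.basis.repr (x : Matrix ι ι ℂ) a := by
  obtain ⟨m, ψ, hψ⟩ := H.exists_lieHom p s hβ hps hs
  have hsinj : Function.Injective s := Function.LeftInverse.injective hps
  have hcoord : ∀ x a, (TwistedLie.basis S.ξ).repr (ψ x) (s a) = m a * H.basis.repr x a := by
    intro x a
    have h1 : (TwistedLie.basis S.ξ).coord (s a) ∘ₗ (ψ : Matrix ι ι ℂ →ₗ[ℂ] TwistedLie S.ξ) =
        (m a : ℂ) • H.basis.coord a := by
      refine H.basis.ext fun c => ?_
      rw [LinearMap.smul_apply, Module.Basis.coord_apply, Module.Basis.repr_self, H.basis_apply]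
      change (TwistedLie.basis S.ξ).repr (ψ (v c)) (s a) = _
      rw [hψ, map_smul, ← TwistedLie.basis_apply, Module.Basis.repr_self, Finsupp.smul_apply]
      by_cases hca : c = a
      · rw [hca, Finsupp.single_eq_same, Finsupp.single_eq_same]
      · rw [Finsupp.single_eq_of_ne (Ne.symm hca),
          Finsupp.single_eq_of_ne (hsinj.ne (Ne.symm hca)), smul_zero, smul_zero]
    exact LinearMap.congr_fun h1 x
  have hinjψ : Function.Injective ψ := by
    intro x y hxy
    refine H.basis.ext_elem fun a => mul_left_cancel₀ (m a).ne_zero ?_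
    rw [← hcoord, ← hcoord, hxy]
  have hinj : Function.Injective (ψ.comp L.incl) := hinjψ.comp Subtype.val_injective
  refine ⟨ψ.comp L.incl, hinj, ?_, ?_⟩
  · apply le_antisymm
    · rintro _ ⟨x, rfl⟩
      change ψ (x : Matrix ι ι ℂ) ∈ S.rootSpan
      have hx := (hL x).mp x.2
      have := Fintype.ofFinite V
      rw [← H.basis.sum_repr (x : Matrix ι ι ℂ), map_sum]
      refine sum_mem fun a _ => ?_
      by_cases ha : a ∈ P
      · rw [map_smul, H.basis_apply, hψ]
        refine Submodule.smul_mem _ _ (Submodule.smul_mem _ _ (Submodule.subset_span ?_))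
        exact ⟨s a, hP ▸ ⟨a, ha, rfl⟩, rfl⟩
      · rw [hx a ha, zero_smul, map_zero]
        exact zero_mem _
    · rw [FiniteRootSystem.rootSpan, Submodule.span_le]
      rintro _ ⟨c, hc, rfl⟩
      rw [hP] at hc
      obtain ⟨a, ha, rfl⟩ := hc
      have hva : v a ∈ L := by
        rw [hL]
        intro c hc
        rw [← H.basis_apply, Module.Basis.repr_self, Finsupp.single_eq_of_ne]
        rintro rfl
        exact hc ha
      refine ⟨((m a)⁻¹ : ℂˣ) • ⟨v a, hva⟩, ?_⟩
      change ψ (((m a)⁻¹ : ℂˣ) • v a) = _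
      rw [Units.smul_def, map_smul, hψ, smul_smul, ← Units.val_mul, inv_mul_cancel,
        Units.val_one, one_smul]
  · intro σ χ
    have hdiag : ∀ x, TwistedLie.diag S.ξ (fun a => χ (.ofAdd a)) (ψ x) =
        ψ (H.basis.constr ℂ (fun a => (χ (.ofAdd (s a)) : ℂ) • v a) x) := by
      have h1 : TwistedLie.diag S.ξ (fun a => χ (.ofAdd a)) ∘ₗ
          (ψ : Matrix ι ι ℂ →ₗ[ℂ] TwistedLie S.ξ) = (ψ : Matrix ι ι ℂ →ₗ[ℂ] TwistedLie S.ξ) ∘ₗ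
            (H.basis.constr ℂ fun a => (χ (.ofAdd (s a)) : ℂ) • v a) := by
        refine H.basis.ext fun a => ?_
        rw [LinearMap.comp_apply, LinearMap.comp_apply, Module.Basis.constr_basis, H.basis_apply]
        change TwistedLie.diag S.ξ _ (ψ (v a)) = ψ _
        rw [map_smul, hψ, map_smul, TwistedLie.diag_u, smul_comm]
      exact fun x => LinearMap.congr_fun h1 x
    have hrep := H.repr_eq_of_basis (f := H.basis.constr ℂ fun a => (χ (.ofAdd (s a)) : ℂ) • v a)
      (r := fun a => (χ (.ofAdd (s a)) : ℂ)) fun a => by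
        rw [← H.basis_apply, Module.Basis.constr_basis, H.basis_apply]
    refine forall_congr' fun x => ?_
    change ψ (σ x) = TwistedLie.diag S.ξ _ (ψ x) ↔ _
    rw [hdiag, hinjψ.eq_iff, H.basis.ext_elem_iff]
    exact forall_congr' fun a => by rw [hrep]

/-- A set of matrices whose elements are the multiples of the `v_a`, at least up to scalars. -/
def Spans (_H : WeylFamily γ β v) (A : Set (Matrix ι ι ℂ)) : Prop :=
  (∀ g ∈ A, ∃ (r : ℂ) (a : V), r ≠ 0 ∧ g = r • v a) ∧ ∀ a, v a ∈ A

/-- Scalars act trivially by conjugation, so the maps Ad v_c already form the whole group, and Ad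
v_c scales coordinate a by β(c,a). -/
theorem mem_adGroup [Finite V] {L : LieSubalgebra ℂ (Matrix ι ι ℂ)} {A : Set (Matrix ι ι ℂ)}
    (hA : H.Spans A) {σ : L ≃ₗ[ℂ] L} :
    σ ∈ adGroup L A ↔ ∃ c : V, ∀ (x : L) (a : V), H.basis.repr (σ x : Matrix ι ι ℂ) a =
          β c a * H.basis.repr (x : Matrix ι ι ℂ) a := by
  constructor
  · intro hσ
    induction hσ using Subgroup.closure_induction with
    | mem σ hσ =>
      obtain ⟨g, hg, -, hσ⟩ := hσ
      obtain ⟨r, c, hr, rfl⟩ := hA.1 g hg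
      refine ⟨c, fun x a => ?_⟩
      rw [hσ, ← H.repr_conj]
      have h1 : (r • v c)⁻¹ = r⁻¹ • (v c)⁻¹ := by
        have := invertibleOfNonzero hr
        rw [Matrix.inv_smul _ _ ((Matrix.isUnit_iff_isUnit_det _).mp (H.isUnit c)), invOf_eq_inv]
      rw [h1, smul_mul_assoc, smul_mul_smul_comm, mul_inv_cancel₀ hr, one_smul]
    | one => exact ⟨0, fun x a => by rw [β.map_zero_left, Units.val_one, one_mul]; rfl⟩
    | mul σ τ _ _ hσ hτ =>
      obtain ⟨c, hc⟩ := hσ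
      obtain ⟨d, hd⟩ := hτ
      refine ⟨c + d, fun x a => ?_⟩
      rw [LinearEquiv.mul_apply, hc, hd, β.add_left, Units.val_mul, mul_assoc]
    | inv σ _ hσ =>
      obtain ⟨c, hc⟩ := hσ
      refine ⟨-c, fun x a => ?_⟩
      have h2 : σ (σ⁻¹ x) = x := LinearEquiv.apply_symm_apply σ x
      have h3 := hc (σ⁻¹ x) a
      rw [h2] at h3
      rw [h3, ← mul_assoc, ← Units.val_mul, ← β.add_left, neg_add_cancel, β.map_zero_left,
        Units.val_one, one_mul]
  · rintro ⟨c, hc⟩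
    refine Subgroup.subset_closure ⟨v c, hA.2 c, H.isUnit c, fun x => H.basis.ext_elem fun a => ?_⟩
    rw [hc, H.repr_conj]

/-- Here s is an isomorphism of groups, so a character of the grading group is a character of V,
hence some β(c,·), and comes from conjugation by v_c. -/
theorem realizes_adGroup [Finite V] {S : FiniteRootSystem.{w}} (p : S.G →+ V) (s : V → S.G)
    (hβ : ∀ a c, S.β a c = β (p a) (p c)) (hps : ∀ a, p (s a) = a) (hsp : ∀ a, s (p a) = a)
    {P : Set V} (hP : S.R = s '' P)
    {L : LieSubalgebra ℂ (Matrix ι ι ℂ)} (hL : ∀ x, x ∈ L ↔ ∀ a ∉ P, H.basis.repr x a = 0)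
    {A : Set (Matrix ι ι ℂ)} (hA : H.Spans A) : S.Realizes (adGroup L A) := by
  have hs : ∀ a c, s a + s c = s (a + c) := fun a c => by
    rw [← hsp (s a + s c), map_add, hps, hps]
  obtain ⟨Φ, hinj, hrange, hΦ⟩ := H.exists_realization p s hβ hps (fun a c _ => hs a c) hP hL
  refine ⟨Φ, hinj, hrange, ?_⟩
  ext σ
  rw [H.mem_adGroup hA, FiniteRootSystem.mem_diagGroup]
  constructor
  · rintro ⟨c, hc⟩
    refine ⟨MonoidHom.mk' (fun d => β c (p d.toAdd)) fun d e => ?_, (hΦ _ _).mpr fun x a => ?_⟩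
    · rw [toAdd_mul, map_add, β.add_right]
    · rw [hc]
      change _ = ((β c (p (s a)) : ℂˣ) : ℂ) * _
      rw [hps]
  · rintro ⟨χ, hχ⟩
    obtain ⟨c, hc⟩ := Bicharacter.exists_eq_of_nondegenerate H.nondegenerate
      (MonoidHom.mk' (fun a : Multiplicative V => χ (.ofAdd (s a.toAdd))) fun d e => by
        rw [toAdd_mul, ← hs, ofAdd_add, map_mul])
    refine ⟨c, fun x a => ?_⟩
    rw [← hc, (hΦ _ _).mp hχ]
    rfl

end WeylFamily

/-! ### Quadratic forms over `ℤ/2` -/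

theorem signChar_mul_self (x : ZMod 2) : signChar x * signChar x = 1 := by
  rw [← signChar_add, zmod_two_add_self, signChar_zero]

theorem signChar_ne_one {x : ZMod 2} (h : signChar x ≠ 1) : x = 1 :=
  (zmod_two_cases x).resolve_left fun h0 => h (signChar_eq_one_iff.mpr h0)

/-- A quadratic form `q` on an elementary abelian `2`-group whose polar form is nondegenerate, and
the polar form `β`, written multiplicatively. -/
structure QuadraticPair {V : Type u} [AddCommGroup V] (β : Bicharacter V) (q : V → ZMod 2) :
    Prop where
  two_torsion : ∀ a : V, a + a = 0
  nondegenerate : ∀ a, (∀ c, β a c = 1) → a = 0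
  polar : ∀ a c, β a c = signChar (q a + q c + q (a + c))

namespace QuadraticPair

variable {V : Type u} [AddCommGroup V] {β : Bicharacter V} {q : V → ZMod 2}
  (H : QuadraticPair β q)

include H

theorem apply_zero : q 0 = 0 := by
  have h := H.polar 0 0
  rw [β.map_zero_left, add_zero, zmod_two_add_self, zero_add] at h
  exact signChar_eq_one_iff.mp h.symm

theorem alternating : β.IsAlternating := fun a => by
  rw [H.polar, zmod_two_add_self, H.two_torsion, zero_add, H.apply_zero, signChar_zero]

theorem symm (a c : V) : β a c = β c a := by
  rw [H.polar, H.polar, add_comm a c, add_comm (q a)]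

theorem eq_one_or (a c : V) : β a c = 1 ∨ β a c = -1 := by
  rw [H.polar]
  rcases zmod_two_cases (q a + q c + q (a + c)) with h | h <;> rw [h]
  · exact Or.inl signChar_zero
  · exact Or.inr signChar_one

theorem mul_self (a c : V) : β a c * β a c = 1 := by
  rw [H.polar, signChar_mul_self]

theorem neg_eq (a : V) : -a = a := neg_eq_of_add_eq_zero_left (H.two_torsion a)

theorem apply_add {a c : V} (h : β a c = 1) : q (a + c) = q a + q c := by
  rw [H.polar, signChar_eq_one_iff] at h
  exact (CharTwo.add_eq_zero.mp h).symm

theorem apply_add_of_ne {a c : V} (h : β a c ≠ 1) : q (a + c) = q a + q c + 1 := by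
  rw [H.polar] at h
  have := signChar_ne_one h
  rw [← this]
  linear_combination -zmod_two_add_self (q a + q c)

theorem exists_ne_one {a : V} (ha : a ≠ 0) : ∃ c, β a c ≠ 1 := by
  by_contra! h
  exact ha (H.nondegenerate a h)

/-- Translation of a quadratic form. -/
theorem translate (j : V) : QuadraticPair β fun a => q j + q (j + a) where
  two_torsion := H.two_torsion
  nondegenerate := H.nondegenerate
  polar a c := by
    have h1 : ∀ x, signChar (q j + q (j + x)) = signChar (q x) * β j x := by
      intro x
      rw [H.polar, ← signChar_add]
      congr 1
      linear_combination -zmod_two_add_self (q x)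
    rw [signChar_add, signChar_add, h1, h1, h1, H.polar a c, β.add_right,
      signChar_add, signChar_add]
    have h2 := H.mul_self j a
    have h3 := H.mul_self j c
    calc _ = signChar (q a) * signChar (q c) * signChar (q (a + c)) * (β j a * β j a) *
          (β j c * β j c) := by rw [h2, h3, mul_one, mul_one]
      _ = _ := by
        simp only [mul_assoc, mul_left_comm]

/-- The elements with `q(a) = 1`. -/
def rootSystem [Finite V] [Nontrivial V] (hgen : AddSubgroup.closure {a | q a = 1} = ⊤) :
    FiniteRootSystem.{u} where
  G := V
  β := β
  alternating := H.alternating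
  nontrivial := fun htop => by
    obtain ⟨a, ha⟩ := exists_ne (0 : V)
    obtain ⟨c, hc⟩ := H.exists_ne_one ha
    exact hc ((htop ▸ Set.mem_univ a : a ∈ β.radical) c)
  R := {a | q a = 1}
  disjoint_radical := fun a (ha : q a = 1) hrad => by
    rw [H.nondegenerate a hrad, H.apply_zero] at ha
    exact absurd ha (by decide)
  generates := hgen
  neg_closed := fun a ha => by rwa [H.neg_eq]
  add_closed := fun a (ha : q a = 1) c (hc : q c = 1) hβ => by
    change q (a + c) = 1
    rw [H.apply_add_of_ne hβ, ha, hc]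
    decide

/-- The elements `(a, q(a) + 1)` with `a ≠ 0`. -/
def outerRootSystem [Finite V] [Nontrivial V]
    (horth : ∀ b b' : V, ∃ a, a ≠ 0 ∧ β a b = 1 ∧ β a b' = 1) : FiniteRootSystem.{u} where
  G := V × ZMod 2
  β := β.comap (AddMonoidHom.fst V (ZMod 2))
  alternating := fun a => H.alternating a.1
  nontrivial := fun htop => by
    obtain ⟨a, ha⟩ := exists_ne (0 : V)
    obtain ⟨c, hc⟩ := H.exists_ne_one ha
    have h1 : (a, (0 : ZMod 2)) ∈ (β.comap (AddMonoidHom.fst V (ZMod 2))).radical :=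
      htop ▸ Set.mem_univ _
    exact hc (h1 (c, 0))
  R := (fun a => (a, q a + 1)) '' {a | a ≠ 0}
  disjoint_radical := by
    rintro _ ⟨a, ha, rfl⟩ hrad
    exact ha (H.nondegenerate a fun c => hrad (c, 0))
  generates := by
    set K := AddSubgroup.closure ((fun a : V => (a, q a + 1)) '' {a | a ≠ 0})
    have hK : ∀ a : V, a ≠ 0 → (a, q a + 1) ∈ K := fun a ha =>
      AddSubgroup.subset_closure ⟨a, ha, rfl⟩
    -- If c ≠ 0 commutes with a, then q is additive on this pair, and the roots over a, c and a + c
    -- add up to (0, 1). The auxiliary d, which commutes with c but not with a, ensures a ≠ c.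
    have h01 : ((0 : V), (1 : ZMod 2)) ∈ K := by
      obtain ⟨a, ha⟩ := exists_ne (0 : V)
      obtain ⟨d, hd⟩ := H.exists_ne_one ha
      obtain ⟨c, hc, hca, hcd⟩ := horth a d
      have hac : a + c ≠ 0 := fun h => by
        rw [← eq_neg_iff_add_eq_zero, H.neg_eq] at h
        rw [h] at hd
        exact hd hcd
      have := add_mem (add_mem (hK a ha) (hK c hc)) (hK _ hac)
      rw [H.apply_add (H.symm a c ▸ hca)] at this
      convert this using 1
      refine Prod.ext ?_ ?_
      · exact (H.two_torsion (a + c)).symm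
      · change 1 = q a + 1 + (q c + 1) + (q a + q c + 1)
        linear_combination -zmod_two_add_self (q a) - zmod_two_add_self (q c) - zmod_two_add_self 1
    have hx : ∀ x : ZMod 2, ((0 : V), x) ∈ K := by
      intro x
      rcases zmod_two_cases x with rfl | rfl
      · exact zero_mem K
      · exact h01
    rw [eq_top_iff]
    rintro ⟨a, x⟩ -
    by_cases ha : a = 0
    · rw [ha]
      exact hx x
    · have := add_mem (hK a ha) (hx (x - (q a + 1)))
      rwa [Prod.mk_add_mk, add_zero, add_sub_cancel] at this
  neg_closed := by
    rintro _ ⟨a, ha, rfl⟩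
    refine ⟨a, ha, Prod.ext (H.neg_eq a).symm ?_⟩
    exact (neg_eq_of_add_eq_zero_left (zmod_two_add_self _)).symm
  add_closed := by
    rintro _ ⟨a, ha, rfl⟩ _ ⟨c, hc, rfl⟩ hβ
    have hβ : β a c ≠ 1 := hβ
    refine ⟨a + c, fun h => ?_, Prod.ext rfl ?_⟩
    · rw [← eq_neg_iff_add_eq_zero, H.neg_eq] at h
      rw [h] at hβ
      exact hβ (H.alternating c)
    · change q (a + c) + 1 = q a + 1 + (q c + 1)
      rw [H.apply_add_of_ne hβ]
      ring

/-- Take c₁ nontrivial on a and c₂ nontrivial on a + b. If neither of them separates a from b as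
required, their sum does. -/
theorem exists_separating {a b : V} (ha : a ≠ 0) (hab : a ≠ b) : ∃ c, β a c ≠ 1 ∧ β b c = 1 := by
  obtain ⟨c₁, h₁⟩ := H.exists_ne_one ha
  by_cases h : β b c₁ = 1
  · exact ⟨c₁, h₁, h⟩
  obtain ⟨c₂, h₂⟩ := H.exists_ne_one (a := a + b) fun h => hab (by
    rwa [← eq_neg_iff_add_eq_zero, H.neg_eq] at h)
  rw [β.add_left] at h₂
  have e1 := H.eq_one_or a c₁
  have e2 := H.eq_one_or a c₂
  have e3 := H.eq_one_or b c₁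
  have e4 := H.eq_one_or b c₂
  by_cases h3 : β b c₂ = 1
  · exact ⟨c₂, by rwa [h3, mul_one] at h₂, h3⟩
  · have h4 : β a c₂ = 1 := by
      by_contra h4
      rw [e2.resolve_left h4, e4.resolve_left h3] at h₂
      exact h₂ (by simp)
    refine ⟨c₁ + c₂, ?_, ?_⟩
    · rwa [β.add_right, h4, mul_one]
    · rw [β.add_right, e3.resolve_left h, e4.resolve_left h3]
      simp

theorem exists_separating_pair {a a' b : V} (ha : a ≠ 0) (hab : a ≠ b) (ha' : a' ≠ 0)
    (hab' : a' ≠ b) : ∃ c, β a c ≠ 1 ∧ β a' c ≠ 1 ∧ β b c = 1 := by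
  obtain ⟨c, hc, hbc⟩ := H.exists_separating ha hab
  obtain ⟨c', hc', hbc'⟩ := H.exists_separating ha' hab'
  by_cases h1 : β a' c = 1
  · by_cases h2 : β a c' = 1
    · refine ⟨c + c', ?_, ?_, ?_⟩
      · rwa [β.add_right, h2, mul_one]
      · rwa [β.add_right, h1, one_mul]
      · rw [β.add_right, hbc, hbc', one_mul]
    · exact ⟨c', h2, hc', hbc'⟩
  · exact ⟨c, hc, h1, hbc⟩

/-- A function that is multiplicative on the pairs that do not commute is a character up to a
sign that depends on `q` only. -/
theorem exists_eq_mul_of_mul {A : Type*} [CommGroup A]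
    (horth : ∀ b b' : V, ∃ a, a ≠ 0 ∧ β a b = 1 ∧ β a b' = 1) {f : V → A}
    (hf : ∀ a c, β a c ≠ 1 → f (a + c) = f a * f c) :
    ∃ (l : V → A) (t : ZMod 2 → A), (∀ a c, l (a + c) = l a * l c) ∧
      (∀ x y, t (x + y) = t x * t y) ∧ ∀ a, a ≠ 0 → f a = l a * t (q a + 1) := by
  have hsymm := H.symm
  have halt := H.alternating
  -- Adding b twice to an element that does not commute with it leads back to that element, so f(b)²
  -- = 1.
  have hsq : ∀ b, b ≠ 0 → f b * f b = 1 := by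
    intro b hb
    obtain ⟨a, ha⟩ := H.exists_ne_one hb
    rw [hsymm] at ha
    have h1 := hf (a + b) b (by rwa [β.add_left, halt, mul_one])
    rw [add_assoc, H.two_torsion, add_zero, hf a b ha, mul_assoc] at h1
    exact left_eq_mul.mp h1
  have hadd : ∀ a b : V, a ≠ b → a + b ≠ 0 := fun a b hab h => hab (by
    rwa [← eq_neg_iff_add_eq_zero, H.neg_eq] at h)
  have hcancel : ∀ a b : V, a + (a + b) = b := fun a b => by
    rw [← add_assoc, H.two_torsion, zero_add]
  have hne0 : ∀ a c, β a c ≠ 1 → c ≠ 0 := fun a c h h0 => h (by rw [h0, β.map_zero_right])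
  -- the defect of multiplicativity on a pair of different commuting elements is constant
  have hδ1 : ∀ a b c, β a c ≠ 1 → β a b = 1 → β b c = 1 →
      f (a + c) * f b * f (a + c + b) = f a * f b * f (a + b) := by
    intro a b c hac hab hbc
    have h1 : f (a + c + b) = f (a + b) * f c := by
      rw [add_right_comm]
      exact hf _ _ (by rwa [β.add_left, hbc, mul_one])
    rw [h1, hf a c hac]
    calc f a * f c * f b * (f (a + b) * f c) = f a * f b * f (a + b) * (f c * f c) := by
          simp only [mul_left_comm, mul_comm]
      _ = _ := by rw [hsq c (hne0 a c hac), mul_one]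
  -- For fixed b, two elements commuting with b are linked by `hδ1` if they do not commute with each
  -- other; otherwise through some c that commutes with b but with neither of them.
  have hδ2 : ∀ a a' b, a ≠ 0 → a ≠ b → a' ≠ 0 → a' ≠ b → β a b = 1 → β a' b = 1 →
      f a * f b * f (a + b) = f a' * f b * f (a' + b) := by
    have key : ∀ a a' b, β a a' ≠ 1 → β a b = 1 → β a' b = 1 →
        f a * f b * f (a + b) = f a' * f b * f (a' + b) := by
      intro a a' b haa hab ha'b
      have h1 := hδ1 a b (a + a') (by rwa [β.add_right, halt, one_mul]) hab
        (by rw [hsymm, β.add_left, hab, ha'b, one_mul])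
      rw [hcancel] at h1
      exact h1.symm
    intro a a' b ha hab ha' hab' hβ hβ'
    by_cases haa : β a a' = 1
    · obtain ⟨c, hc, hc', hbc⟩ := H.exists_separating_pair ha hab ha' hab'
      rw [key a c b hc hβ (by rwa [hsymm]), key a' c b hc' hβ' (by rwa [hsymm])]
    · exact key a a' b haa hβ hβ'
  -- To replace b by b', use some d commuting with both as the common partner. This works at once if
  -- b and b' do not commute, since then d differs from both; otherwise one passes through an
  -- element that commutes with neither.
  have hδ3 : ∀ a a' b b', a ≠ 0 → b ≠ 0 → a ≠ b → a' ≠ 0 → b' ≠ 0 → a' ≠ b' → β a b = 1 →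
      β a' b' = 1 → f a * f b * f (a + b) = f a' * f b' * f (a' + b') := by
    have key : ∀ a b, f a * f b * f (a + b) = f b * f a * f (b + a) := fun a b => by
      rw [mul_comm (f a), add_comm a]
    have key2 : ∀ a a' b b', a ≠ 0 → b ≠ 0 → a ≠ b → a' ≠ 0 → b' ≠ 0 → a' ≠ b' → β a b = 1 →
        β a' b' = 1 → β b b' ≠ 1 → f a * f b * f (a + b) = f a' * f b' * f (a' + b') := by
      intro a a' b b' ha hb hab ha' hb' hab' hβ hβ' hbb
      obtain ⟨d, hd, hdb, hdb'⟩ := horth b b'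
      have h1 : d ≠ b := fun h => hbb (h ▸ hdb')
      have h2 : d ≠ b' := fun h => hbb (by rw [hsymm]; exact h ▸ hdb)
      rw [hδ2 a d b ha hab hd h1 hβ hdb, hδ2 a' d b' ha' hab' hd h2 hβ' hdb', key d b, key d b']
      exact hδ2 b b' d hb h1.symm hb' h2.symm (by rwa [hsymm]) (by rwa [hsymm])
    intro a a' b b' ha hb hab ha' hb' hab' hβ hβ'
    by_cases hbb : β b b' = 1
    · obtain ⟨c, hc, hc', -⟩ := H.exists_separating_pair (b := b + b') hb
        (fun h => hb' (left_eq_add.mp h)) hb' (fun h => hb (right_eq_add.mp h))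
      have hc0 := hne0 b c hc
      obtain ⟨e, he⟩ := H.exists_ne_one hc0
      obtain ⟨d, hd, hdc, hde⟩ := horth c e
      have hdc' : d ≠ c := fun h => he (h ▸ hde)
      rw [key2 a d b c ha hb hab hd hc0 hdc' hβ hdc hc,
        key2 a' d b' c ha' hb' hab' hd hc0 hdc' hβ' hdc hc']
    · exact key2 a a' b b' ha hb hab ha' hb' hab' hβ hβ' hbb
  obtain ⟨κ, hκ1, hκ⟩ : ∃ κ : A, κ * κ = 1 ∧
      ∀ a b, a ≠ 0 → b ≠ 0 → a ≠ b → β a b = 1 → f (a + b) = f a * f b * κ := by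
    by_cases hex : ∃ a b : V, a ≠ 0 ∧ b ≠ 0 ∧ a ≠ b ∧ β a b = 1
    · obtain ⟨a, b, ha, hb, hab, hβ⟩ := hex
      have e1 := hsq a ha
      have e2 := hsq b hb
      refine ⟨f a * f b * f (a + b), ?_, ?_⟩
      · rw [mul_mul_mul_comm, mul_mul_mul_comm (f a), e1, e2, hsq _ (hadd a b hab),
          mul_one, mul_one]
      · intro a' b' ha' hb' hab' hβ'
        rw [hδ3 a a' b b' ha hb hab ha' hb' hab' hβ hβ', ← mul_assoc, mul_mul_mul_comm, hsq a' ha',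
          hsq b' hb', one_mul, one_mul]
    · exact ⟨1, one_mul 1, fun a b ha hb hab hβ => absurd ⟨a, b, ha, hb, hab, hβ⟩ hex⟩
  classical
  let t : ZMod 2 → A := fun x => if x = 0 then 1 else κ
  have ht0 : t 0 = 1 := if_pos rfl
  have ht1 : t 1 = κ := if_neg (by decide)
  have htadd : ∀ x y, t (x + y) = t x * t y := by
    have h11 : (1 : ZMod 2) + 1 = 0 := by decide
    intro x y
    rcases zmod_two_cases x with rfl | rfl <;> rcases zmod_two_cases y with rfl | rfl <;>
      simp [ht0, ht1, h11, hκ1]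
  have htsq : ∀ x, t x * t x = 1 := fun x => by rw [← htadd, zmod_two_add_self, ht0]
  -- The function q + 1 is additive on noncommuting pairs and off by 1 on commuting ones, so t(q +
  -- 1) absorbs exactly the defect κ.
  let l : V → A := fun a => if a = 0 then 1 else f a * t (q a + 1)
  have hl0 : l 0 = 1 := if_pos rfl
  have hl : ∀ a, a ≠ 0 → l a = f a * t (q a + 1) := fun a ha => if_neg ha
  refine ⟨l, t, fun a c => ?_, htadd, fun a ha => by rw [hl a ha, mul_assoc, htsq, mul_one]⟩
  by_cases ha : a = 0
  · rw [ha, zero_add, hl0, one_mul]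
  by_cases hc : c = 0
  · rw [hc, add_zero, hl0, mul_one]
  by_cases hac : a = c
  · rw [hac, H.two_torsion, hl0, hl c hc, mul_mul_mul_comm, hsq c hc, htsq, one_mul]
  rw [hl a ha, hl c hc, hl _ (hadd a c hac), mul_mul_mul_comm, ← htadd]
  by_cases hβ : β a c = 1
  · rw [hκ a c ha hc hac hβ, H.apply_add hβ, mul_assoc, ← ht1, ← htadd]
    congr 2
    ring
  · rw [hf a c hβ, H.apply_add_of_ne hβ]
    congr 2
    ring

end QuadraticPair

/-! ### Realizations by Weyl families -/

/-- All nonzero elements of a group with a nondegenerate alternating bicharacter. -/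
def fullRootSystem {V : Type u} [AddCommGroup V] [Finite V] [Nontrivial V] {β : Bicharacter V}
    (hβ : β.IsAlternating) (hnd : ∀ a, (∀ c, β a c = 1) → a = 0) : FiniteRootSystem.{u} where
  G := V
  β := β
  alternating := hβ
  nontrivial := fun htop => by
    obtain ⟨a, ha⟩ := exists_ne (0 : V)
    exact ha (hnd a (htop ▸ Set.mem_univ a : a ∈ β.radical))
  R := {a | a ≠ 0}
  disjoint_radical := fun a ha hrad => ha (hnd a hrad)
  generates := by
    rw [eq_top_iff]
    rintro a -
    by_cases ha : a = 0
    · rw [ha]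
      exact zero_mem _
    · exact AddSubgroup.subset_closure ha
  neg_closed := fun a ha => neg_ne_zero.mpr ha
  add_closed := fun a _ c _ hac h => hac (by
    have h1 := β.add_right a a c
    rw [h, β.map_zero_right, hβ, one_mul] at h1
    exact h1.symm)

section

attribute [local instance] LieRing.ofAssociativeRing

theorem mem_sl_iff_trace_eq_zero {ι : Type} [Fintype ι] [DecidableEq ι] (x : Matrix ι ι ℂ) :
    x ∈ LieAlgebra.SpecialLinear.sl ι ℂ ↔ x.trace = 0 := by
  rw [LieAlgebra.SpecialLinear.sl]
  exact Iff.rfl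

theorem exists_negTranspose (ι : Type) [Fintype ι] [DecidableEq ι] :
    ∃ τ : LieAlgebra.SpecialLinear.sl ι ℂ ≃ₗ[ℂ] LieAlgebra.SpecialLinear.sl ι ℂ,
      ∀ x, (τ x : Matrix ι ι ℂ) = -(x : Matrix ι ι ℂ)ᵀ := by
  have hmem : ∀ x : LieAlgebra.SpecialLinear.sl ι ℂ,
      -(x : Matrix ι ι ℂ)ᵀ ∈ LieAlgebra.SpecialLinear.sl ι ℂ := fun x => by
    rw [mem_sl_iff_trace_eq_zero, Matrix.trace_neg, Matrix.trace_transpose,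
      (mem_sl_iff_trace_eq_zero _).mp x.2, neg_zero]
  have hinv : Function.Involutive (fun x : LieAlgebra.SpecialLinear.sl ι ℂ =>
      (⟨-(x : Matrix ι ι ℂ)ᵀ, hmem x⟩ : LieAlgebra.SpecialLinear.sl ι ℂ)) := fun x => by
    ext : 1
    simp
  refine ⟨LinearEquiv.ofInvolutive
    { toFun := fun x => ⟨-(x : Matrix ι ι ℂ)ᵀ, hmem x⟩
      map_add' := fun x y => ?_
      map_smul' := fun r x => ?_ } hinv, fun x => rfl⟩
  · ext : 1
    change -((x : Matrix ι ι ℂ) + (y : Matrix ι ι ℂ))ᵀ = -(x : Matrix ι ι ℂ)ᵀ + -(y : Matrix ι ι ℂ)ᵀ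
    rw [Matrix.transpose_add, neg_add]
  · ext : 1
    change -(r • (x : Matrix ι ι ℂ))ᵀ = r • -(x : Matrix ι ι ℂ)ᵀ
    rw [Matrix.transpose_smul, smul_neg]

end

namespace WeylFamily

attribute [local instance] LieRing.ofAssociativeRing

variable {V : Type} [AddCommGroup V] {ι : Type} [Fintype ι] [DecidableEq ι]
  {γ β : Bicharacter V} {v : V → Matrix ι ι ℂ} (H : WeylFamily γ β v)

include H

/-- Transposition reverses products, so transposing v_a v_c exchanges the factors, at the cost of
β(a,c). Hence the sign of a + c is the product of the signs of a and c with β(a,c). -/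
theorem quadraticPair {q : V → ZMod 2} (h2 : ∀ a : V, a + a = 0)
    (hq : ∀ a, (v a)ᵀ = (signChar (q a) : ℂ) • v a) : QuadraticPair β q where
  two_torsion := h2
  nondegenerate := H.nondegenerate
  polar a c := by
    have h1 := congrArg Matrix.transpose (H.mul_swap a c)
    have hsq : β a c * β a c = 1 := by
      rw [← β.add_left, h2, β.map_zero_left]
    have h3 : (v (a + c))ᵀ = ((signChar (q a) * signChar (q c) * β a c : ℂˣ) : ℂ) • v (a + c) := by
      have h4 := congrArg Matrix.transpose (H.mul a c)
      rw [Matrix.transpose_mul, Matrix.transpose_smul, hq, hq, smul_mul_smul_comm,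
        H.mul_swap c a, H.mul, H.alternating.swap a c, smul_smul, smul_smul] at h4
      have h5 := congrArg (fun M => ((γ a c)⁻¹ : ℂˣ) • M) h4
      simp only [Units.smul_def, smul_smul] at h5
      rw [← Units.val_mul (γ a c)⁻¹ (γ a c), inv_mul_cancel, Units.val_one, one_smul] at h5
      rw [← h5]
      congr 1
      rw [inv_eq_of_mul_eq_one_left hsq]
      simp only [← Units.val_mul]
      congr 1
      rw [mul_comm (γ a c)⁻¹, mul_assoc _ (γ a c), mul_inv_cancel, mul_one,
        mul_comm (signChar (q c))]
    rw [hq] at h3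
    have h6 : (signChar (q (a + c)) : ℂ) =
        ((signChar (q a) * signChar (q c) * β a c : ℂˣ) : ℂ) := by
      have h7 := sub_eq_zero.mpr h3
      rw [← sub_smul] at h7
      rw [← sub_eq_zero]
      refine (smul_eq_zero.mp h7).resolve_right fun h0 => ?_
      have := H.isUnit (a + c)
      rw [h0] at this
      have := H.nonempty
      exact not_isUnit_zero ‹_›
    rw [signChar_add, signChar_add, Units.ext h6]
    calc β a c = (signChar (q a) * signChar (q a)) * (signChar (q c) * signChar (q c)) * β a c := by
          rw [signChar_mul_self, signChar_mul_self, one_mul, one_mul]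
      _ = _ := by simp only [mul_assoc, mul_left_comm]

variable [Finite V]

theorem mem_sl_iff (x : Matrix ι ι ℂ) :
    x ∈ LieAlgebra.SpecialLinear.sl ι ℂ ↔ ∀ a ∉ {a : V | a ≠ 0}, H.basis.repr x a = 0 := by
  rw [mem_sl_iff_trace_eq_zero, H.trace_eq]
  constructor
  · intro h a ha
    have ha : a = 0 := by simpa using ha
    rw [ha]
    exact (mul_eq_zero.mp h).resolve_right H.trace_zero
  · intro h
    rw [h 0 (by simp), zero_mul]

theorem isInnerRealization_sl [Nontrivial V] {A : Set (Matrix ι ι ℂ)} (hA : H.Spans A) :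
    IsInnerRealization (adGroup (LieAlgebra.SpecialLinear.sl ι ℂ) A)
      (fullRootSystem H.alternating H.nondegenerate) :=
  ⟨H.realizes_adGroup (S := fullRootSystem H.alternating H.nondegenerate) (AddMonoidHom.id V) id
    (fun _ _ => rfl) (fun _ => rfl) (fun _ => rfl) (Set.image_id _).symm H.mem_sl_iff hA,
    H.nondegenerate, fun _ _ _ hn => hn⟩

theorem repr_neg_transpose {q : V → ZMod 2}
    (hq : ∀ a, (v a)ᵀ = (signChar (q a) : ℂ) • v a) (x : Matrix ι ι ℂ) (a : V) :
    H.basis.repr (-xᵀ) a = signChar (q a + 1) * H.basis.repr x a := by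
  refine H.repr_eq_of_basis (f := -(Matrix.transposeLinearEquiv ι ι ℂ ℂ : _ →ₗ[ℂ] _))
    (r := fun a => (signChar (q a + 1) : ℂ)) (fun a => ?_) x a
  change -(v a)ᵀ = _
  rw [hq, signChar_add, signChar_one, ← neg_smul]
  simp

/-! ### Subalgebras and automorphisms defined by transposition -/

section Transpose

variable {q : V → ZMod 2} (h2 : ∀ a : V, a + a = 0)
  (hq : ∀ a, (v a)ᵀ = (signChar (q a) : ℂ) • v a)

include h2 hq

/-- L is the kernel of x ↦ v_j⁻¹(xᵗ v_j + v_j x), which is diagonal: v_a has eigenvalue 1 plus the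
sign of q(j) + q(j + a), that is, 0 or 2. -/
theorem mem_iff_of_skew {j : V} {L : LieSubalgebra ℂ (Matrix ι ι ℂ)}
    (hL : ∀ x, x ∈ L ↔ xᵀ * v j = -(v j * x)) (x : Matrix ι ι ℂ) :
    x ∈ L ↔ ∀ a ∉ {a : V | q j + q (j + a) = 1}, H.basis.repr x a = 0 := by
  have hQ := H.quadraticPair h2 hq
  have hj : IsUnit (v j).det := (Matrix.isUnit_iff_isUnit_det _).mp (H.isUnit j)
  let f : Matrix ι ι ℂ →ₗ[ℂ] Matrix ι ι ℂ := LinearMap.mulLeft ℂ (v j)⁻¹ ∘ₗ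
    (LinearMap.mulRight ℂ (v j) ∘ₗ (Matrix.transposeLinearEquiv ι ι ℂ ℂ : _ →ₗ[ℂ] _) +
      LinearMap.mulLeft ℂ (v j))
  have hf : ∀ x, f x = (v j)⁻¹ * (xᵀ * v j + v j * x) := fun _ => rfl
  have hfv : ∀ a, f (v a) = ((signChar (q j + q (j + a)) : ℂ) + 1) • v a := by
    intro a
    have h1 : signChar (q a) * β a j = signChar (q j + q (j + a)) := by
      rw [hQ.polar, ← signChar_add, add_comm a j]
      congr 1
      linear_combination zmod_two_add_self (q a)
    rw [hf, hq, smul_mul_assoc, H.mul_swap a j, smul_smul, ← Units.val_mul, h1, mul_add,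
      mul_smul_comm, ← mul_assoc, Matrix.nonsing_inv_mul _ hj, one_mul, add_smul, one_smul]
  have hx : x ∈ L ↔ f x = 0 := by
    rw [hL, hf, eq_neg_iff_add_eq_zero]
    refine ⟨fun h => by rw [h, mul_zero], fun h => ?_⟩
    have := congrArg (fun M => v j * M) h
    simpa only [← mul_assoc, Matrix.mul_nonsing_inv _ hj, one_mul, mul_zero] using this
  rw [hx, H.basis.ext_elem_iff]
  refine forall_congr' fun a => ?_
  rw [H.repr_eq_of_basis hfv, map_zero, Finsupp.zero_apply]
  rcases zmod_two_cases (q j + q (j + a)) with h | h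
  · simp only [Set.mem_ofPred_eq, h, signChar_zero, Units.val_one, mul_eq_zero]
    norm_num
  · simp [h, signChar_one]

theorem exists_isInnerRealization_of_skew [Nontrivial V] {j : V}
    {L : LieSubalgebra ℂ (Matrix ι ι ℂ)} (hL : ∀ x, x ∈ L ↔ xᵀ * v j = -(v j * x))
    (hgen : AddSubgroup.closure {a | q j + q (j + a) = 1} = ⊤)
    {A : Set (Matrix ι ι ℂ)} (hA : H.Spans A) :
    ∃ S : FiniteRootSystem.{0}, IsInnerRealization (adGroup L A) S ∧ ∀ a : S.G, a + a = 0 :=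
  ⟨((H.quadraticPair h2 hq).translate j).rootSystem hgen,
    ⟨H.realizes_adGroup (S := ((H.quadraticPair h2 hq).translate j).rootSystem hgen)
      (AddMonoidHom.id V) id (fun _ _ => rfl) (fun _ => rfl) (fun _ => rfl) (Set.image_id _).symm
      (H.mem_iff_of_skew h2 hq hL) hA,
      H.nondegenerate, nsmul_mem_of_two_torsion h2⟩, h2⟩

/-- The map x ↦ -xᵗ scales v_a by the sign of q(a) + 1, so recording q(a) + 1 as a second degree
adjoins it to T. A character of V × ℤ/2 is some β(c,·), possibly times the sign of the second
coordinate: conjugation by v_c, possibly composed with negative transposition. Universality is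
`exists_eq_mul_of_mul`. -/
theorem isOuterRealization_sl [Nontrivial V] {A : Set (Matrix ι ι ℂ)} (hA : H.Spans A)
    (horth : ∀ b b' : V, ∃ a, a ≠ 0 ∧ β a b = 1 ∧ β a b' = 1) :
    IsOuterRealization (adGroup (LieAlgebra.SpecialLinear.sl ι ℂ) A ⊔
      negTransposeGroup (LieAlgebra.SpecialLinear.sl ι ℂ))
      ((H.quadraticPair h2 hq).outerRootSystem horth) := by
  have hQ := H.quadraticPair h2 hq
  have hs : ∀ a c, β a c ≠ 1 → ((a, q a + 1) : V × ZMod 2) + (c, q c + 1) =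
      (a + c, q (a + c) + 1) := fun a c hβ => by
    rw [hQ.apply_add_of_ne hβ, Prod.mk_add_mk]
    congr 1
    ring
  refine ⟨?_, fun μ hμ => ?_⟩
  · obtain ⟨Φ, hinj, hrange, hΦ⟩ := H.exists_realization
      (S := (H.quadraticPair h2 hq).outerRootSystem horth) (AddMonoidHom.fst V (ZMod 2))
      (fun a => (a, q a + 1)) (fun _ _ => rfl) (fun _ => rfl) hs rfl H.mem_sl_iff
    refine ⟨Φ, hinj, hrange, le_antisymm (sup_le ?_ ?_) ?_⟩
    · intro σ hσ
      obtain ⟨c, hc⟩ := (H.mem_adGroup hA).mp hσ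
      exact ⟨MonoidHom.mk' (fun d : Multiplicative (V × ZMod 2) => β c d.toAdd.1)
        fun d e => β.add_right c _ _, (hΦ _ _).mpr hc⟩
    · refine (Subgroup.closure_le _).mpr fun τ hτ => ?_
      refine ⟨MonoidHom.mk' (fun d : Multiplicative (V × ZMod 2) => signChar d.toAdd.2)
        fun d e => signChar_add _ _, (hΦ _ _).mpr fun x a => ?_⟩
      rw [hτ x, H.repr_neg_transpose hq]
      rfl
    · rintro σ ⟨χ, hχ⟩
      change Multiplicative (V × ZMod 2) →* ℂˣ at χ
      have hχ' : ∀ (x : LieAlgebra.SpecialLinear.sl ι ℂ) (a : V),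
          H.basis.repr (σ x : Matrix ι ι ℂ) a =
            (χ (.ofAdd (a, q a + 1)) : ℂ) * H.basis.repr (x : Matrix ι ι ℂ) a := (hΦ _ _).mp hχ
      have hχs : ∀ a, χ (.ofAdd (a, q a + 1)) =
          χ (.ofAdd (a, 0)) * χ (.ofAdd (0, q a + 1)) := fun a => by
        rw [← map_mul, ← ofAdd_add, Prod.mk_add_mk, add_zero, zero_add]
      obtain ⟨c, hc⟩ := Bicharacter.exists_eq_of_nondegenerate H.nondegenerate
        (MonoidHom.mk' (fun a : Multiplicative V => χ (.ofAdd (a.toAdd, 0))) fun d e => by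
          rw [← map_mul, ← ofAdd_add, Prod.mk_add_mk, add_zero, toAdd_mul])
      have hc : ∀ a, χ (.ofAdd (a, 0)) = β c a := hc
      have hsq : χ (.ofAdd (0, 1)) * χ (.ofAdd (0, 1)) = 1 := by
        rw [← map_mul, ← ofAdd_add, Prod.mk_add_mk, add_zero, zmod_two_add_self]
        exact map_one χ
      have h00 : χ (.ofAdd (0, 0)) = 1 := map_one χ
      obtain ⟨τ, hτ⟩ := exists_negTranspose ι
      have hτmem : τ ∈ negTransposeGroup (LieAlgebra.SpecialLinear.sl ι ℂ) :=
        Subgroup.subset_closure hτ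
      have hsign : χ (.ofAdd (0, 1)) = 1 ∨ χ (.ofAdd (0, 1)) = -1 := by
        have := congrArg Units.val hsq
        rw [Units.val_mul, Units.val_one, mul_self_eq_one_iff] at this
        exact this.imp (fun h => Units.ext h) fun h => Units.ext h
      rcases hsign with h1 | h1
      · refine Subgroup.mem_sup_left ((H.mem_adGroup hA).mpr ⟨c, fun x a => ?_⟩)
        have h3 : χ (.ofAdd (0, q a + 1)) = 1 := by
          rcases zmod_two_cases (q a + 1) with h | h <;> rw [h]
          · exact h00
          · exact h1
        rw [hχ', hχs, hc, h3, mul_one]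
      · have h3 : ∀ x, χ (.ofAdd (0, x)) = signChar x := fun x => by
          rcases zmod_two_cases x with h | h <;> rw [h]
          · rw [h00, signChar_zero]
          · rw [h1, signChar_one]
        have hστ : σ * τ ∈ adGroup (LieAlgebra.SpecialLinear.sl ι ℂ) A := by
          refine (H.mem_adGroup hA).mpr ⟨c, fun x a => ?_⟩
          rw [LinearEquiv.mul_apply, hχ', hτ, H.repr_neg_transpose hq, hχs, hc, h3, ← mul_assoc,
            ← Units.val_mul, mul_assoc, signChar_mul_self, mul_one]
        rw [← mul_inv_cancel_right σ τ]
        exact mul_mem (Subgroup.mem_sup_left hστ) (Subgroup.mem_sup_right (inv_mem hτmem))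
  · change V × ZMod 2 → ℂˣ at μ
    by_cases hmul : ∀ a c, β a c ≠ 1 → μ (a + c, q (a + c) + 1) =
        μ (a, q a + 1) * μ (c, q c + 1)
    · obtain ⟨l, t, hl, ht, hf⟩ := hQ.exists_eq_mul_of_mul horth
        (f := fun a => μ (a, q a + 1)) hmul
      have hlt : ∀ d e : Multiplicative (V × ZMod 2), l (d * e).toAdd.1 * t (d * e).toAdd.2 =
          l d.toAdd.1 * t d.toAdd.2 * (l e.toAdd.1 * t e.toAdd.2) := fun d e => by
        rw [toAdd_mul, Prod.fst_add, Prod.snd_add, hl, ht, mul_mul_mul_comm]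
      refine ⟨MonoidHom.mk' (fun d : Multiplicative (V × ZMod 2) => l d.toAdd.1 * t d.toAdd.2)
        hlt, ?_⟩
      rintro _ ⟨a, ha, rfl⟩
      exact (hf a ha).symm
    · refine absurd (fun a c hβ => ?_) hmul
      rw [← hs a c hβ]
      refine hμ _ ⟨a, fun h => hβ ?_, rfl⟩ _ ⟨c, fun h => hβ ?_, rfl⟩ hβ
      · rw [h, β.map_zero_left]
      · rw [h, β.map_zero_right]

end Transpose

end WeylFamily

/-! ### Generalized Pauli matrices -/

/-- `e` is the character of `ℤ/n` with `e(1) = ε`, and it is faithful. -/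
structure IsFaithfulChar {n : ℕ} (ε : ℂ) (e : ZMod n → ℂˣ) : Prop where
  map_add : ∀ x y, e (x + y) = e x * e y
  map_one : (e 1 : ℂ) = ε
  eq_zero : ∀ x, e x = 1 → x = 0

theorem isFaithfulChar_signChar : IsFaithfulChar (-1) signChar where
  map_add := signChar_add
  map_one := by rw [signChar_one]; simp
  eq_zero _ := signChar_eq_one_iff.mp

theorem exists_isFaithfulChar {n : ℕ} [NeZero n] {ε : ℂ} (hε : IsPrimitiveRoot ε n) :
    ∃ e : ZMod n → ℂˣ, IsFaithfulChar ε e := by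
  obtain ⟨ζ, rfl⟩ := hε.isUnit (NeZero.ne n)
  have hζ : IsPrimitiveRoot ζ n := IsPrimitiveRoot.coe_units_iff.mp hε
  have hcast : ∀ m : ℕ, ζ ^ (m : ZMod n).val = ζ ^ m := fun m => by
    rw [ZMod.val_natCast, ← pow_eq_pow_mod m hζ.pow_eq_one]
  refine ⟨fun x => ζ ^ x.val, fun x y => ?_, ?_, fun x hx => ?_⟩
  · rw [← pow_add, ← hcast (x.val + y.val), Nat.cast_add, ZMod.natCast_zmod_val,
      ZMod.natCast_zmod_val]
  · have := hcast 1
    rw [Nat.cast_one, pow_one] at this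
    rw [this]
  · exact (ZMod.val_eq_zero x).mp (Nat.eq_zero_of_dvd_of_lt (hζ.dvd_of_pow_eq_one _ hx)
      (ZMod.val_lt x))

namespace IsFaithfulChar

variable {n : ℕ} {ε : ℂ} {e : ZMod n → ℂˣ} (he : IsFaithfulChar ε e)

include he

theorem map_zero : e 0 = 1 := by
  have h := he.map_add 0 0
  rw [add_zero] at h
  exact left_eq_mul.mp h

theorem map_neg (x : ZMod n) : e (-x) = (e x)⁻¹ := by
  rw [eq_inv_iff_mul_eq_one, ← he.map_add, neg_add_cancel, he.map_zero]

theorem coe_natCast (m : ℕ) : (e m : ℂ) = ε ^ m := by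
  induction m with
  | zero => rw [Nat.cast_zero, he.map_zero, pow_zero, Units.val_one]
  | succ m ih => rw [Nat.cast_succ, he.map_add, Units.val_mul, ih, he.map_one, pow_succ]

end IsFaithfulChar

theorem fin_natCast_zmod_injective {n : ℕ} {p q : Fin n} (h : ((p : ℕ) : ZMod n) = (q : ℕ)) :
    p = q := by
  rw [ZMod.natCast_eq_natCast_iff', Nat.mod_eq_of_lt p.2, Nat.mod_eq_of_lt q.2] at h
  exact Fin.ext h

theorem fin_natCast_zmod_surjective {n : ℕ} [NeZero n] (x : ZMod n) :
    ∃ p : Fin n, ((p : ℕ) : ZMod n) = x :=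
  ⟨⟨x.val, ZMod.val_lt x⟩, ZMod.natCast_zmod_val x⟩

/-- The matrix `X_n^i Y_n^j`, for `(i, j) = a`. -/
def weylMatrix {n : ℕ} (e : ZMod n → ℂˣ) (a : ZMod n × ZMod n) : Matrix (Fin n) (Fin n) ℂ :=
  Matrix.of fun p q => if ((q : ℕ) : ZMod n) = (p : ℕ) + a.2 then
    (e (a.1 * (-1 - (p : ℕ))) : ℂ) else 0

theorem weylMatrix_apply {n : ℕ} (e : ZMod n → ℂˣ) (a : ZMod n × ZMod n) (p q : Fin n) :
    weylMatrix e a p q =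
      if ((q : ℕ) : ZMod n) = (p : ℕ) + a.2 then (e (a.1 * (-1 - (p : ℕ))) : ℂ) else 0 := rfl

section Weyl

variable {n : ℕ} {ε : ℂ} {e : ZMod n → ℂˣ} (he : IsFaithfulChar ε e)

include he

theorem weylMatrix_zero : weylMatrix e 0 = 1 := by
  ext p q
  rw [weylMatrix_apply, Matrix.one_apply, Prod.fst_zero, Prod.snd_zero, zero_mul, add_zero,
    he.map_zero, Units.val_one]
  exact if_congr ⟨fun h => (fin_natCast_zmod_injective h).symm, fun h => by rw [h]⟩ rfl rfl

theorem weylMatrix_eq_pauliX : weylMatrix e (1, 0) = pauliX n ε := by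
  ext p q
  rw [weylMatrix_apply, pauliX, Matrix.diagonal_apply, one_mul, add_zero]
  -- The exponents of X_n decrease from n - 1 to 0, which modulo n is the shift -1 - p in
  -- `weylMatrix`.
  have h1 : ((n - 1 - (p : ℕ) : ℕ) : ZMod n) = -1 - (p : ℕ) := by
    have hp := p.2
    rw [Nat.cast_sub (by omega), Nat.cast_sub (by omega), ZMod.natCast_self, Nat.cast_one, zero_sub]
  rw [← h1, he.coe_natCast]
  exact if_congr ⟨fun h => (fin_natCast_zmod_injective h).symm, fun h => by rw [h]⟩ rfl rfl

theorem weylMatrix_eq_pauliY : weylMatrix e (0, 1) = pauliY n := by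
  ext p q
  rw [weylMatrix_apply, pauliY, Matrix.of_apply, zero_mul, he.map_zero, Units.val_one]
  refine if_congr ?_ rfl rfl
  rw [← Nat.cast_succ, ZMod.natCast_eq_natCast_iff', Nat.mod_eq_of_lt q.2]

variable [NeZero n]

theorem weylMatrix_mul (a c : ZMod n × ZMod n) :
    weylMatrix e a * weylMatrix e c = (e (-(a.2 * c.1)) : ℂ) • weylMatrix e (a + c) := by
  ext p q
  obtain ⟨r, hr⟩ := fin_natCast_zmod_surjective (((p : ℕ) : ZMod n) + a.2)
  rw [Matrix.mul_apply, Finset.sum_eq_single r, Matrix.smul_apply]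
  · simp only [weylMatrix_apply, hr, if_true, smul_eq_mul, Prod.fst_add, Prod.snd_add]
    rw [add_assoc]
    split_ifs
    · rw [← Units.val_mul, ← Units.val_mul, ← he.map_add, ← he.map_add]
      congr 2
      ring
    · rw [mul_zero, mul_zero]
  · intro s _ hs
    rw [weylMatrix_apply, if_neg, zero_mul]
    intro h
    exact hs (fin_natCast_zmod_injective (h.trans hr.symm))
  · simp

theorem exists_unit_weylMatrix (a : ZMod n × ZMod n) :
    ∃ g : GL (Fin n) ℂ, (g : Matrix (Fin n) (Fin n) ℂ) = weylMatrix e a := by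
  refine ⟨Units.mkOfMulEqOne (weylMatrix e a) ((e (a.2 * -a.1) : ℂ) • weylMatrix e (-a)) ?_, rfl⟩
  rw [mul_smul_comm, weylMatrix_mul he, smul_smul, ← Units.val_mul, ← he.map_add, Prod.fst_neg,
    add_neg_cancel, add_neg_cancel, he.map_zero, Units.val_one, one_smul, weylMatrix_zero he]

theorem exists_mem_pauliGroup (a : ZMod n × ZMod n) :
    ∃ g ∈ pauliGroup n ε, (g : Matrix (Fin n) (Fin n) ℂ) = weylMatrix e a := by
  obtain ⟨X, hX⟩ := exists_unit_weylMatrix he (1, 0)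
  obtain ⟨Y, hY⟩ := exists_unit_weylMatrix he (0, 1)
  have hXmem : X ∈ pauliGroup n ε :=
    Subgroup.subset_closure (Or.inl (hX.trans (weylMatrix_eq_pauliX he)))
  have hYmem : Y ∈ pauliGroup n ε :=
    Subgroup.subset_closure (Or.inr (hY.trans (weylMatrix_eq_pauliY he)))
  have hXpow : ∀ m : ℕ, ((X ^ m : GL (Fin n) ℂ) : Matrix (Fin n) (Fin n) ℂ) =
      weylMatrix e ((m : ZMod n), 0) := by
    intro m
    induction m with
    | zero => rw [pow_zero, Units.val_one, Nat.cast_zero]; exact (weylMatrix_zero he).symm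
    | succ m ih =>
      rw [pow_succ, Units.val_mul, ih, hX, weylMatrix_mul he, zero_mul, neg_zero, he.map_zero,
        Units.val_one, one_smul, Prod.mk_add_mk, add_zero, Nat.cast_succ]
  have hYpow : ∀ m : ℕ, ((Y ^ m : GL (Fin n) ℂ) : Matrix (Fin n) (Fin n) ℂ) =
      weylMatrix e (0, (m : ZMod n)) := by
    intro m
    induction m with
    | zero => rw [pow_zero, Units.val_one, Nat.cast_zero]; exact (weylMatrix_zero he).symm
    | succ m ih =>
      rw [pow_succ, Units.val_mul, ih, hY, weylMatrix_mul he, mul_zero, neg_zero, he.map_zero,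
        Units.val_one, one_smul, Prod.mk_add_mk, add_zero, Nat.cast_succ]
  refine ⟨X ^ a.1.val * Y ^ a.2.val, mul_mem (pow_mem hXmem _) (pow_mem hYmem _), ?_⟩
  rw [Units.val_mul, hXpow, hYpow, weylMatrix_mul he, zero_mul, neg_zero, he.map_zero,
    Units.val_one, one_smul, Prod.mk_add_mk, add_zero, zero_add, ZMod.natCast_zmod_val,
    ZMod.natCast_zmod_val]

/-- By `weylMatrix_mul` the nonzero multiples of the monomials X^i Y^j are closed under products and
inverses. The scalars are harmless, as only conjugations matter later. -/
theorem exists_eq_smul_of_mem_pauliGroup {g : GL (Fin n) ℂ} (hg : g ∈ pauliGroup n ε) :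
    ∃ (r : ℂˣ) (a : ZMod n × ZMod n),
      (g : Matrix (Fin n) (Fin n) ℂ) = (r : ℂ) • weylMatrix e a := by
  induction hg using Subgroup.closure_induction with
  | mem g hg =>
    rcases hg with hg | hg
    · exact ⟨1, (1, 0), by rw [hg, weylMatrix_eq_pauliX he, Units.val_one, one_smul]⟩
    · exact ⟨1, (0, 1), by rw [hg, weylMatrix_eq_pauliY he, Units.val_one, one_smul]⟩
  | one => exact ⟨1, 0, by rw [weylMatrix_zero he, Units.val_one, Units.val_one, one_smul]⟩
  | mul g h _ _ hg hh =>
    obtain ⟨r, a, hg⟩ := hg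
    obtain ⟨s, c, hh⟩ := hh
    refine ⟨r * s * e (-(a.2 * c.1)), a + c, ?_⟩
    rw [Units.val_mul, hg, hh, smul_mul_smul_comm, weylMatrix_mul he, smul_smul, Units.val_mul,
      Units.val_mul]
  | inv g _ hg =>
    obtain ⟨r, a, hg⟩ := hg
    refine ⟨r⁻¹ * e (a.2 * -a.1), -a, ?_⟩
    have h1 : (g : Matrix (Fin n) (Fin n) ℂ) *
        (((r⁻¹ * e (a.2 * -a.1) : ℂˣ) : ℂ) • weylMatrix e (-a)) = 1 := by
      rw [hg, smul_mul_smul_comm, weylMatrix_mul he, smul_smul, ← Units.val_mul, ← Units.val_mul,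
        ← mul_assoc, mul_inv_cancel, one_mul, ← he.map_add, Prod.fst_neg, add_neg_cancel,
        add_neg_cancel, he.map_zero, Units.val_one, one_smul, weylMatrix_zero he]
    rw [← mul_one ((g⁻¹ : GL (Fin n) ℂ) : Matrix (Fin n) (Fin n) ℂ), ← h1, ← mul_assoc,
      ← Units.val_mul, inv_mul_cancel, Units.val_one, one_mul]

end Weyl

/-! ### Kronecker products -/

section Kronecker

variable {k : ℕ} {n : Fin k → ℕ}

theorem kroneckerProd_apply (A : ∀ i, Matrix (Fin (n i)) (Fin (n i)) ℂ) (p q : ∀ i, Fin (n i)) :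
    kroneckerProd A p q = ∏ i, A i (p i) (q i) := rfl

theorem kroneckerProd_mul (A B : ∀ i, Matrix (Fin (n i)) (Fin (n i)) ℂ) :
    kroneckerProd A * kroneckerProd B = kroneckerProd fun i => A i * B i := by
  ext p q
  simp only [kroneckerProd_apply, Matrix.mul_apply, Finset.prod_univ_sum, Fintype.piFinset_univ,
    ← Finset.prod_mul_distrib]

theorem kroneckerProd_one :
    kroneckerProd (fun i => (1 : Matrix (Fin (n i)) (Fin (n i)) ℂ)) = 1 := by
  ext p q
  rw [kroneckerProd_apply, Matrix.one_apply]
  by_cases h : p = q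
  · rw [if_pos h, h]
    exact Finset.prod_eq_one fun i _ => Matrix.one_apply_eq _
  · rw [if_neg h]
    obtain ⟨i, hi⟩ := Function.ne_iff.mp h
    exact Finset.prod_eq_zero (Finset.mem_univ i) (Matrix.one_apply_ne hi)

theorem kroneckerProd_smul (r : Fin k → ℂ) (A : ∀ i, Matrix (Fin (n i)) (Fin (n i)) ℂ) :
    (kroneckerProd fun i => r i • A i) = (∏ i, r i) • kroneckerProd A := by
  ext p q
  rw [kroneckerProd_apply, Matrix.smul_apply, kroneckerProd_apply, smul_eq_mul,
    ← Finset.prod_mul_distrib]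
  rfl

theorem kroneckerProd_transpose (A : ∀ i, Matrix (Fin (n i)) (Fin (n i)) ℂ) :
    (kroneckerProd A)ᵀ = kroneckerProd fun i => (A i)ᵀ := rfl

/-- The group of the exponents of the products of generalized Pauli matrices. -/
abbrev PauliIndex (n : Fin k → ℕ) : Type := ∀ i, ZMod (n i) × ZMod (n i)

/-- The bicharacter `γ` with `v_a v_c = γ(a,c) v_{a+c}`. -/
def pauliCocycle {ε : Fin k → ℂ} {e : ∀ i, ZMod (n i) → ℂˣ} (he : ∀ i, IsFaithfulChar (ε i) (e i)) :
    Bicharacter (PauliIndex n) where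
  toFun a c := ∏ i, e i (-((a i).2 * (c i).1))
  add_left a b c := by
    rw [← Finset.prod_mul_distrib]
    refine Finset.prod_congr rfl fun i _ => ?_
    rw [← (he i).map_add, Pi.add_apply, Prod.snd_add]
    congr 1
    ring
  add_right a b c := by
    rw [← Finset.prod_mul_distrib]
    refine Finset.prod_congr rfl fun i _ => ?_
    rw [← (he i).map_add, Pi.add_apply, Prod.fst_add]
    congr 1
    ring

/-- The alternating bicharacter `β` with `v_a v_c = β(a,c) v_c v_a`. -/
def pauliBicharacter {ε : Fin k → ℂ} {e : ∀ i, ZMod (n i) → ℂˣ}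
    (he : ∀ i, IsFaithfulChar (ε i) (e i)) : Bicharacter (PauliIndex n) where
  toFun a c := ∏ i, e i ((a i).1 * (c i).2 - (a i).2 * (c i).1)
  add_left a b c := by
    rw [← Finset.prod_mul_distrib]
    refine Finset.prod_congr rfl fun i _ => ?_
    rw [← (he i).map_add, Pi.add_apply, Prod.fst_add, Prod.snd_add]
    congr 1
    ring
  add_right a b c := by
    rw [← Finset.prod_mul_distrib]
    refine Finset.prod_congr rfl fun i _ => ?_
    rw [← (he i).map_add, Pi.add_apply, Prod.fst_add, Prod.snd_add]
    congr 1
    ring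

variable {ε : Fin k → ℂ} {e : ∀ i, ZMod (n i) → ℂˣ} (he : ∀ i, IsFaithfulChar (ε i) (e i))

theorem pauliCocycle_apply (a c : PauliIndex n) :
    pauliCocycle he a c = ∏ i, e i (-((a i).2 * (c i).1)) := rfl

theorem pauliBicharacter_apply (a c : PauliIndex n) :
    pauliBicharacter he a c = ∏ i, e i ((a i).1 * (c i).2 - (a i).2 * (c i).1) := rfl

theorem pauliBicharacter_single (a : PauliIndex n) (i : Fin k) (x : ZMod (n i) × ZMod (n i)) :
    pauliBicharacter he a (Pi.single i x) = e i ((a i).1 * x.2 - (a i).2 * x.1) := by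
  rw [pauliBicharacter_apply, Finset.prod_eq_single i]
  · rw [Pi.single_eq_same]
  · intro j _ hj
    rw [Pi.single_eq_of_ne hj, Prod.fst_zero, Prod.snd_zero, mul_zero, mul_zero, sub_zero,
      (he j).map_zero]
  · simp

/-- The products of generalized Pauli matrices. -/
def pauliProduct (e : ∀ i, ZMod (n i) → ℂˣ) (a : PauliIndex n) :
    Matrix (∀ i, Fin (n i)) (∀ i, Fin (n i)) ℂ :=
  kroneckerProd fun i => weylMatrix (e i) (a i)

include he

theorem weylFamily_pauliProduct [∀ i, NeZero (n i)] :
    WeylFamily (pauliCocycle he) (pauliBicharacter he) (pauliProduct e) where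
  lift a c := by
    rw [pauliBicharacter_apply, pauliCocycle_apply, pauliCocycle_apply, ← Finset.prod_inv_distrib,
      ← Finset.prod_mul_distrib]
    refine Finset.prod_congr rfl fun i _ => ?_
    rw [← (he i).map_neg, ← (he i).map_add]
    congr 1
    ring
  -- Pairing with the two generators of the i-th factor isolates the coordinates of a there, and e_i
  -- is faithful.
  nondegenerate a ha := by
    funext i
    refine Prod.ext ?_ ?_
    · refine (he i).eq_zero _ ?_
      have := ha (Pi.single i (0, 1))
      rwa [pauliBicharacter_single, mul_one, mul_zero, sub_zero] at this
    · refine (he i).eq_zero _ ?_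
      have := ha (Pi.single i (1, 0))
      rwa [pauliBicharacter_single, mul_one, mul_zero, zero_sub, (he i).map_neg, inv_eq_one] at this
  apply_zero := by
    rw [pauliProduct, ← kroneckerProd_one]
    congr 1
    funext i
    exact weylMatrix_zero (he i)
  mul a c := by
    rw [pauliProduct, pauliProduct, kroneckerProd_mul, pauliProduct, pauliCocycle_apply]
    have h1 : ((∏ i, e i (-((a i).2 * (c i).1)) : ℂˣ) : ℂ) =
        ∏ i, (e i (-((a i).2 * (c i).1)) : ℂ) :=
      map_prod (Units.coeHom ℂ) _ _
    rw [h1, ← kroneckerProd_smul]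
    congr 1
    funext i
    exact weylMatrix_mul (he i) _ _
  card := by
    rw [Nat.card_pi, Fintype.card_pi, ← Finset.prod_pow]
    refine Finset.prod_congr rfl fun i _ => ?_
    rw [Nat.card_prod, Nat.card_zmod, Fintype.card_fin, pow_two]
  nonempty := ⟨fun i => ⟨0, NeZero.pos (n i)⟩⟩

theorem spans_pauliTensor [∀ i, NeZero (n i)] :
    (weylFamily_pauliProduct he).Spans (pauliTensor n ε) := by
  constructor
  · rintro _ ⟨A, hA, rfl⟩
    choose r a hr using fun i => exists_eq_smul_of_mem_pauliGroup (he i) (hA i)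
    refine ⟨∏ i, (r i : ℂ), a, Finset.prod_ne_zero_iff.mpr fun i _ => (r i).ne_zero, ?_⟩
    rw [pauliProduct, ← kroneckerProd_smul]
    congr 1
    funext i
    exact hr i
  · intro a
    choose g hg hga using fun i => exists_mem_pauliGroup (he i) (a i)
    refine ⟨g, hg, ?_⟩
    rw [pauliProduct]
    congr 1
    funext i
    exact (hga i).symm

end Kronecker

/-! ### The examples of Pauli type -/

section Pauli

attribute [local instance] LieRing.ofAssociativeRing

theorem pauliIndex_nontrivial {k : ℕ} {n : Fin k → ℕ} (hk : 1 ≤ k) (hn : ∀ i, 1 < n i) :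
    Nontrivial (PauliIndex n) := by
  have := Fact.mk (hn ⟨0, hk⟩)
  have : Nontrivial (ZMod (n ⟨0, hk⟩) × ZMod (n ⟨0, hk⟩)) := inferInstance
  exact Pi.nontrivial_at ⟨0, hk⟩

/-- The automorphism τ needed for uniqueness exchanges the exponents of X and Y in every factor,
which inverts β. -/
theorem exists_isInnerRealization_sl {k : ℕ} {n : Fin k → ℕ} {ε : Fin k → ℂ} (hk : 1 ≤ k)
    (hn : ∀ i, 1 < n i) (hε : ∀ i, IsPrimitiveRoot (ε i) (n i)) :
    ∃ S : FiniteRootSystem.{0}, IsInnerRealization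
      (adGroup (LieAlgebra.SpecialLinear.sl (∀ i, Fin (n i)) ℂ) (pauliTensor n ε)) S ∧
      (∀ a : S.G, a ≠ 0 → a ∈ S.R) ∧
      ∃ τ : S.G ≃+ S.G, ∀ a b, S.β (τ a) (τ b) = (S.β a b)⁻¹ := by
  have hne : ∀ i, NeZero (n i) := fun i => ⟨by have := hn i; omega⟩
  have := pauliIndex_nontrivial hk hn
  choose e he using fun i => exists_isFaithfulChar (hε i)
  have H := weylFamily_pauliProduct he
  refine ⟨fullRootSystem H.alternating H.nondegenerate,
    H.isInnerRealization_sl (spans_pauliTensor he),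
    fun _ h => h, AddEquiv.piCongrRight fun i => AddEquiv.prodComm, fun a b => ?_⟩
  change PauliIndex n at a b
  change pauliBicharacter he (fun i => (a i).swap) (fun i => (b i).swap) =
    (pauliBicharacter he a b)⁻¹
  rw [pauliBicharacter_apply, pauliBicharacter_apply, ← Finset.prod_inv_distrib]
  refine Finset.prod_congr rfl fun i _ => ?_
  rw [← (he i).map_neg, Prod.fst_swap, Prod.snd_swap, Prod.fst_swap, Prod.snd_swap]
  congr 1
  ring

/-! ### Pauli matrices of size two -/

/-- Over ℤ/2 the support q = p + a_2 is symmetric in p and q, and exchanging them changes the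
exponent a_1(-1 - p) by a_1 a_2. -/
theorem weylMatrix_transpose (a : ZMod 2 × ZMod 2) :
    (weylMatrix signChar a)ᵀ = (signChar (a.1 * a.2) : ℂ) • weylMatrix signChar a := by
  ext p q
  have h2 := zmod_two_add_self
  rw [Matrix.transpose_apply, Matrix.smul_apply, weylMatrix_apply, weylMatrix_apply, smul_eq_mul]
  have hiff : ((p : ℕ) : ZMod 2) = (q : ℕ) + a.2 ↔ ((q : ℕ) : ZMod 2) = (p : ℕ) + a.2 :=
    ⟨fun h => by linear_combination -h - h2 a.2, fun h => by linear_combination -h - h2 a.2⟩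
  by_cases h : ((q : ℕ) : ZMod 2) = (p : ℕ) + a.2
  · rw [if_pos h, if_pos (hiff.mpr h), ← Units.val_mul, ← signChar_add, h]
    congr 2
    linear_combination -h2 (a.1 * a.2)
  · rw [if_neg h, if_neg (hiff.not.mpr h), mul_zero]

theorem signChar_sum {ι : Type*} (s : Finset ι) (f : ι → ZMod 2) :
    signChar (∑ i ∈ s, f i) = ∏ i ∈ s, signChar (f i) := by
  classical
  induction s using Finset.induction_on with
  | empty => exact signChar_zero
  | insert i s hi ih => rw [Finset.sum_insert hi, Finset.prod_insert hi, signChar_add, ih]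

variable {k : ℕ}

/-- The quadratic form `∑ a_i b_i` on `((ℤ/2)^2)^k`. -/
def pauliForm (a : PauliIndex fun _ : Fin k => 2) : ZMod 2 := ∑ i, (a i).1 * (a i).2

theorem pauliProduct_transpose (a : PauliIndex fun _ : Fin k => 2) :
    (pauliProduct (fun _ => signChar) a)ᵀ =
      (signChar (pauliForm a) : ℂ) • pauliProduct (fun _ => signChar) a := by
  have h1 : (signChar (pauliForm a) : ℂ) = ∏ i, (signChar ((a i).1 * (a i).2) : ℂ) := by
    rw [pauliForm, signChar_sum]
    exact map_prod (Units.coeHom ℂ) _ _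
  rw [pauliProduct, kroneckerProd_transpose, h1, ← kroneckerProd_smul]
  congr 1
  funext i
  exact weylMatrix_transpose (a i)

theorem pauliIndex_add_self (a : PauliIndex fun _ : Fin k => 2) : a + a = 0 :=
  funext fun _ => Prod.ext (zmod_two_add_self _) (zmod_two_add_self _)

theorem pauliForm_single (i : Fin k) (x : ZMod 2 × ZMod 2) :
    pauliForm (Pi.single i x : PauliIndex fun _ : Fin k => 2) = x.1 * x.2 := by
  rw [pauliForm, Finset.sum_eq_single i]
  · rw [Pi.single_eq_same]
  · intro j _ hj
    rw [Pi.single_eq_of_ne hj]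
    exact mul_zero _
  · simp

theorem pauliForm_single_add_single {i j : Fin k} (hij : i ≠ j) (x y : ZMod 2 × ZMod 2) :
    pauliForm (Pi.single i x + Pi.single j y : PauliIndex fun _ : Fin k => 2) =
      x.1 * x.2 + y.1 * y.2 := by
  rw [pauliForm, Finset.sum_eq_add i j hij]
  · rw [Pi.add_apply, Pi.add_apply, Pi.single_eq_same, Pi.single_eq_same, Pi.single_eq_of_ne hij,
      Pi.single_eq_of_ne hij.symm, add_zero, zero_add]
  · rintro l - ⟨hli, hlj⟩
    rw [Pi.add_apply, Pi.single_eq_of_ne hli, Pi.single_eq_of_ne hlj, add_zero]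
    exact mul_zero _
  · simp
  · simp

/-- Each factor (ℤ/2)² is generated by the vectors (x,0) and (0,y), on which the form vanishes. -/
theorem pauliIndex_eq_top {K : AddSubgroup (PauliIndex fun _ : Fin k => 2)}
    (hK : ∀ i (x : ZMod 2 × ZMod 2), x.1 * x.2 = 0 → Pi.single i x ∈ K) : K = ⊤ := by
  rw [eq_top_iff]
  rintro a -
  have h : a = ∑ i, Pi.single i (a i) := (Finset.univ_sum_single a).symm
  rw [h]
  refine sum_mem fun i _ => ?_
  have h1 : a i = ((a i).1, 0) + (0, (a i).2) := by rw [Prod.mk_add_mk, add_zero, zero_add]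
  rw [h1, Pi.single_add]
  exact add_mem (hK i _ (mul_zero _)) (hK i _ (zero_mul _))

theorem weylFamily_two :
    WeylFamily (pauliCocycle fun _ : Fin k => isFaithfulChar_signChar)
      (pauliBicharacter fun _ : Fin k => isFaithfulChar_signChar)
      (pauliProduct (n := fun _ : Fin k => 2) fun _ => signChar) :=
  weylFamily_pauliProduct (n := fun _ : Fin k => 2) fun _ => isFaithfulChar_signChar

theorem spans_two :
    (weylFamily_two (k := k)).Spans (pauliTensor (fun _ : Fin k => 2) fun _ => -1) :=
  spans_pauliTensor (n := fun _ : Fin k => 2) fun _ => isFaithfulChar_signChar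

/-- Skew-symmetry is the case j = 0, with roots q(a) = 1. To generate an isotropic x in one factor,
put (1,1) in a second factor: x plus this vector and the vector itself are both roots. -/
theorem exists_isInnerRealization_so_pow (hk : 2 ≤ k) :
    ∃ S : FiniteRootSystem.{0}, IsInnerRealization
      (adGroup (LieAlgebra.Orthogonal.so (Fin k → Fin 2) ℂ)
        (pauliTensor (fun _ : Fin k => 2) (fun _ => -1))) S ∧ ∀ a : S.G, a + a = 0 := by
  have := pauliIndex_nontrivial (k := k) (n := fun _ => 2) (by omega) fun _ => one_lt_two
  have H := weylFamily_two (k := k)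
  have h0 : pauliForm (0 : PauliIndex fun _ : Fin k => 2) = 0 :=
    (H.quadraticPair pauliIndex_add_self pauliProduct_transpose).apply_zero
  refine H.exists_isInnerRealization_of_skew (j := 0) pauliIndex_add_self pauliProduct_transpose
    (fun x => ?_) (pauliIndex_eq_top fun i x hx => ?_) spans_two
  · rw [H.apply_zero, mul_one, one_mul]
    exact LieAlgebra.Orthogonal.mem_so _ _ _
  · obtain ⟨l, hl⟩ : ∃ l : Fin k, l ≠ i := by
      have : Nontrivial (Fin k) := Fin.nontrivial_iff_two_le.mpr hk
      exact exists_ne i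
    have h1 : ∀ a : PauliIndex fun _ : Fin k => 2, pauliForm a = 1 →
        a ∈ AddSubgroup.closure {a | pauliForm (0 : PauliIndex fun _ : Fin k => 2) +
          pauliForm (0 + a) = 1} := fun a ha =>
      AddSubgroup.subset_closure (by rw [Set.mem_ofPred_eq, zero_add, h0, zero_add, ha])
    have h2 := add_mem
      (h1 (Pi.single i x + Pi.single l (1, 1)) (by
        rw [pauliForm_single_add_single hl.symm, hx, zero_add]
        exact one_mul (1 : ZMod 2)))
      (h1 (Pi.single l (1, 1)) (by
        rw [pauliForm_single]
        exact one_mul (1 : ZMod 2)))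
    rwa [add_assoc, pauliIndex_add_self, add_zero] at h2

/-- For n = 2 the product XY is minus the matrix of φ₁; the sign does not affect the Lie algebra of
the form. -/
theorem symplecticForm_eq (hk : 1 ≤ k) :
    symplecticForm k = -pauliProduct (fun _ => signChar)
      (Pi.single ⟨0, hk⟩ (1, 1) : PauliIndex fun _ : Fin k => 2) := by
  have h1 : (∏ i : Fin k, if i = ⟨0, hk⟩ then (-1 : ℂ) else 1) = -1 := by
    rw [Finset.prod_ite_eq' Finset.univ (⟨0, hk⟩ : Fin k) fun _ => (-1 : ℂ)]
    simp
  have h2 : ∀ M : Matrix (Fin k → Fin 2) (Fin k → Fin 2) ℂ,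
      -M = (∏ i : Fin k, if i = ⟨0, hk⟩ then (-1 : ℂ) else 1) • M := fun M => by
    rw [h1, neg_one_smul]
  rw [symplecticForm, pauliProduct, h2, ← kroneckerProd_smul]
  congr 1
  funext i
  by_cases hi : i = ⟨0, hk⟩
  · subst hi
    rw [if_pos rfl, if_pos rfl, Pi.single_eq_same]
    ext p q
    fin_cases p <;> fin_cases q
    · simp [weylMatrix_apply]
    · have h2 : (-1 : ZMod 2) = 1 := by decide
      simp [weylMatrix_apply, h2, signChar_one]
    · have h3 : (0 : ZMod 2) = 1 + 1 := by decide
      simp [weylMatrix_apply, signChar_zero, ← h3]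
    · simp [weylMatrix_apply]
  · rw [if_neg fun h => hi (Fin.ext h), if_neg hi, Pi.single_eq_of_ne hi, one_smul,
      weylMatrix_zero isFaithfulChar_signChar]

/-- Since q(j) = 1, the roots are the a with q(j + a) = 0. In the factor of j both (1,0) and (0,1)
are roots; for isotropic x in another factor, x plus (1,0) in the factor of j is a root, and (1,0)
is subtracted. -/
theorem exists_isInnerRealization_sp (hk : 1 ≤ k) :
    ∃ S : FiniteRootSystem.{0}, IsInnerRealization
      (adGroup (skewAdjointMatricesLieSubalgebra (symplecticForm k))
        (pauliTensor (fun _ : Fin k => 2) (fun _ => -1))) S ∧ ∀ a : S.G, a + a = 0 := by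
  have := pauliIndex_nontrivial (k := k) (n := fun _ => 2) hk fun _ => one_lt_two
  have H := weylFamily_two (k := k)
  refine H.exists_isInnerRealization_of_skew (j := Pi.single ⟨0, hk⟩ (1, 1)) pauliIndex_add_self
    pauliProduct_transpose (fun x => ?_) (pauliIndex_eq_top fun i x hx => ?_) spans_two
  · rw [mem_skewAdjointMatricesLieSubalgebra, mem_skewAdjointMatricesSubmodule,
      Matrix.IsSkewAdjoint, Matrix.IsAdjointPair, symplecticForm_eq hk, mul_neg, neg_mul_neg,
      neg_eq_iff_eq_neg]
  · set j : PauliIndex fun _ : Fin k => 2 := Pi.single ⟨0, hk⟩ (1, 1) with hj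
    have hqj : pauliForm j = 1 := by rw [hj, pauliForm_single]; exact one_mul (1 : ZMod 2)
    have h1 : ∀ a : PauliIndex fun _ : Fin k => 2, pauliForm (j + a) = 0 →
        a ∈ AddSubgroup.closure {a | pauliForm j + pauliForm (j + a) = 1} := fun a ha =>
      AddSubgroup.subset_closure (by rw [Set.mem_ofPred_eq, ha, hqj, add_zero])
    have h3 : ∀ y : ZMod 2 × ZMod 2, ((1, 1) + y).1 * ((1, 1) + y).2 = 0 →
        Pi.single ⟨0, hk⟩ y ∈ AddSubgroup.closure {a | pauliForm j + pauliForm (j + a) = 1} :=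
      fun y hy => h1 _ (by rw [hj, ← Pi.single_add, pauliForm_single, hy])
    have h10 := h3 (1, 0) (by decide)
    by_cases hi : ⟨0, hk⟩ = i
    · subst hi
      have h01 := h3 (0, 1) (by decide)
      obtain ⟨x₁, x₂⟩ := x
      rcases zmod_two_cases x₁ with rfl | rfl <;> rcases zmod_two_cases x₂ with rfl | rfl
      · rw [show ((0 : ZMod 2), (0 : ZMod 2)) = 0 from rfl, Pi.single_zero]
        exact zero_mem _
      · exact h01
      · exact h10
      · exact absurd hx (by decide)
    · have h5 : (((1, 1) : ZMod 2 × ZMod 2) + (1, 0)).1 * (((1, 1) : ZMod 2 × ZMod 2) + (1, 0)).2 =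
          0 := by decide
      have h2 := add_mem (h1 ((Pi.single ⟨0, hk⟩ (1, 0) : PauliIndex fun _ : Fin k => 2) +
        Pi.single i x) (by
        rw [hj, ← add_assoc, ← Pi.single_add, pauliForm_single_add_single hi, hx, add_zero]
        exact h5)) h10
      rwa [add_right_comm, pauliIndex_add_self, zero_add] at h2

theorem exists_isOuterRealization_sl (hk : 2 ≤ k) :
    ∃ S : FiniteRootSystem.{0}, IsOuterRealization
      (adGroup (LieAlgebra.SpecialLinear.sl (Fin k → Fin 2) ℂ)
          (pauliTensor (fun _ : Fin k => 2) (fun _ => -1)) ⊔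
        negTransposeGroup (LieAlgebra.SpecialLinear.sl (Fin k → Fin 2) ℂ)) S ∧
      ∀ a : S.G, a + a = 0 := by
  have := pauliIndex_nontrivial (k := k) (n := fun _ => 2) (by omega) fun _ => one_lt_two
  have H := weylFamily_two (k := k)
  have hQ := H.quadraticPair pauliIndex_add_self pauliProduct_transpose
  refine ⟨_, H.isOuterRealization_sl pauliIndex_add_self pauliProduct_transpose spans_two
    fun b b' => ?_, fun a => Prod.ext (pauliIndex_add_self _) (zmod_two_add_self _)⟩
  -- By the pigeonhole principle, as 4^k > 4, two different elements have the same pairings with b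
  -- and with b'; their sum is nonzero and commutes with both.
  let f : PauliIndex (fun _ : Fin k => 2) → ZMod 2 × ZMod 2 := fun a =>
    (pauliForm a + pauliForm b + pauliForm (a + b), pauliForm a + pauliForm b' + pauliForm (a + b'))
  have hf : ¬Function.Injective f := fun hinj => by
    have h1 := Nat.card_le_card_of_injective f hinj
    rw [H.card, Nat.card_prod, Nat.card_zmod, Fintype.card_fun, Fintype.card_fin,
      Fintype.card_fin, ← pow_mul] at h1
    have h2 : 2 ^ 4 ≤ 2 ^ (k * 2) := Nat.pow_le_pow_right two_pos (by omega)
    omega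
  rw [Function.Injective] at hf
  push Not at hf
  obtain ⟨c, d, hcd, hne⟩ := hf
  refine ⟨c + d, fun h => hne ?_, ?_, ?_⟩
  · rwa [← eq_neg_iff_add_eq_zero, hQ.neg_eq] at h
  · rw [Bicharacter.add_left, hQ.polar c b, hQ.polar d b, (Prod.mk.inj hcd).1, signChar_mul_self]
  · rw [Bicharacter.add_left, hQ.polar c b', hQ.polar d b', (Prod.mk.inj hcd).2, signChar_mul_self]

end Pauli

/-! ### The classification theorem -/

section Main

variable {L : Type u} [LieRing L] [LieAlgebra ℂ L] {T : Subgroup (L ≃ₗ[ℂ] L)}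

theorem IsInnerRealization.of_pairIso {L' : Type v} [LieRing L'] [LieAlgebra ℂ L']
    {T' : Subgroup (L' ≃ₗ[ℂ] L')} {S : FiniteRootSystem.{0}} (hT : PairIso T T')
    (h : IsInnerRealization T' S) : IsInnerRealization T S :=
  ⟨h.1.of_pairIso hT, h.2⟩

theorem IsOuterRealization.of_pairIso {L' : Type v} [LieRing L'] [LieAlgebra ℂ L']
    {T' : Subgroup (L' ≃ₗ[ℂ] L')} {S : FiniteRootSystem.{0}} (hT : PairIso T T')
    (h : IsOuterRealization T' S) : IsOuterRealization T S :=
  ⟨h.1.of_pairIso hT, h.2⟩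

/-- Only type I allows values of β other than ±1 and needs the argument with moduli; the remaining
grading groups are elementary 2-groups. -/
theorem IsInnerExample.exists_isInnerRealization (hT : IsInnerExample T) :
    ∃ S : FiniteRootSystem.{0}, IsInnerRealization T S ∧
      ∀ S' : FiniteRootSystem.{v}, GradingIso S'.standardGrading S.standardGrading → S'.Iso S := by
  cases hT with
  | typeI k n ε hk hn _ hε h =>
    obtain ⟨S, hS, hR, τ, hτ⟩ := exists_isInnerRealization_sl hk hn hε
    exact ⟨S, hS.of_pairIso h, fun S' h' => S.iso_of_gradingIso_of_forall_mem hR τ hτ h'⟩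
  | typeII k hk h =>
    obtain ⟨S, hS, h2⟩ := exists_isInnerRealization_so_odd hk
    exact ⟨S, hS.of_pairIso h, fun S' => FiniteRootSystem.iso_of_gradingIso_of_two_torsion h2⟩
  | typeIII k hk h =>
    obtain ⟨S, hS, h2⟩ := exists_isInnerRealization_sp hk
    exact ⟨S, hS.of_pairIso h, fun S' => FiniteRootSystem.iso_of_gradingIso_of_two_torsion h2⟩
  | typeIV k hk h =>
    obtain ⟨S, hS, h2⟩ := exists_isInnerRealization_so_even (n := 2 * k) (by omega) (even_two_mul k)
    exact ⟨S, hS.of_pairIso h, fun S' => FiniteRootSystem.iso_of_gradingIso_of_two_torsion h2⟩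
  | typeV k hk h =>
    obtain ⟨S, hS, h2⟩ := exists_isInnerRealization_so_pow (k := k) (by omega)
    exact ⟨S, hS.of_pairIso h, fun S' => FiniteRootSystem.iso_of_gradingIso_of_two_torsion h2⟩

theorem IsOuterExample.exists_isOuterRealization (hT : IsOuterExample T) :
    ∃ S : FiniteRootSystem.{0}, IsOuterRealization T S ∧
      ∀ S' : FiniteRootSystem.{v}, GradingIso S'.standardGrading S.standardGrading → S'.Iso S := by
  cases hT with
  | typeI' k hk h =>
    obtain ⟨S, hS, h2⟩ := exists_isOuterRealization_sl hk
    exact ⟨S, hS.of_pairIso h, fun S' => FiniteRootSystem.iso_of_gradingIso_of_two_torsion h2⟩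
  | typeIV' k hk h =>
    obtain ⟨S, hS, h2⟩ := exists_isOuterRealization_so_even (n := 2 * k) (by omega)
    exact ⟨S, hS.of_pairIso h, fun S' => FiniteRootSystem.iso_of_gradingIso_of_two_torsion h2⟩

end Main

theorem mainTheorem3 {L : Type u} [LieRing L] [LieAlgebra ℂ L] (T : Subgroup (L ≃ₗ[ℂ] L))
    (hT : IsInnerExample T ∨ IsOuterExample T) :
    (IsInnerExample T → IsGoodFiniteMaximalQuasitorus (lieInt L) T) ∧
    (IsOuterExample T → IsGoodFiniteMaximalQuasitorus (lieAut L) T) ∧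
    ∃ S : FiniteRootSystem.{0}, S.CorrespondsTo T ∧
      ∀ S' : FiniteRootSystem.{v}, S'.CorrespondsTo T → S'.Iso S := by
  refine ⟨fun h => ?_, fun h => ?_, ?_⟩
  · obtain ⟨S, ⟨hS, hβ, hR⟩, -⟩ := IsInnerExample.exists_isInnerRealization.{u, 0} h
    exact hS.isGood_lieInt hβ hR
  · obtain ⟨S, ⟨hS, huniv⟩, -⟩ := IsOuterExample.exists_isOuterRealization.{u, 0} h
    exact hS.isGood_lieAut huniv
  · obtain ⟨S, hS, huniq⟩ : ∃ S : FiniteRootSystem.{0}, S.Realizes T ∧ ∀ S' : FiniteRootSystem.{v},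
        GradingIso S'.standardGrading S.standardGrading → S'.Iso S := by
      rcases hT with h | h
      · obtain ⟨S, hS, huniq⟩ := h.exists_isInnerRealization
        exact ⟨S, hS.1, huniq⟩
      · obtain ⟨S, hS, huniq⟩ := h.exists_isOuterRealization
        exact ⟨S, hS.1, huniq⟩
    exact ⟨S, hS.correspondsTo, fun S' hS' =>
      huniq S' (FiniteRootSystem.gradingIso_of_correspondsTo hS' hS.correspondsTo)⟩
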